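/- **Setting.** Let $N\ge 1$, $\alpha\in(0,1)$, and let $\Omega\subset\mathbb R^N$ be a nonempty bounded open set with boundary of class $C^{2,\alpha}$. Let $p>1$, with $p<\frac{N+2}{N-2}$ if $N\ge 3$; put $m=1/p$, let $T>0$ and $c=\frac{1}{(1-m)T}=\frac{p}{(p-1)T}$. Let $u_0\ge 0$ satisfy (H0): $u_0\in L^q(\Omega)$ for some $q\ge 1$, with $q>\frac{N(1-m)}2$ in case $m<\frac{N-2}{N}$. Let $v\ge 0$ be a solution of the rescaled fast diffusion problem $$\partial_t v^p=\Delta v+c\,v^p\ \text{ in }(0,\infty)\times\Omega,\qquad v=0\ \text{ on }(0,\infty)\times\partial\Omega,\qquad v(0,\cdot)^p=u_0,$$ in the weak sense: $v^p\in C([0,\infty);L^1(\Omega))$, $v\in L^2_{\rm loc}((0,\infty);H^1_0(\Omega))$, and the equation holds when tested against $C_c^\infty((0,\infty)\times\Omega)$. Let $V\in C^2(\Omega)\cap C(\overline\Omega)$ be the positive classical solution of $-\Delta V=c\,V^p$ in $\Omega$, $V=0$ on $\partial\Omega$, to which $v$ converges, i.e. $\|v(t)^p-V^p\|_{L^\infty(\Omega)}\to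 0$ as $t\to\infty$. Let $0<\lambda_{V,1}<\lambda_{V,2}<\dots$ be the distinct eigenvalues of the Dirichlet Laplacian on $L^2(\Omega;V^{p-1}dx)$, that is, the numbers $\lambda$ for which $-\Delta\varphi=\lambda V^{p-1}\varphi$ has a nontrivial weak solution $\varphi\in H^1_0(\Omega)$. Let $k_p$ be the largest integer $k$ with $\lambda_{V,k}<pc$, and put $\lambda_p=\lambda_{V,k_p+1}-cp$. The nonlinear entropy is $$\mathcal E[v]=\int_\Omega\Big[(v^{p+1}-V^{p+1})-\tfrac{p+1}{p}(v^p-V^p)V\Big]dx .$$ **Proposition (sharp exponential decay for the entropy).** Assume that * (H1')$_\delta$: for some $0<\delta<\frac1{2p}$ and $t_0\ge1$, $|v(t,x)-V(x)|\le\delta V(x)$ for a.e. $(t,x)\in[t_0,\infty)\times\Omega$; * (H2): the problem $-\Delta\varphi=cp\,V^{p-1}\varphi$ in $\Omega$, $\varphi=0$ on $\partial\Omega$, has no nontrivial solution $\varphi\in H_0^1(\Omega)$; * for some $\eta>0$ and $\overline\kappa>0$, $$\Big\|\frac{v(t)-V}{V}\Big\|_{L^\infty(\Omega)}\le\overline\kappa\,\mathcal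 E[v(t-1)]^{\eta}\qquad\text{for all }t\ge t_0.$$ Then $\lambda_p>0$, and there exists $T_0\ge t_0$ such that $$\mathcal E[v(t)]\le\overline\kappa_0\,e^{-\frac{2\lambda_p}{p}t}\qquad\text{for all }t\ge T_0,$$ where $\overline\kappa_0>0$ depends only on $p,N,\eta,T_0$ and $\mathcal E[v(T_0)]$. -/

import Mathlib

open MeasureTheory Set Filter Topology
open scoped ContDiff Gradient

noncomputable section

/-- The Euclidean space `ℝ^N`. -/
abbrev Eucl (N : ℕ) : Type := EuclideanSpace ℝ (Fin N)

/-- `Ω` is a nonempty bounded open set whose boundary is of class `C^{2,α}`: near every boundary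
point, `Ω` is the sublevel set `{ρ < 0}` of a `C^{2,α}` function `ρ` with nonvanishing
gradient at that point (equivalently, by the implicit function theorem, `Ω` lies locally on one
side of the graph of a `C^{2,α}` function). -/
structure IsC2AlphaDomain {N : ℕ} (Ω : Set (Eucl N)) (α : ℝ) : Prop where
  isOpen : IsOpen Ω
  nonempty : Ω.Nonempty
  bounded : Bornology.IsBounded Ω
  boundary : ∀ x₀ ∈ frontier Ω, ∃ (U : Set (Eucl N)) (ρ : Eucl N → ℝ),
    IsOpen U ∧ x₀ ∈ U ∧ ContDiffOn ℝ 2 ρ U ∧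
    (∃ C : ℝ, ∀ x ∈ U, ∀ y ∈ U,
      ‖iteratedFDeriv ℝ 2 ρ x - iteratedFDeriv ℝ 2 ρ y‖ ≤ C * ‖x - y‖ ^ α) ∧
    gradient ρ x₀ ≠ 0 ∧
    Ω ∩ U = {x ∈ U | ρ x < 0}

/-- `ψ ∈ C_c^∞(Ω)`. -/
def IsTestFunction {N : ℕ} (Ω : Set (Eucl N)) (ψ : Eucl N → ℝ) : Prop :=
  ContDiff ℝ ∞ ψ ∧ HasCompactSupport ψ ∧ tsupport ψ ⊆ Ω

/-- `φ ∈ C_c^∞((0,∞) × Ω)`, with the time variable first. -/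
def IsSpaceTimeTestFunction {N : ℕ} (Ω : Set (Eucl N)) (φ : ℝ × Eucl N → ℝ) : Prop :=
  ContDiff ℝ ∞ φ ∧ HasCompactSupport φ ∧ tsupport φ ⊆ Ioi (0 : ℝ) ×ˢ Ω

/-- `u ∈ H^1_0(Ω)` with weak gradient `G`: the pair `(u, G)` is the limit in `L²(Ω)` of pairs
`(ψ, ∇ψ)` with `ψ ∈ C_c^∞(Ω)`. -/
def MemH10 {N : ℕ} (Ω : Set (Eucl N)) (u : Eucl N → ℝ) (G : Eucl N → Eucl N) : Prop :=
  MemLp u 2 (volume.restrict Ω) ∧ MemLp G 2 (volume.restrict Ω) ∧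
  ∃ ψ : ℕ → Eucl N → ℝ, (∀ n, IsTestFunction Ω (ψ n)) ∧
    Tendsto (fun n => eLpNorm (fun x => ψ n x - u x) 2 (volume.restrict Ω)) atTop (𝓝 0) ∧
    Tendsto (fun n => eLpNorm (fun x => gradient (ψ n) x - G x) 2 (volume.restrict Ω))
      atTop (𝓝 0)

/-- The constant `c = 1 / ((1 - m) T) = p / ((p - 1) T)`, where `m = 1 / p`. -/
def rateConst (p T : ℝ) : ℝ := p / ((p - 1) * T)

/-- Condition (H0) on the initial datum `u₀`, for the exponent `m`. -/
def InitialDatumCondition {N : ℕ} (Ω : Set (Eucl N)) (m : ℝ) (u₀ : Eucl N → ℝ) : Prop :=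
  (∀ᵐ x ∂(volume.restrict Ω), 0 ≤ u₀ x) ∧
  ∃ q : ℝ, 1 ≤ q ∧ (m < ((N : ℝ) - 2) / N → (N : ℝ) * (1 - m) / 2 < q) ∧
    MemLp u₀ (ENNReal.ofReal q) (volume.restrict Ω)

/-- `v = w^m` (with `p = 1 / m`, i.e. `w = v^p`), where `w` is a nonnegative weak solution of
the rescaled Cauchy–Dirichlet problem `w_t = Δ(w^m) + c w` in `(0,∞) × Ω`, `w = 0` on
`(0,∞) × ∂Ω`, `w(0,·) = u₀`; equivalently `∂_t v^p = Δ v + c v^p`. Here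
`w ∈ C([0,∞); L¹(Ω))`, `v ∈ L²_loc((0,∞); H^1_0(Ω))`. -/
structure IsRCDPSolution {N : ℕ} (Ω : Set (Eucl N)) (p T : ℝ) (u₀ : Eucl N → ℝ)
    (v : ℝ → Eucl N → ℝ) : Prop where
  nonneg : ∀ t, 0 ≤ t → ∀ᵐ x ∂(volume.restrict Ω), 0 ≤ v t x
  integrable : ∀ t, 0 ≤ t → IntegrableOn (fun x => v t x ^ p) Ω
  continuous_L1 : ∀ s, 0 ≤ s →
    Tendsto (fun t => ∫ x in Ω, |v t x ^ p - v s x ^ p|) (𝓝[Ici 0] s) (𝓝 0)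
  initial : ∀ᵐ x ∂(volume.restrict Ω), v 0 x ^ p = u₀ x
  measurable : AEStronglyMeasurable (fun z : ℝ × Eucl N => v z.1 z.2)
    (volume.restrict (Ioi (0 : ℝ) ×ˢ Ω))
  weak : ∃ G : ℝ → Eucl N → Eucl N,
    AEStronglyMeasurable (fun z : ℝ × Eucl N => G z.1 z.2)
      (volume.restrict (Ioi (0 : ℝ) ×ˢ Ω)) ∧
    (∀ᵐ t ∂(volume.restrict (Ioi (0 : ℝ))), MemH10 Ω (v t) (G t)) ∧
    (∀ a b : ℝ, 0 < a → a < b →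
      MemLp (fun z : ℝ × Eucl N => G z.1 z.2) 2 (volume.restrict (Ioo a b ×ˢ Ω))) ∧
    ∀ φ : ℝ × Eucl N → ℝ, IsSpaceTimeTestFunction Ω φ →
      ∫ z in Ioi (0 : ℝ) ×ˢ Ω,
        (v z.1 z.2 ^ p * deriv (fun s => φ (s, z.2)) z.1
          - inner ℝ (G z.1 z.2) (gradient (fun y => φ (z.1, y)) z.2)
          + rateConst p T * v z.1 z.2 ^ p * φ z) = 0

/-- `V` is a positive classical solution of `-ΔV = c V^p` in `Ω`, `V = 0` on `∂Ω`. -/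
structure IsPositiveStationarySolution {N : ℕ} (Ω : Set (Eucl N)) (p c : ℝ)
    (V : Eucl N → ℝ) : Prop where
  continuousOn : ContinuousOn V (closure Ω)
  contDiffOn : ContDiffOn ℝ 2 V Ω
  pos : ∀ x ∈ Ω, 0 < V x
  boundary : ∀ x ∈ frontier Ω, V x = 0
  equation : ∀ x ∈ Ω, -(Laplacian.laplacian V x) = c * V x ^ p

/-- `φ ∈ H^1_0(Ω)` is a (weak) solution of the homogeneous Dirichlet problem
`-Δφ = μ V^{p-1} φ` in `Ω`, `φ = 0` on `∂Ω`. -/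
def IsWeightedDirichletSolution {N : ℕ} (Ω : Set (Eucl N)) (p : ℝ) (V : Eucl N → ℝ) (μ : ℝ)
    (φ : Eucl N → ℝ) : Prop :=
  ∃ G : Eucl N → Eucl N, MemH10 Ω φ G ∧
    ∀ ψ : Eucl N → ℝ, IsTestFunction Ω ψ →
      ∫ x in Ω, inner ℝ (G x) (gradient ψ x) = μ * ∫ x in Ω, φ x * ψ x * V x ^ (p - 1)

/-- `μ` is an eigenvalue of the Dirichlet Laplacian `-Δ` on `L²(Ω; V^{p-1} dx)`. -/
def IsWeightedEigenvalue {N : ℕ} (Ω : Set (Eucl N)) (p : ℝ) (V : Eucl N → ℝ) (μ : ℝ) : Prop :=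
  ∃ φ : Eucl N → ℝ, IsWeightedDirichletSolution Ω p V μ φ ∧
    ¬ (φ =ᵐ[volume.restrict Ω] fun _ => 0)

/-- The distinct eigenvalues `λ_{V,1} < λ_{V,2} < …` of the Dirichlet Laplacian on
`L²(Ω; V^{p-1} dx)`, in increasing order. All of them are positive; the value at index `0` is
set to `0`, so that `λ_{V,k+1}` is always the smallest eigenvalue above `λ_{V,k}`. -/
def weightedEigenvalue {N : ℕ} (Ω : Set (Eucl N)) (p : ℝ) (V : Eucl N → ℝ) : ℕ → ℝ
  | 0 => 0
  | k + 1 => sInf {μ : ℝ | IsWeightedEigenvalue Ω p V μ ∧ weightedEigenvalue Ω p V k < μ}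

/-- Condition (H2): the equation `-Δφ = c p V^{p-1} φ` with zero Dirichlet data has only the
trivial solution. -/
def NondegeneracyCondition {N : ℕ} (Ω : Set (Eucl N)) (p c : ℝ) (V : Eucl N → ℝ) : Prop :=
  ∀ φ : Eucl N → ℝ, IsWeightedDirichletSolution Ω p V (c * p) φ →
    φ =ᵐ[volume.restrict Ω] fun _ => 0

/-- `k_p`, the largest integer `k` with `λ_{V,k} < p c`. -/
def indexKp {N : ℕ} (Ω : Set (Eucl N)) (p c : ℝ) (V : Eucl N → ℝ) : ℕ :=
  sSup {k : ℕ | weightedEigenvalue Ω p V k < p * c}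

/-- `λ_p = λ_{V,k_p+1} - c p`. -/
def lambdaP {N : ℕ} (Ω : Set (Eucl N)) (p c : ℝ) (V : Eucl N → ℝ) : ℝ :=
  weightedEigenvalue Ω p V (indexKp Ω p c V + 1) - c * p

/-- The nonlinear entropy
`E[v] = ∫_Ω [(v^{p+1} - V^{p+1}) - ((p+1)/p) (v^p - V^p) V] dx`. -/
def entropy {N : ℕ} (Ω : Set (Eucl N)) (p : ℝ) (V v : Eucl N → ℝ) : ℝ :=
  ∫ x in Ω, ((v x ^ (p + 1) - V x ^ (p + 1)) - (p + 1) / p * (v x ^ p - V x ^ p) * V x)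

/-- Condition (H1')_δ on `[t₀,∞)`: `|v(t,x) - V(x)| ≤ δ V(x)` for a.e.
`(t,x) ∈ [t₀,∞) × Ω`. -/
def RelativeErrorCondition {N : ℕ} (Ω : Set (Eucl N)) (V : Eucl N → ℝ) (v : ℝ → Eucl N → ℝ)
    (δ t₀ : ℝ) : Prop :=
  ∀ᵐ z : ℝ × Eucl N ∂(volume.restrict (Ici t₀ ×ˢ Ω)), |v z.1 z.2 - V z.2| ≤ δ * V z.2

end

/-! ### Spectral theory of compact symmetric operators -/

section Spectral

open Module.End

variable {H : Type*} [NormedAddCommGroup H] [InnerProductSpace ℝ H]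

/-! Put w = V^((p-1)/2), X = v^p / w, Y = w v, and let W = X - X₀, F = Y - Y₀ be the deviations from
the values at v = V. Let T = w (-Δ)⁻¹ w on L²(Ω). Applying w (-Δ)⁻¹ to the equation turns it into an
evolution in a Hilbert space, (T W)' = -F + c T W. The operator T is compact, symmetric and
positive, and its eigenvalues are the reciprocals of the weighted eigenvalues λ. The entropy E is
comparable with ‖W‖², and W - p F is small relative to W, by a factor O(E(t-1)^η) thanks to the
assumed bound on the relative error.

If F were exactly W / p, a mode with eigenvalue λ would evolve like exp(-(λ - c p) t / p).
Nondegeneracy excludes λ = c p, so W splits into a stable part P W (λ ≥ c p + λ_p) and an unstable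
part W - P W (λ < c p). Let n = ⟨T P W, P W⟩ and a = ⟨T (W - P W), W - P W⟩. In spite of the error
term, a - n is eventually nondecreasing; since v converges to V it tends to 0, hence a ≤ n and the
stable part controls everything. This gives n' ≤ -(2 λ_p / p - k E(t-1)^η) n and n' ≤ -k' E
(`exists_sharp_decay`).

It remains to return from n, a weaker norm, to E. Convexity of the entropy in v^p shows that E grows
at most exponentially (`exists_exponential_growth_bound`), and the dissipation of n over a unit time
then yields E(s+1) ≤ C n(s). A first decay at half the rate makes the defect E(t-1)^η exponentially
small, hence integrable, and the sharp rate follows (`exists_sharp_exponential_bound`).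

The analytic input is Rellich's theorem (`isCompactOperator_potential`), the spectral gap
(`lambdaP_spec`), and the weak equation tested with (-Δ)⁻¹(w x)
(`integral_deriv_mul_inner_eq_zero`). The resulting multiplicative constant, which depends on all
the data, is absorbed by choosing T₀ late. -/

theorem exists_orthogonal_eigenvector_sum {T : H →L[ℝ] H} (hT : T.IsSymmetric) {ι : Type*}
    {f : ι → ℝ} (hf : Function.Injective f) {v : H}
    (hv : v ∈ ⨆ i, eigenspace (T : Module.End ℝ H) (f i)) :
    ∃ (s : Finset ι) (x : ι → H), (∀ i, T (x i) = f i • x i) ∧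
      ‖v‖ ^ 2 = ∑ i ∈ s, ‖x i‖ ^ 2 ∧ inner ℝ (T v) v = ∑ i ∈ s, f i * ‖x i‖ ^ 2 := by
  classical
  obtain ⟨g, rfl⟩ := (Submodule.mem_iSup_iff_exists_dfinsupp' _ _).mp hv
  have hx : ∀ i, T (g i : H) = f i • (g i : H) := fun i => mem_eigenspace_iff.mp (g i).2
  have horth : OrthogonalFamily ℝ (fun i : ι => eigenspace (T : Module.End ℝ H) (f i))
      fun i => (eigenspace (T : Module.End ℝ H) (f i)).subtypeₗᵢ :=
    (LinearMap.IsSymmetric.orthogonalFamily_eigenspaces hT).comp hf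
  refine ⟨g.support, fun i => g i, hx, ?_, ?_⟩
  · rw [← real_inner_self_eq_norm_sq]
    have h := horth.inner_sum (fun i => g i) (fun i => g i) g.support
    change inner ℝ (∑ i ∈ g.support, (g i : H)) (∑ i ∈ g.support, (g i : H)) = _ at h
    simp only [DFinsupp.sum]
    rw [h]
    exact Finset.sum_congr rfl fun i _ => by rw [real_inner_self_eq_norm_sq]; rfl
  · have h := horth.inner_sum (fun i => f i • g i) (fun i => g i) g.support
    change inner ℝ (∑ i ∈ g.support, f i • (g i : H)) (∑ i ∈ g.support, (g i : H)) = _ at h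
    simp only [DFinsupp.sum, map_sum, hx]
    rw [h]
    exact Finset.sum_congr rfl fun i _ => by
      rw [real_inner_smul_left, real_inner_self_eq_norm_sq]; rfl

/-- On finite sums of eigenvectors the form is a weighted sum of squares; closedness of the
inequality does the rest. The family `f` may list numbers that are not eigenvalues, and these do not
constrain `m`. -/
theorem le_inner_of_mem_iSup_eigenspace {T : H →L[ℝ] H} (hT : T.IsSymmetric) {ι : Type*}
    {f : ι → ℝ} (hf : Function.Injective f) {m : ℝ}
    (hm : ∀ i, HasEigenvalue (T : Module.End ℝ H) (f i) → m ≤ f i) {v : H}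
    (hv : v ∈ (⨆ i, eigenspace (T : Module.End ℝ H) (f i)).topologicalClosure) :
    m * ‖v‖ ^ 2 ≤ inner ℝ (T v) v := by
  have hcl : IsClosed {v : H | m * ‖v‖ ^ 2 ≤ inner ℝ (T v) v} :=
    isClosed_le (by fun_prop) (by fun_prop)
  refine closure_minimal (fun w hw => ?_) hcl hv
  obtain ⟨s, x, hx, h1, h2⟩ := exists_orthogonal_eigenvector_sum hT hf hw
  rw [mem_ofPred_eq, h1, h2, Finset.mul_sum]
  refine Finset.sum_le_sum fun i _ => ?_
  by_cases h0 : x i = 0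
  · simp [h0]
  · exact mul_le_mul_of_nonneg_right
      (hm i (hasEigenvalue_of_hasEigenvector ⟨mem_eigenspace_iff.mpr (hx i), h0⟩)) (by positivity)

theorem inner_le_of_mem_iSup_eigenspace {T : H →L[ℝ] H} (hT : T.IsSymmetric) {ι : Type*}
    {f : ι → ℝ} (hf : Function.Injective f) {m : ℝ}
    (hm : ∀ i, HasEigenvalue (T : Module.End ℝ H) (f i) → f i ≤ m) {v : H}
    (hv : v ∈ (⨆ i, eigenspace (T : Module.End ℝ H) (f i)).topologicalClosure) :
    inner ℝ (T v) v ≤ m * ‖v‖ ^ 2 := by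
  have hcl : IsClosed {v : H | inner ℝ (T v) v ≤ m * ‖v‖ ^ 2} :=
    isClosed_le (by fun_prop) (by fun_prop)
  refine closure_minimal (fun w hw => ?_) hcl hv
  obtain ⟨s, x, hx, h1, h2⟩ := exists_orthogonal_eigenvector_sum hT hf hw
  rw [mem_ofPred_eq, h1, h2, Finset.mul_sum]
  refine Finset.sum_le_sum fun i _ => ?_
  by_cases h0 : x i = 0
  · simp [h0]
  · exact mul_le_mul_of_nonneg_right
      (hm i (hasEigenvalue_of_hasEigenvector ⟨mem_eigenspace_iff.mpr (hx i), h0⟩)) (by positivity)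

/-- Unit eigenvectors for distinct eigenvalues are orthogonal, so their images are at mutual
distance at least r. Infinitely many of them would contradict compactness. -/
theorem finite_eigenvalues_of_isCompactOperator {T : H →L[ℝ] H} (hT : T.IsSymmetric)
    (hc : IsCompactOperator T) {r : ℝ} (hr : 0 < r) :
    {ν : ℝ | HasEigenvalue (T : Module.End ℝ H) ν ∧ r ≤ ν}.Finite := by
  by_contra hinf
  have hinf' : {ν : ℝ | HasEigenvalue (T : Module.End ℝ H) ν ∧ r ≤ ν}.Infinite := hinf
  set ν := hinf'.natEmbedding with hν
  have hmem : ∀ n, HasEigenvalue (T : Module.End ℝ H) (ν n : ℝ) ∧ r ≤ (ν n : ℝ) := fun n => (ν n).2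
  have hex : ∀ n, ∃ x : H, ‖x‖ = 1 ∧ T x = (ν n : ℝ) • x := fun n => by
    obtain ⟨x, hx⟩ := (hmem n).1.exists_hasEigenvector
    have hx0 : ‖x‖ ≠ 0 := norm_ne_zero_iff.mpr hx.2
    have hx1 : T x = (ν n : ℝ) • x := mem_eigenspace_iff.mp hx.1
    refine ⟨‖x‖⁻¹ • x, ?_, ?_⟩
    · rw [norm_smul, norm_inv, norm_norm, inv_mul_cancel₀ hx0]
    · rw [map_smul, hx1, smul_comm]
  choose x hx1 hx2 using hex
  have horth : ∀ m n, m ≠ n → inner ℝ (x m) (x n) = (0 : ℝ) := fun m n hmn => by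
    have h := hT (x m) (x n)
    simp only [ContinuousLinearMap.coe_coe, hx2, real_inner_smul_left, real_inner_smul_right] at h
    have hne : (ν m : ℝ) - ν n ≠ 0 :=
      sub_ne_zero.mpr fun h => hmn (ν.injective (Subtype.ext h))
    exact (mul_eq_zero.mp (by linarith : ((ν m : ℝ) - ν n) * inner ℝ (x m) (x n) = 0)).resolve_left
      hne
  obtain ⟨K, hK, hKs⟩ := IsCompactOperator.image_closedBall_subset_compact (f := (T : H →ₗ[ℝ] H)) hc 1
  have hxK : ∀ n, T (x n) ∈ K := fun n => hKs ⟨x n, by simp [hx1 n], rfl⟩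
  obtain ⟨a, -, φ, hφ, hlim⟩ := hK.tendsto_subseq hxK
  have hcau := hlim.cauchySeq
  rw [Metric.cauchySeq_iff'] at hcau
  obtain ⟨n, hn⟩ := hcau r hr
  have h := hn (n + 1) (by omega)
  have hne : φ (n + 1) ≠ φ n := (hφ (Nat.lt_succ_self n)).ne'
  have hsq : r ^ 2 ≤ dist (T (x (φ (n + 1)))) (T (x (φ n))) ^ 2 := by
    rw [dist_eq_norm, norm_sub_sq_real, hx2, hx2, real_inner_smul_left, real_inner_smul_right,
      horth _ _ hne, norm_smul, norm_smul, hx1, hx1]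
    have h1 := (hmem (φ (n + 1))).2
    simp only [Real.norm_eq_abs, mul_one, mul_zero, sub_zero, sq_abs]
    nlinarith [sq_nonneg (ν (φ n) : ℝ)]
  exact absurd h (not_lt.mpr (le_of_sq_le_sq hsq dist_nonneg))

variable [CompleteSpace H]

/-- Otherwise all eigenvalues are at least r, hence finitely many with finite-dimensional
eigenspaces. Their span is finite-dimensional and has trivial orthogonal complement, so it is the
whole space. -/
theorem exists_eigenvalue_lt {T : H →L[ℝ] H} (hT : T.IsSymmetric)
    (hc : IsCompactOperator T) (hpos : ∀ x, x ≠ 0 → 0 < inner ℝ (T x) x)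
    (hinf : ¬ FiniteDimensional ℝ H) {r : ℝ} (hr : 0 < r) :
    ∃ ν, HasEigenvalue (T : Module.End ℝ H) ν ∧ 0 < ν ∧ ν < r := by
  have hpos' : ∀ ν, HasEigenvalue (T : Module.End ℝ H) ν → 0 < ν := fun ν hν => by
    obtain ⟨x, hx⟩ := hν.exists_hasEigenvector
    have hx1 : T x = ν • x := mem_eigenspace_iff.mp hx.1
    have h := hpos x hx.2
    rw [hx1, real_inner_smul_left, real_inner_self_eq_norm_sq] at h
    exact pos_of_mul_pos_left h (by positivity)
  by_contra! hcon
  apply hinf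
  have hall : ∀ ν, HasEigenvalue (T : Module.End ℝ H) ν → r ≤ ν := fun ν hν => hcon ν hν (hpos' ν hν)
  set s := {ν : ℝ | HasEigenvalue (T : Module.End ℝ H) ν ∧ r ≤ ν} with hs
  have hsfin : s.Finite := finite_eigenvalues_of_isCompactOperator hT hc hr
  have : Finite s := hsfin
  have hfd : ∀ ν : s, FiniteDimensional ℝ (eigenspace (T : Module.End ℝ H) ν) := fun ν =>
    ContinuousLinearMap.finite_dimensional_eigenspace hc ν (lt_of_lt_of_le hr ν.2.2).ne'
  have hsup : (⨆ ν, eigenspace (T : Module.End ℝ H) ν) =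
      ⨆ ν : s, eigenspace (T : Module.End ℝ H) ν := by
    refine le_antisymm (iSup_le fun ν => ?_) (iSup_le fun ν => le_iSup _ (ν : ℝ))
    by_cases hν : HasEigenvalue (T : Module.End ℝ H) ν
    · exact le_iSup (fun ν : s => eigenspace (T : Module.End ℝ H) ν) ⟨ν, hν, hall ν hν⟩
    · rw [hasEigenvalue_iff, not_not] at hν
      rw [hν]; exact bot_le
  have hbot := ContinuousLinearMap.orthogonalComplement_iSup_eigenspaces_eq_bot hc hT
  rw [hsup] at hbot
  have hfin : FiniteDimensional ℝ (⨆ ν : s, eigenspace (T : Module.End ℝ H) ν : Submodule ℝ H) :=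
    inferInstance
  have htop := (Submodule.orthogonal_eq_bot_iff).mp hbot
  rw [htop] at hfin
  exact Module.Finite.equiv (Submodule.topEquiv (R := ℝ) (M := H))

/-- P projects onto the orthogonal complement of L, the span of the eigenspaces above b. Both the
complement and the closure of L are invariant under T, so P commutes with T. The separate bound b'
leaves room for a strict inequality on the range of 1 - P. -/
theorem exists_spectral_projection {T : H →L[ℝ] H} (hT : T.IsSymmetric)
    (hc : IsCompactOperator T) {a b b' : ℝ}
    (hgap : ∀ ν, HasEigenvalue (T : Module.End ℝ H) ν → ν ≤ a ∨ b < ν)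
    (hb' : ∀ ν, HasEigenvalue (T : Module.End ℝ H) ν → b < ν → b' ≤ ν) :
    ∃ P : H →L[ℝ] H, P.IsSymmetric ∧ (∀ x, P (P x) = P x) ∧ (∀ x, T (P x) = P (T x)) ∧
      (∀ x, inner ℝ (T (P x)) (P x) ≤ a * ‖P x‖ ^ 2) ∧
      (∀ x, b' * ‖x - P x‖ ^ 2 ≤ inner ℝ (T (x - P x)) (x - P x)) := by
  set L : Submodule ℝ H := ⨆ ν : Ioi b, eigenspace (T : Module.End ℝ H) ν with hL
  have hLinv : ∀ x ∈ L, T x ∈ L := by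
    intro x hx
    have : L ≤ L.comap (T : H →ₗ[ℝ] H) := by
      refine iSup_le fun ν y hy => ?_
      rw [Submodule.mem_comap]
      rw [mem_eigenspace_iff] at hy
      rw [hy]
      exact L.smul_mem _
        ((le_iSup (fun ν : Ioi b => eigenspace (T : Module.End ℝ H) ν) ν) (mem_eigenspace_iff.mpr hy))
    exact this hx
  have hKinv : ∀ x ∈ Lᗮ, T x ∈ Lᗮ := by
    intro x hx
    rw [Submodule.mem_orthogonal] at hx ⊢
    intro u hu
    have := hT u x
    simp only [ContinuousLinearMap.coe_coe] at this
    rw [← this]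
    exact hx _ (hLinv u hu)
  have hKKinv : ∀ x ∈ Lᗮᗮ, T x ∈ Lᗮᗮ := by
    intro x hx
    rw [Submodule.mem_orthogonal] at hx ⊢
    intro u hu
    have := hT u x
    simp only [ContinuousLinearMap.coe_coe] at this
    rw [← this]
    exact hx _ (hKinv u hu)
  refine ⟨Lᗮ.starProjection, Submodule.starProjection_isSymmetric _, ?_, ?_, ?_, ?_⟩
  · intro x
    exact Submodule.starProjection_eq_self_iff.mpr (Submodule.starProjection_apply_mem _ _)
  · intro x
    have h1 : T (Lᗮ.starProjection x) ∈ Lᗮ := hKinv _ (Submodule.starProjection_apply_mem _ _)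
    have h2 : T (x - Lᗮ.starProjection x) ∈ Lᗮᗮ :=
      hKKinv _ (Submodule.sub_starProjection_mem_orthogonal _)
    refine (Submodule.eq_starProjection_of_mem_orthogonal h1 ?_).symm
    rw [← map_sub]
    exact h2
  · intro x
    -- Every eigenvalue of the restriction is at most a: an eigenvector with eigenvalue above b
    -- would lie both in L and in its orthogonal complement.
    set S : Lᗮ →L[ℝ] Lᗮ := T.restrict hKinv with hS
    have hSc : IsCompactOperator S := hc.restrict' hKinv
    have hSs : S.IsSymmetric := hT.restrict_invariant hKinv
    have hSb := ContinuousLinearMap.orthogonalComplement_iSup_eigenspaces_eq_bot hSc hSs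
    have htop := (Submodule.topologicalClosure_eq_top_iff).mpr hSb
    set y : Lᗮ := ⟨Lᗮ.starProjection x, Submodule.starProjection_apply_mem _ _⟩ with hy
    have hle := inner_le_of_mem_iSup_eigenspace hSs (f := fun ν : ℝ => ν) (m := a)
      Function.injective_id ?_ (v := y) (by rw [htop]; trivial)
    · exact hle
    · intro ν hν
      obtain ⟨z, hz⟩ := hν.exists_hasEigenvector
      have hz1 : S z = ν • z := mem_eigenspace_iff.mp hz.1
      have hz2 : T (z : H) = ν • (z : H) := congrArg Subtype.val hz1
      have hz0 : (z : H) ≠ 0 := fun h => hz.2 (Subtype.ext h)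
      have hze : (z : H) ∈ eigenspace (T : Module.End ℝ H) ν := mem_eigenspace_iff.mpr hz2
      rcases hgap ν (hasEigenvalue_of_hasEigenvector ⟨hze, hz0⟩) with h | h
      · exact h
      · exfalso
        have hzL : (z : H) ∈ L :=
          (le_iSup (fun ν : Ioi b => eigenspace (T : Module.End ℝ H) ν) ⟨ν, h⟩) hze
        have := (Submodule.mem_orthogonal _ _).mp z.2 _ hzL
        exact hz0 (inner_self_eq_zero.mp this)
  · intro x
    refine le_inner_of_mem_iSup_eigenspace hT (f := fun ν : Ioi b => (ν : ℝ))
      Subtype.val_injective (fun ν hν => hb' ν hν ν.2) ?_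
    rw [← Submodule.orthogonal_orthogonal_eq_closure]
    exact Submodule.sub_starProjection_mem_orthogonal _

end Spectral

/-! ### Scalar differential inequalities -/

section ScalarODE

/-- A continuous function whose forward averages exceed its value by at most `O(h)` times its size
grows at most exponentially. -/
theorem le_exp_mul_of_average_le {e : ℝ → ℝ} {t₁ C : ℝ} (hC : 0 ≤ C)
    (he : ContinuousOn e (Ioi t₁))
    (havg : ∀ t, t₁ < t → ∀ h, 0 < h → ∀ M, (∀ τ ∈ Icc t (t + h), e τ ≤ M) →
      ∫ τ in t..t + h, (e τ - e t) ≤ C * h ^ 2 * M)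
    {a b : ℝ} (ha : t₁ < a) (hab : a ≤ b) : e b ≤ Real.exp (2 * C * (b - a)) * e a := by
  have hsub : Icc a b ⊆ Ioi t₁ := fun x hx => lt_of_lt_of_le ha hx.1
  have key := le_gronwallBound_of_liminf_deriv_right_le (f := e) (f' := fun t => 2 * C * e t)
    (δ := e a) (K := 2 * C) (ε := 0) (a := a) (b := b) (he.mono hsub) ?_ le_rfl
    (fun x _ => by simp) b (right_mem_Icc.mpr hab)
  · rw [gronwallBound_ε0] at key
    linarith
  intro t ht r hr
  have htt : t₁ < t := lt_of_lt_of_le ha ht.1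
  -- If all slopes of e just to the right of t were at least r > 2 C e(t), integration would give r
  -- h² / 2 ≤ C h² M. The bound M is taken so little above e(t) that 2 C M < r, a contradiction.
  by_contra hcon
  rw [not_frequently] at hcon
  obtain ⟨u, hu, hus⟩ := mem_nhdsGT_iff_exists_Ioo_subset.mp hcon
  have hu : t < u := hu
  set M := e t + (r - 2 * C * e t) / (2 * (2 * C + 1)) with hM
  have hpos : 0 < (r - 2 * C * e t) / (2 * (2 * C + 1)) := by
    apply div_pos <;> linarith
  have hMr : 2 * C * M < r := by
    have h1 : (r - 2 * C * e t) / (2 * (2 * C + 1)) * (2 * (2 * C + 1)) = r - 2 * C * e t :=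
      div_mul_cancel₀ _ (by positivity)
    rw [hM]
    nlinarith
  have hnear : ∀ᶠ z in 𝓝 t, e z < M :=
    (he.continuousAt (Ioi_mem_nhds htt)).eventually (gt_mem_nhds (by linarith))
  obtain ⟨d, hd, hdM⟩ := Metric.eventually_nhds_iff.mp hnear
  set h := min (d / 2) ((u - t) / 2) with hh
  have hh0 : 0 < h := lt_min (by linarith) (by linarith)
  have hhd : h < d := lt_of_le_of_lt (min_le_left _ _) (by linarith)
  have hhu : t + h < u := by
    have := min_le_right (d / 2) ((u - t) / 2)
    linarith
  have hav := havg t htt h hh0 M fun τ hτ => (hdM (by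
    rw [Real.dist_eq, abs_of_nonneg (by linarith [hτ.1])]; linarith [hτ.2])).le
  have hlow : ∫ τ in t..t + h, r * (τ - t) ≤ ∫ τ in t..t + h, (e τ - e t) := by
    refine intervalIntegral.integral_mono_on (by linarith)
      (Continuous.intervalIntegrable (by fun_prop) _ _) ?_ ?_
    · refine ContinuousOn.intervalIntegrable ((he.mono ?_).sub continuousOn_const)
      rw [uIcc_of_le (by linarith)]
      exact fun x hx => lt_of_lt_of_le htt hx.1
    · intro x hx
      rcases eq_or_lt_of_le hx.1 with rfl | hlt
      · simp
      · have h1 : ¬ (x - t)⁻¹ * (e x - e t) < r := hus ⟨hlt, lt_of_le_of_lt hx.2 hhu⟩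
        rw [not_lt, inv_mul_eq_div, le_div_iff₀ (by linarith)] at h1
        exact h1
  have hint : ∫ τ in t..t + h, r * (τ - t) = r * (h ^ 2 / 2) := by
    rw [intervalIntegral.integral_const_mul,
      intervalIntegral.integral_comp_sub_right (fun x => x) t]
    simp
  rw [hint] at hlow
  have : 0 < h ^ 2 * (r - 2 * C * M) := by
    apply mul_pos (by positivity); linarith
  nlinarith

theorem le_exp_mul_of_hasDerivAt_le {n n' G G' : ℝ → ℝ} {t₁ : ℝ}
    (hn : ∀ t, t₁ < t → HasDerivAt n (n' t) t) (hG : ∀ t, t₁ < t → HasDerivAt G (G' t) t)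
    (hle : ∀ t, t₁ < t → n' t ≤ -(G' t) * n t) {s t : ℝ} (hs : t₁ < s) (hst : s ≤ t) :
    n t ≤ Real.exp (G s - G t) * n s := by
  have hder : ∀ x, t₁ < x → HasDerivAt (fun x => n x * Real.exp (G x))
      (n' x * Real.exp (G x) + n x * (Real.exp (G x) * G' x)) x := fun x hx =>
    (hn x hx).mul (hG x hx).exp
  have hanti : AntitoneOn (fun x => n x * Real.exp (G x)) (Ioi t₁) := by
    refine antitoneOn_of_deriv_nonpos (convex_Ioi t₁)
      (fun x hx => (hder x hx).continuousAt.continuousWithinAt) (fun x hx => ?_) (fun x hx => ?_)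
    · rw [interior_Ioi] at hx
      exact (hder x hx).differentiableAt.differentiableWithinAt
    · rw [interior_Ioi] at hx
      rw [(hder x hx).deriv]
      nlinarith [hle x hx, Real.exp_pos (G x)]
  have h := hanti (show s ∈ Ioi t₁ from hs) (show t ∈ Ioi t₁ from lt_of_lt_of_le hs hst) hst
  simp only at h
  rw [Real.exp_sub, div_mul_eq_mul_div, le_div_iff₀ (Real.exp_pos _)]
  linarith

theorem sub_le_mul_of_hasDerivAt_le {n n' : ℝ → ℝ} {t₁ c : ℝ} {s t : ℝ}
    (hn : ∀ t, t₁ < t → HasDerivAt n (n' t) t) (hs : t₁ < s) (hst : s ≤ t)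
    (hle : ∀ x ∈ Icc s t, n' x ≤ c) : n t - n s ≤ c * (t - s) := by
  have hlt : ∀ x ∈ Icc s t, t₁ < x := fun x hx => lt_of_lt_of_le hs hx.1
  refine Convex.image_sub_le_mul_sub_of_deriv_le (convex_Icc s t)
    (fun x hx => (hn x (hlt x hx)).continuousAt.continuousWithinAt)
    (fun x hx => (hn x (hlt x (interior_subset hx))).differentiableAt.differentiableWithinAt)
    (fun x hx => ?_) s (left_mem_Icc.mpr hst) t (right_mem_Icc.mpr hst) hst
  rw [(hn x (hlt x (interior_subset hx))).deriv]
  exact hle x (interior_subset hx)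

/-- Sharp exponential decay for a quantity `e` controlled by a Lyapunov function `n`, where the
defect of the decay rate of `n` is a power of `e` at an earlier time. -/
theorem exists_sharp_exponential_bound {n n' e : ℝ → ℝ} {t₁ k₁ k₂ k₃ K r η : ℝ} (hk₁ : 0 < k₁)
    (hk₂ : 0 ≤ k₂) (hk₃ : 0 < k₃) (hr : 0 < r) (hη : 0 < η) (hK : 0 ≤ K)
    (hn0 : ∀ t, t₁ < t → 0 ≤ n t) (he0 : ∀ t, t₁ < t → 0 ≤ e t)
    (hn : ∀ t, t₁ < t → HasDerivAt n (n' t) t)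
    (hdiss : ∀ t, t₁ < t → n' t ≤ -k₁ * e t)
    (hrate : ∀ t, t₁ < t → n' t ≤ -(r - k₂ * e (t - 1) ^ η) * n t)
    (hne : ∀ t, t₁ < t → n t ≤ k₃ * e t)
    (hgrow : ∀ a b, t₁ < a → a ≤ b → e b ≤ Real.exp (K * (b - a)) * e a)
    (hlim : Tendsto e atTop (𝓝 0)) :
    ∃ C t₂ : ℝ, 0 < C ∧ ∀ s t, t₂ ≤ s → s ≤ t → e t ≤ C * Real.exp (-r * (t - s)) * e s := by
  -- Over [s, s+1] the drop of n is at most n(s), while the growth bound keeps e above exp(-K)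
  -- e(s+1) throughout. The dissipation therefore bounds e(s+1) by n(s).
  have hsmooth : ∀ s, t₁ < s → e (s + 1) ≤ Real.exp K / k₁ * n s := by
    intro s hs
    have h1 : n (s + 1) - n s ≤ (-(k₁ * (Real.exp (-K) * e (s + 1)))) * (s + 1 - s) := by
      refine sub_le_mul_of_hasDerivAt_le hn hs (by linarith) fun x hx => ?_
      have hx1 : t₁ < x := lt_of_lt_of_le hs hx.1
      refine (hdiss x hx1).trans ?_
      have h2 := hgrow x (s + 1) hx1 hx.2
      have h3 : Real.exp (K * (s + 1 - x)) ≤ Real.exp K :=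
        Real.exp_le_exp.mpr (by nlinarith [hx.1])
      have h4 : e (s + 1) ≤ Real.exp K * e x :=
        h2.trans (mul_le_mul_of_nonneg_right h3 (he0 x hx1))
      have h5 : Real.exp (-K) * e (s + 1) ≤ e x := by
        rw [Real.exp_neg, inv_mul_le_iff₀ (Real.exp_pos K)]
        exact h4
      nlinarith
    have h2 := hn0 (s + 1) (by linarith)
    rw [div_mul_eq_mul_div, le_div_iff₀ hk₁]
    rw [Real.exp_neg] at h1
    have h3 : k₁ * ((Real.exp K)⁻¹ * e (s + 1)) ≤ n s := by linarith
    calc e (s + 1) * k₁ = Real.exp K * (k₁ * ((Real.exp K)⁻¹ * e (s + 1))) := by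
          field_simp [(Real.exp_pos K).ne']
      _ ≤ Real.exp K * n s := mul_le_mul_of_nonneg_left h3 (Real.exp_pos K).le
  have hpow : Tendsto (fun t => k₂ * e (t - 1) ^ η) atTop (𝓝 0) := by
    have h1 : Tendsto (fun t : ℝ => e (t - 1)) atTop (𝓝 0) :=
      hlim.comp (tendsto_atTop_add_const_right _ (-1) tendsto_id)
    have h2 := (h1.rpow_const (p := η) (Or.inr hη.le)).const_mul k₂
    rwa [Real.zero_rpow hη.ne', mul_zero] at h2
  obtain ⟨t₂, ht₂⟩ := (hpow.eventually (gt_mem_nhds (half_pos hr))).exists_forall_of_atTop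
  set t₃ := max (t₁ + 1) (max t₂ 0) with ht₃
  have h31 : t₁ < t₃ := lt_of_lt_of_le (by linarith) (le_max_left _ _)
  have h32 : t₂ ≤ t₃ := (le_max_left _ _).trans (le_max_right _ _)
  have h30 : 0 ≤ t₃ := (le_max_right _ _).trans (le_max_right _ _)
  -- As e tends to 0, the defect of the rate is eventually below r / 2, which gives a preliminary
  -- decay at half the rate.
  have hhalf : ∀ s t, t₃ < s → s ≤ t → n t ≤ Real.exp (r / 2 * s - r / 2 * t) * n s := by
    intro s t hs hst
    refine le_exp_mul_of_hasDerivAt_le (G := fun t => r / 2 * t) (G' := fun _ => r / 2)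
      (fun t ht => hn t (h31.trans ht)) (fun t _ => by
        simpa using (hasDerivAt_id t).const_mul (r / 2)) (fun t ht => ?_) hs hst
    refine (hrate t (h31.trans ht)).trans ?_
    have h1 := ht₂ t (h32.trans ht.le)
    have h2 := hn0 t (h31.trans ht)
    nlinarith
  set t₄ := t₃ + 4 with ht₄
  set s₀ := t₃ + 1 with hs₀
  set B := Real.exp K / k₁ * (Real.exp (r / 2 * (s₀ + 2)) * n s₀) with hB
  have hB0 : 0 ≤ B := by
    have := hn0 s₀ (by linarith)
    positivity
  -- The value at t - 1 is reached from n at t - 2, one unit being lost to `hsmooth`.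
  have heB : ∀ t, t₄ ≤ t → e (t - 1) ≤ B * Real.exp (-(r / 2) * t) := by
    intro t ht
    have h1 := hsmooth (t - 2) (by linarith)
    have h2 := hhalf s₀ (t - 2) (by linarith) (by linarith)
    have h3 : r / 2 * s₀ - r / 2 * (t - 2) = r / 2 * (s₀ + 2) + -(r / 2) * t := by ring
    rw [h3, Real.exp_add] at h2
    rw [show t - 2 + 1 = t - 1 by ring] at h1
    refine h1.trans ((mul_le_mul_of_nonneg_left h2 (by positivity)).trans_eq ?_)
    rw [hB]; ring
  set β := r / 2 * η with hβ
  have hβ0 : 0 < β := by positivity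
  set D := k₂ * B ^ η with hD
  have hD0 : 0 ≤ D := by positivity
  have hrate' : ∀ t, t₄ < t → n' t ≤ -(r - D * Real.exp (-β * t)) * n t := by
    intro t ht
    refine (hrate t (by linarith)).trans ?_
    have h1 : e (t - 1) ^ η ≤ B ^ η * Real.exp (-β * t) := by
      refine (Real.rpow_le_rpow (he0 _ (by linarith)) (heB t ht.le) hη.le).trans_eq ?_
      rw [Real.mul_rpow hB0 (Real.exp_pos _).le, ← Real.exp_mul]
      congr 2; rw [hβ]; ring
    have h2 := hn0 t (by linarith)
    have h3 : k₂ * e (t - 1) ^ η ≤ D * Real.exp (-β * t) := by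
      rw [hD, mul_assoc]; exact mul_le_mul_of_nonneg_left h1 hk₂
    nlinarith
  have hsharp : ∀ s t, t₄ < s → s ≤ t →
      n t ≤ Real.exp (D / β) * Real.exp (-r * (t - s)) * n s := by
    intro s t hs hst
    -- The defect D exp(-β t) is integrable, so its primitive is bounded. As s ≥ 0, it costs at most
    -- the factor exp(D / β).
    have h1 := le_exp_mul_of_hasDerivAt_le (G := fun t => r * t + D / β * Real.exp (-β * t))
      (G' := fun t => r - D * Real.exp (-β * t)) (fun t ht => hn t (by linarith)) (fun t _ => by
        have h := ((hasDerivAt_id t).const_mul r).add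
          ((((hasDerivAt_id t).const_mul (-β)).exp).const_mul (D / β))
        refine h.congr_deriv ?_
        simp only [id_eq]
        field_simp
        ring) hrate' hs hst
    refine h1.trans (mul_le_mul_of_nonneg_right ?_ (hn0 s (by linarith)))
    rw [← Real.exp_add]
    refine Real.exp_le_exp.mpr ?_
    have h2 : Real.exp (-β * s) ≤ 1 := by
      rw [Real.exp_le_one_iff]; nlinarith
    have h3 : 0 ≤ D / β := by positivity
    have h4 : 0 ≤ D / β * Real.exp (-β * t) := by positivity
    nlinarith
  -- The first summand serves t ≤ s + 1, where the growth bound suffices. The second serves t ≥ s +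
  -- 1: n decays from s to t - 1 and is converted back to e in the last unit of time.
  refine ⟨Real.exp (K + r) + Real.exp K / k₁ * (Real.exp (D / β) * (Real.exp r * k₃)), t₄ + 1,
    by positivity, fun s t hs hst => ?_⟩
  have hes := he0 s (by linarith)
  rcases le_total t (s + 1) with h | h
  · have h1 := hgrow s t (by linarith) hst
    have h2 : Real.exp (K * (t - s)) ≤ Real.exp (K + r) * Real.exp (-r * (t - s)) := by
      rw [← Real.exp_add]
      refine Real.exp_le_exp.mpr ?_
      nlinarith
    calc e t ≤ Real.exp (K * (t - s)) * e s := h1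
      _ ≤ Real.exp (K + r) * Real.exp (-r * (t - s)) * e s := mul_le_mul_of_nonneg_right h2 hes
      _ ≤ _ := by
        refine mul_le_mul_of_nonneg_right (mul_le_mul_of_nonneg_right ?_ (Real.exp_pos _).le) hes
        have : 0 ≤ Real.exp K / k₁ * (Real.exp (D / β) * (Real.exp r * k₃)) := by positivity
        linarith
  · have h1 := hsmooth (t - 1) (by linarith)
    rw [sub_add_cancel] at h1
    have h2 := hsharp s (t - 1) (by linarith) (by linarith)
    have h3 := hne s (by linarith)
    have h4 : Real.exp (-r * (t - 1 - s)) = Real.exp r * Real.exp (-r * (t - s)) := by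
      rw [← Real.exp_add]; congr 1; ring
    rw [h4] at h2
    calc e t ≤ Real.exp K / k₁ * n (t - 1) := h1
      _ ≤ Real.exp K / k₁ * (Real.exp (D / β) * (Real.exp r * Real.exp (-r * (t - s))) *
          (k₃ * e s)) := by
        refine mul_le_mul_of_nonneg_left (h2.trans ?_) (by positivity)
        exact mul_le_mul_of_nonneg_left h3 (by positivity)
      _ = Real.exp K / k₁ * (Real.exp (D / β) * (Real.exp r * k₃)) *
          Real.exp (-r * (t - s)) * e s := by ring
      _ ≤ _ := by
        refine mul_le_mul_of_nonneg_right (mul_le_mul_of_nonneg_right ?_ (Real.exp_pos _).le) hes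
        linarith [Real.exp_pos (K + r)]

end ScalarODE

/-! ### The abstract flow (T W)' = -F + c T W -/

section Flow

variable {H : Type*} [NormedAddCommGroup H] [InnerProductSpace ℝ H]

/-- Only S W is differentiable; W is merely continuous. By symmetry the increment of the form equals
⟨S W(s) - S W(t), W(s) + W(t)⟩, which needs nothing more. -/
theorem hasDerivAt_inner_apply_self {S : H →L[ℝ] H} (hS : S.IsSymmetric) {W : ℝ → H} {D : H}
    {t : ℝ} (hW : ContinuousAt W t) (hD : HasDerivAt (fun s => S (W s)) D t) :
    HasDerivAt (fun s => inner ℝ (S (W s)) (W s)) (2 * inner ℝ D (W t)) t := by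
  rw [hasDerivAt_iff_tendsto_slope] at hD ⊢
  have hsum : Tendsto (fun s => W s + W t) (𝓝[≠] t) (𝓝 (W t + W t)) :=
    (hW.tendsto.mono_left nhdsWithin_le_nhds).add_const _
  have h := hD.inner (𝕜 := ℝ) hsum
  rw [inner_add_right, ← two_mul] at h
  refine h.congr fun s => ?_
  simp only [slope, vsub_eq_sub, smul_eq_mul]
  rw [real_inner_smul_left]
  congr 1
  have hsym : inner ℝ (S (W s)) (W t) = inner ℝ (S (W t)) (W s) := by
    have := hS (W s) (W t)
    simp only [ContinuousLinearMap.coe_coe] at this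
    rw [this, real_inner_comm]
  rw [inner_sub_left, inner_add_right, inner_add_right, hsym]
  ring

section

variable {T : H →L[ℝ] H} {W F : ℝ → H} {e : ℝ → ℝ} {t₁ c c₁ c₃ c₄ : ℝ}

/-- Exchanging t and τ in the convexity inequality bounds the increment of e from both sides by
quantities that tend to 0. -/
theorem continuousOn_of_convexity (hW : ContinuousOn W (Ioi t₁)) (hF : ContinuousOn F (Ioi t₁))
    (hconv : ∀ t τ, t₁ < t → t₁ < τ → e τ - e t ≤ c₃ * inner ℝ (F τ) (W τ - W t)) :
    ContinuousOn e (Ioi t₁) := by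
  intro t ht
  have hWt := hW t ht
  have hFt := hF t ht
  have hd : Tendsto (fun τ => W τ - W t) (𝓝[Ioi t₁] t) (𝓝 0) := by
    simpa using (hWt.tendsto.sub_const (W t))
  have h1 : Tendsto (fun τ => c₃ * inner ℝ (F τ) (W τ - W t)) (𝓝[Ioi t₁] t) (𝓝 0) := by
    simpa using (hFt.tendsto.inner (𝕜 := ℝ) hd).const_mul c₃
  have h2 : Tendsto (fun τ => c₃ * inner ℝ (F t) (W τ - W t)) (𝓝[Ioi t₁] t) (𝓝 0) := by
    simpa using ((tendsto_const_nhds (x := F t)).inner (𝕜 := ℝ) hd).const_mul c₃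
  have h3 : Tendsto (fun τ => e τ - e t) (𝓝[Ioi t₁] t) (𝓝 0) := by
    refine tendsto_of_tendsto_of_tendsto_of_le_of_le' h2 h1 ?_ ?_
    · filter_upwards [self_mem_nhdsWithin] with τ hτ
      have := hconv τ t hτ ht
      rw [← neg_sub (W τ) (W t), inner_neg_right] at this
      linarith
    · filter_upwards [self_mem_nhdsWithin] with τ hτ
      exact hconv t τ ht hτ
  simpa [ContinuousWithinAt] using h3.add_const (e t)

/-- Along the flow `(T W)' = -F + c T W` a convex potential of `F` grows at most exponentially. -/
theorem exists_exponential_growth_bound (hT : T.IsSymmetric) (hTpos : ∀ x, 0 ≤ inner ℝ (T x) x)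
    (hc : 0 < c) (hc₁ : 0 < c₁) (hc₃ : 0 < c₃) (hc₄ : 0 ≤ c₄)
    (hW : ContinuousOn W (Ioi t₁)) (hF : ContinuousOn F (Ioi t₁))
    (hder : ∀ t, t₁ < t → HasDerivAt (fun t => T (W t)) (-F t + c • T (W t)) t)
    (hlo : ∀ t, t₁ < t → c₁ * ‖W t‖ ^ 2 ≤ e t)
    (hconv : ∀ t τ, t₁ < t → t₁ < τ → e τ - e t ≤ c₃ * inner ℝ (F τ) (W τ - W t))
    (hFW : ∀ t, t₁ < t → ‖F t‖ ≤ c₄ * ‖W t‖) :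
    ∃ K : ℝ, 0 ≤ K ∧ ∀ a b, t₁ < a → a ≤ b → e b ≤ Real.exp (K * (b - a)) * e a := by
  have hecont : ContinuousOn e (Ioi t₁) := continuousOn_of_convexity hW hF hconv
  set A := c₄ + c * ‖T‖ with hA
  have hA0 : 0 ≤ A := by positivity
  set C := c₃ * c * A / c₁ with hC
  have hC0 : 0 ≤ C := by positivity
  refine ⟨2 * C, by positivity, fun a b ha hab =>
    le_exp_mul_of_average_le hC0 hecont ?_ ha hab⟩
  intro t ht h hh M hM
  have hsub : ∀ τ ∈ Icc t (t + h), t₁ < τ := fun τ hτ => lt_of_lt_of_le ht hτ.1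
  have hWM : ∀ τ ∈ Icc t (t + h), ‖W τ‖ ^ 2 ≤ M / c₁ := fun τ hτ => by
    rw [le_div_iff₀ hc₁]
    linarith [hlo τ (hsub τ hτ), hM τ hτ]
  have hM0 : 0 ≤ M / c₁ := (sq_nonneg _).trans (hWM t ⟨le_rfl, by linarith⟩)
  have hWM' : ∀ τ ∈ Icc t (t + h), ‖W τ‖ ≤ √(M / c₁) := fun τ hτ =>
    Real.le_sqrt_of_sq_le (hWM τ hτ)
  -- Along the flow T W, rather than W, has a controlled time derivative; this is why a Lipschitz
  -- bound is sought only for T W.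
  have hlip : ∀ τ ∈ Icc t (t + h), ‖T (W τ) - T (W t)‖ ≤ A * √(M / c₁) * h := by
    intro τ hτ
    have h1 := (convex_Icc t (t + h)).norm_image_sub_le_of_norm_hasDerivWithin_le
      (f := fun t => T (W t)) (C := A * √(M / c₁))
      (fun x hx => (hder x (hsub x hx)).hasDerivWithinAt) (fun x hx => by
        have h2 : ‖c • T (W x)‖ ≤ c * (‖T‖ * ‖W x‖) := by
          rw [norm_smul, Real.norm_of_nonneg hc.le]
          exact mul_le_mul_of_nonneg_left (T.le_opNorm _) hc.le
        calc ‖-F x + c • T (W x)‖ ≤ ‖F x‖ + ‖c • T (W x)‖ := by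
              simpa using norm_add_le (-F x) (c • T (W x))
          _ ≤ c₄ * ‖W x‖ + c * (‖T‖ * ‖W x‖) := add_le_add (hFW x (hsub x hx)) h2
          _ = A * ‖W x‖ := by rw [hA]; ring
          _ ≤ A * √(M / c₁) := mul_le_mul_of_nonneg_left (hWM' x hx) hA0)
      (show t ∈ Icc t (t + h) from ⟨le_rfl, by linarith⟩) hτ
    refine h1.trans (mul_le_mul_of_nonneg_left ?_ (by positivity))
    rw [Real.norm_of_nonneg (by linarith [hτ.1])]
    linarith [hτ.2]
  -- The equation gives D' = 2 ⟨-F + c T W, W(τ) - W(t)⟩, so the convexity bound on e(τ) - e(t)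
  -- equals -(c₃/2) D' plus c₃ c ⟨T W(τ), W(τ) - W(t)⟩. The first term has nonpositive integral
  -- because D(t) = 0 and D ≥ 0.
  set D : ℝ → ℝ := fun τ => inner ℝ (T (W τ - W t)) (W τ - W t) with hD
  set D' : ℝ → ℝ := fun τ => 2 * inner ℝ (-F τ + c • T (W τ)) (W τ - W t) with hD'
  have hDder : ∀ τ ∈ Icc t (t + h), HasDerivAt D (D' τ) τ := fun τ hτ => by
    have hτ' := hsub τ hτ
    refine hasDerivAt_inner_apply_self hT (W := fun τ => W τ - W t)
      ((hW.continuousAt (Ioi_mem_nhds hτ')).sub continuousAt_const) ?_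
    simp only [map_sub]
    exact (hder τ hτ').sub_const _
  have hD'cont : ContinuousOn D' (Icc t (t + h)) := by
    have hW' := hW.mono hsub
    have hF' := hF.mono hsub
    exact ((hF'.neg.add ((T.continuous.comp_continuousOn hW').const_smul c)).inner
      (hW'.sub continuousOn_const)).const_mul 2
  have hle : t ≤ t + h := by linarith
  have huIcc : uIcc t (t + h) = Icc t (t + h) := uIcc_of_le hle
  have hD'int : IntervalIntegrable D' volume t (t + h) :=
    ContinuousOn.intervalIntegrable (by rwa [huIcc])
  have hpt : ∀ τ ∈ Icc t (t + h), e τ - e t ≤ -(c₃ / 2) * D' τ + C * h * M := by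
    intro τ hτ
    refine (hconv t τ ht (hsub τ hτ)).trans ?_
    -- Symmetry moves T onto the increment, where `hlip` supplies the factor h.
    have h1 : inner ℝ (T (W τ)) (W τ - W t) ≤ √(M / c₁) * (A * √(M / c₁) * h) := by
      have h2 := hT (W τ) (W τ - W t)
      simp only [ContinuousLinearMap.coe_coe, map_sub] at h2
      rw [h2]
      exact (real_inner_le_norm _ _).trans
        (mul_le_mul (hWM' τ hτ) (hlip τ hτ) (norm_nonneg _) (Real.sqrt_nonneg _))
    have h3 : √(M / c₁) * (A * √(M / c₁) * h) = A * h * (M / c₁) := by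
      rw [show √(M / c₁) * (A * √(M / c₁) * h) = A * h * (√(M / c₁) * √(M / c₁)) by ring,
        Real.mul_self_sqrt hM0]
    rw [h3] at h1
    have h4 : D' τ = -2 * inner ℝ (F τ) (W τ - W t) + 2 * c * inner ℝ (T (W τ)) (W τ - W t) := by
      simp only [hD', inner_add_left, inner_neg_left, real_inner_smul_left]
      ring
    have h5 : C * h * M = c₃ * c * (A * h * (M / c₁)) := by
      rw [hC]; ring
    rw [h4, h5]
    have h6 := mul_le_mul_of_nonneg_left h1 (show 0 ≤ c₃ * c by positivity)
    nlinarith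
  calc ∫ τ in t..t + h, (e τ - e t) ≤ ∫ τ in t..t + h, (-(c₃ / 2) * D' τ + C * h * M) := by
        refine intervalIntegral.integral_mono_on hle ?_ ?_ hpt
        · exact ContinuousOn.intervalIntegrable
            (by rw [huIcc]; exact (hecont.mono hsub).sub continuousOn_const)
        · exact (hD'int.const_mul _).add intervalIntegrable_const
    _ = -(c₃ / 2) * (D (t + h) - D t) + C * h ^ 2 * M := by
        rw [intervalIntegral.integral_add (hD'int.const_mul _) intervalIntegrable_const,
          intervalIntegral.integral_const_mul, intervalIntegral.integral_const,
          intervalIntegral.integral_eq_sub_of_hasDerivAt (by rwa [huIcc]) hD'int]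
        simp only [add_sub_cancel_left, smul_eq_mul]
        ring
    _ ≤ C * h ^ 2 * M := by
        have h1 : D t = 0 := by simp [hD]
        have h2 : 0 ≤ D (t + h) := hTpos _
        rw [h1]
        nlinarith

set_option maxHeartbeats 1000000 in
/-- Sharp exponential decay for the flow `(T W)' = -F + c T W`, where `F` is close to `p⁻¹ W`,
when no eigenvalue of `T` lies in `(Λ⁻¹, (c p)⁻¹]`, and `W → 0`. -/
theorem exists_sharp_decay {P : H →L[ℝ] H} {Λ p σ c₂ κ η : ℝ}
    (hT : T.IsSymmetric) (hTpos : ∀ x, 0 ≤ inner ℝ (T x) x)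
    (hP : P.IsSymmetric) (hPP : ∀ x, P (P x) = P x) (hTP : ∀ x, T (P x) = P (T x))
    (hc : 0 < c) (hp : 0 < p) (hΛ : c * p < Λ) (hσ : 0 < σ)
    (hhigh : ∀ x, Λ * inner ℝ (T (P x)) (P x) ≤ ‖P x‖ ^ 2)
    (hlow : ∀ x, (1 + σ) * ‖x - P x‖ ^ 2 ≤ c * p * inner ℝ (T (x - P x)) (x - P x))
    (hc₁ : 0 < c₁) (hc₂ : 0 < c₂) (hc₃ : 0 < c₃) (hc₄ : 0 ≤ c₄) (hκ : 0 ≤ κ) (hη : 0 < η)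
    (hW : ContinuousOn W (Ioi t₁)) (hF : ContinuousOn F (Ioi t₁))
    (hder : ∀ t, t₁ < t → HasDerivAt (fun t => T (W t)) (-F t + c • T (W t)) t)
    (hlo : ∀ t, t₁ < t → c₁ * ‖W t‖ ^ 2 ≤ e t) (hup : ∀ t, t₁ < t → e t ≤ c₂ * ‖W t‖ ^ 2)
    (hconv : ∀ t τ, t₁ < t → t₁ < τ → e τ - e t ≤ c₃ * inner ℝ (F τ) (W τ - W t))
    (hFW : ∀ t, t₁ < t → ‖F t‖ ≤ c₄ * ‖W t‖)
    (hR : ∀ t, t₁ < t → ‖W t - p • F t‖ ≤ κ * e (t - 1) ^ η * ‖W t‖)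
    (hlim : Tendsto e atTop (𝓝 0)) :
    ∃ C t₂ : ℝ, 0 < C ∧ ∀ s t, t₂ ≤ s → s ≤ t →
      e t ≤ C * Real.exp (-(2 * (Λ - c * p) / p) * (t - s)) * e s := by
  obtain ⟨K, hK, hgrow⟩ :=
    exists_exponential_growth_bound hT hTpos hc hc₁ hc₃ hc₄ hW hF hder hlo hconv hFW
  have hcp : 0 < c * p := by positivity
  have hΛ0 : 0 < Λ := hcp.trans hΛ
  -- ρ is the relative width of the gap on the stable side; σ plays that role on the unstable side.
  -- From t₃ on the error ε is below a quarter of both.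
  set ρ := 1 - c * p / Λ with hρ
  have hρ0 : 0 < ρ := by rw [hρ, sub_pos, div_lt_one hΛ0]; exact hΛ
  have hρ1 : ρ < 1 := by rw [hρ]; linarith [div_pos hcp hΛ0]
  have hρΛ : (1 - ρ) * Λ = c * p := by rw [hρ]; field_simp; ring
  set ε : ℝ → ℝ := fun t => κ * e (t - 1) ^ η with hε
  have hεlim : Tendsto ε atTop (𝓝 0) := by
    have h1 : Tendsto (fun t : ℝ => e (t - 1)) atTop (𝓝 0) :=
      hlim.comp (tendsto_atTop_add_const_right _ (-1) tendsto_id)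
    have h2 := (h1.rpow_const (p := η) (Or.inr hη.le)).const_mul κ
    rwa [Real.zero_rpow hη.ne', mul_zero] at h2
  obtain ⟨t₂, ht₂⟩ := (hεlim.eventually (gt_mem_nhds
    (show 0 < min σ ρ / 4 by positivity))).exists_forall_of_atTop
  set t₃ := max (t₁ + 1) t₂ with ht₃
  have h31 : t₁ + 1 ≤ t₃ := le_max_left _ _
  have h32 : t₂ ≤ t₃ := le_max_right _ _
  have he0 : ∀ t, t₁ < t → 0 ≤ e t := fun t ht => le_trans (by positivity) (hlo t ht)
  have hε0 : ∀ t, t₃ < t → 0 ≤ ε t := fun t ht =>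
    mul_nonneg hκ (Real.rpow_nonneg (he0 _ (by linarith)) _)
  have hεσ : ∀ t, t₃ < t → 4 * ε t ≤ σ := fun t ht => by
    have := ht₂ t (by linarith); have := min_le_left σ ρ; linarith
  have hερ : ∀ t, t₃ < t → 4 * ε t ≤ ρ := fun t ht => by
    have := ht₂ t (by linarith); have := min_le_right σ ρ; linarith
  have hTs : ∀ x y, inner ℝ (T x) y = inner ℝ x (T y) := fun x y => hT x y
  have hPs : ∀ x y, inner ℝ (P x) y = inner ℝ x (P y) := fun x y => hP x y
  set x : ℝ → ℝ := fun t => ‖P (W t)‖ with hx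
  set y : ℝ → ℝ := fun t => ‖W t - P (W t)‖ with hy
  set n : ℝ → ℝ := fun t => inner ℝ (T (P (W t))) (P (W t)) with hn
  set a : ℝ → ℝ := fun t => inner ℝ (T (W t - P (W t))) (W t - P (W t)) with ha
  have hn0 : ∀ t, 0 ≤ n t := fun t => hTpos _
  have ha0 : ∀ t, 0 ≤ a t := fun t => hTpos _
  have hx0 : ∀ t, 0 ≤ x t := fun t => norm_nonneg _
  have hy0 : ∀ t, 0 ≤ y t := fun t => norm_nonneg _
  have hPorth : ∀ u v, inner ℝ (P u) (v - P v) = (0 : ℝ) := fun u v => by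
    rw [hPs, map_sub, hPP, sub_self, inner_zero_right]
  have hpyth : ∀ t, ‖W t‖ ^ 2 = x t ^ 2 + y t ^ 2 := fun t => by
    have h := norm_add_sq_real (P (W t)) (W t - P (W t))
    rw [add_sub_cancel, hPorth] at h
    simp only [hx, hy]; linarith
  have hWle : ∀ t, ‖W t‖ ≤ x t + y t := fun t => by
    have h := norm_add_le (P (W t)) (W t - P (W t))
    rwa [add_sub_cancel] at h
  set R : ℝ → H := fun t => W t - p • F t with hRdef
  have hFR : ∀ t, F t = p⁻¹ • (W t - R t) := fun t => by
    simp only [hRdef, sub_sub_cancel]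
    rw [smul_smul, inv_mul_cancel₀ hp.ne', one_smul]
  have hRle : ∀ t, t₃ < t → ∀ z : H, inner ℝ (R t) z ≤ ε t * (x t + y t) * ‖z‖ := by
    intro t ht z
    refine (real_inner_le_norm _ _).trans (mul_le_mul_of_nonneg_right ?_ (norm_nonneg _))
    exact (hR t (by linarith)).trans (mul_le_mul_of_nonneg_left (hWle t) (hε0 t ht))
  -- This displays n as the form of T ∘ P, symmetric because T and P commute, so that
  -- `hasDerivAt_inner_apply_self` applies to W itself. The same is done for a with T - T ∘ P.
  have hn_eq : ∀ t, n t = inner ℝ (T (P (W t))) (W t) := fun t => by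
    simp only [hn]
    rw [← hPs, ← hTP, hPP]
  have ha_eq : ∀ t, a t = inner ℝ (T (W t - P (W t))) (W t) := fun t => by
    simp only [ha]
    have h1 : inner ℝ (T (W t - P (W t))) (P (W t)) = (0 : ℝ) := by
      rw [← hPs, ← hTP, map_sub, hPP, sub_self, map_zero, inner_zero_left]
    rw [inner_sub_right, h1, sub_zero]
  set n' : ℝ → ℝ := fun t => -(2 / p) * (x t ^ 2 - c * p * n t - inner ℝ (R t) (P (W t))) with hn'
  set a' : ℝ → ℝ := fun t => -(2 / p) *
    (y t ^ 2 - c * p * a t - inner ℝ (R t) (W t - P (W t))) with ha'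
  have hnder : ∀ t, t₃ < t → HasDerivAt n (n' t) t := by
    intro t ht
    have ht1 : t₁ < t := by linarith
    have hS : (T ∘L P).IsSymmetric := fun u v => by
      simp only [ContinuousLinearMap.coe_coe, ContinuousLinearMap.comp_apply]
      rw [hTs, hPs, hTP]
    have hd : HasDerivAt (fun s => (T ∘L P) (W s)) (P (-F t + c • T (W t))) t := by
      have h := P.hasFDerivAt.comp_hasDerivAt t (hder t ht1)
      refine h.congr_of_eventuallyEq (Eventually.of_forall fun s => ?_)
      simp only [ContinuousLinearMap.comp_apply, Function.comp_apply, hTP]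
    have h := hasDerivAt_inner_apply_self hS (hW.continuousAt (Ioi_mem_nhds ht1)) hd
    have hfun : (fun s => inner ℝ ((T ∘L P) (W s)) (W s)) = n := funext fun s => (hn_eq s).symm
    rw [hfun] at h
    refine h.congr_deriv ?_
    have h1 : inner ℝ (W t) (P (W t)) = x t ^ 2 := by
      simp only [hx]
      rw [← real_inner_self_eq_norm_sq, hPs, hPP]
    have h2 : inner ℝ (T (W t)) (P (W t)) = n t := by rw [hn_eq, hTP, hPs]
    rw [hPs, inner_add_left, inner_neg_left, hFR, real_inner_smul_left, real_inner_smul_left,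
      inner_sub_left, h1, h2]
    simp only [hn']
    field_simp
    ring
  have hader : ∀ t, t₃ < t → HasDerivAt a (a' t) t := by
    intro t ht
    have ht1 : t₁ < t := by linarith
    have hS : (T - T ∘L P).IsSymmetric := fun u v => by
      simp only [ContinuousLinearMap.coe_coe, ContinuousLinearMap.comp_apply,
        sub_apply, inner_sub_left, inner_sub_right]
      rw [hTs, hTs, hPs, hTP]
    have hd : HasDerivAt (fun s => (T - T ∘L P) (W s))
        ((-F t + c • T (W t)) - P (-F t + c • T (W t))) t := by
      have h := (hder t ht1).sub (P.hasFDerivAt.comp_hasDerivAt t (hder t ht1))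
      refine h.congr_of_eventuallyEq (Eventually.of_forall fun s => ?_)
      simp only [ContinuousLinearMap.comp_apply, Pi.sub_apply, Function.comp_apply, hTP,
        sub_apply]
    have h := hasDerivAt_inner_apply_self hS (hW.continuousAt (Ioi_mem_nhds ht1)) hd
    have hfun : (fun s => inner ℝ ((T - T ∘L P) (W s)) (W s)) = a := funext fun s => by
      rw [ha_eq, map_sub, sub_apply, ContinuousLinearMap.comp_apply]
    rw [hfun] at h
    refine h.congr_deriv ?_
    have h1 : inner ℝ (W t) (W t - P (W t)) = y t ^ 2 := by
      simp only [hy]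
      rw [← real_inner_self_eq_norm_sq (W t - P (W t)), inner_sub_left (W t), hPorth, sub_zero]
    have h2 : inner ℝ (T (W t)) (W t - P (W t)) = a t := by
      rw [ha_eq, map_sub, inner_sub_left, inner_sub_right, hTP, hPs]
    have h3 : inner ℝ ((-F t + c • T (W t)) - P (-F t + c • T (W t))) (W t) =
        inner ℝ (-F t + c • T (W t)) (W t - P (W t)) := by
      rw [inner_sub_left, inner_sub_right, hPs]
    rw [h3, inner_add_left, inner_neg_left, hFR, real_inner_smul_left, real_inner_smul_left,
      inner_sub_left, h1, h2]
    simp only [ha']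
    field_simp
    ring
  have hhigh' : ∀ t, Λ * n t ≤ x t ^ 2 := fun t => hhigh _
  have hhigh'' : ∀ t, c * p * n t ≤ (1 - ρ) * x t ^ 2 := fun t => by
    rw [← hρΛ, mul_assoc]
    exact mul_le_mul_of_nonneg_left (hhigh' t) (by linarith)
  have hlow' : ∀ t, (1 + σ) * y t ^ 2 ≤ c * p * a t := fun t => hlow _
  have hcross : ∀ t, 2 * (x t * y t) ≤ x t ^ 2 + y t ^ 2 := fun t => by
    nlinarith [sq_nonneg (x t - y t)]
  have hWlim : Tendsto (fun t => ‖W t‖ ^ 2) atTop (𝓝 0) := by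
    have h1 : Tendsto (fun t => e t / c₁) atTop (𝓝 0) := by simpa using hlim.div_const c₁
    refine squeeze_zero' (Eventually.of_forall fun t => sq_nonneg _) ?_ h1
    filter_upwards [eventually_gt_atTop t₁] with t ht
    rw [le_div_iff₀ hc₁]; linarith [hlo t ht]
  have hquad : ∀ z : H, inner ℝ (T z) z ≤ ‖T‖ * ‖z‖ ^ 2 := fun z => by
    refine (real_inner_le_norm _ _).trans ?_
    rw [sq, ← mul_assoc]
    exact mul_le_mul_of_nonneg_right (T.le_opNorm z) (norm_nonneg _)
  have hTW : Tendsto (fun t => ‖T‖ * ‖W t‖ ^ 2) atTop (𝓝 0) := by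
    simpa using hWlim.const_mul ‖T‖
  have hnlim : Tendsto n atTop (𝓝 0) := by
    refine squeeze_zero hn0 (fun t => (hquad _).trans ?_) hTW
    refine mul_le_mul_of_nonneg_left ?_ (norm_nonneg _)
    rw [hpyth]; nlinarith [sq_nonneg (y t)]
  have halim : Tendsto a atTop (𝓝 0) := by
    refine squeeze_zero ha0 (fun t => (hquad _).trans ?_) hTW
    refine mul_le_mul_of_nonneg_left ?_ (norm_nonneg _)
    rw [hpyth]; nlinarith [sq_nonneg (x t)]
  have hp2 : 0 < 2 / p := by positivity
  -- The derivative of a - n is at least (2/p) ((ρ - 2ε) x² + (σ - 2ε) y²) ≥ 0. A nondecreasing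
  -- function tending to 0 is nonpositive: convergence of W to 0 is exactly what excludes a dominant
  -- unstable part.
  have han : ∀ t, t₃ < t → a t ≤ n t := by
    have hmono : MonotoneOn (fun t => a t - n t) (Ioi t₃) := by
      refine monotoneOn_of_deriv_nonneg (convex_Ioi t₃)
        (fun t ht => ((hader t ht).sub (hnder t ht)).continuousAt.continuousWithinAt)
        (fun t ht => ?_) (fun t ht => ?_)
      · rw [interior_Ioi] at ht
        exact ((hader t ht).sub (hnder t ht)).differentiableAt.differentiableWithinAt
      · rw [interior_Ioi] at ht
        have hd := ((hader t ht).sub (hnder t ht)).deriv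
        rw [show (fun t => a t - n t) = a - n from rfl, hd]
        have h1 := hRle t ht (P (W t))
        have h2 : -inner ℝ (R t) (W t - P (W t)) ≤ ε t * (x t + y t) * y t := by
          have h := (neg_le_abs _).trans (abs_real_inner_le_norm (R t) (W t - P (W t)))
          refine h.trans (mul_le_mul_of_nonneg_right ?_ (norm_nonneg _))
          exact (hR t (by linarith [show t₃ < t from ht])).trans
            (mul_le_mul_of_nonneg_left (hWle t) (hε0 t ht))
        have h3 := hhigh'' t
        have h4 := hlow' t
        have h5 := hcross t
        have h6 := hε0 t ht
        have h7 := hεσ t ht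
        have h8 := hερ t ht
        have h9 : -(ε t * (x t + y t) * x t) ≤ -inner ℝ (R t) (P (W t)) := by
          simpa only [hx] using neg_le_neg h1
        have h10 : ε t * (x t + y t) * (x t + y t) ≤ 2 * ε t * (x t ^ 2 + y t ^ 2) := by
          linarith [mul_le_mul_of_nonneg_left h5 h6]
        have h11 : 0 ≤ (σ - 2 * ε t) * y t ^ 2 + (ρ - 2 * ε t) * x t ^ 2 := by
          have := sq_nonneg (x t); have := sq_nonneg (y t)
          apply add_nonneg <;> apply mul_nonneg <;> linarith
        have h12 : 0 ≤ (x t ^ 2 - c * p * n t - inner ℝ (R t) (P (W t))) -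
            (y t ^ 2 - c * p * a t - inner ℝ (R t) (W t - P (W t))) := by
          linarith
        simp only [hn', ha']
        linarith [mul_nonneg hp2.le h12]
    intro t ht
    have hl : Tendsto (fun t => a t - n t) atTop (𝓝 0) := by simpa using halim.sub hnlim
    have : a t - n t ≤ 0 := by
      refine ge_of_tendsto hl ?_
      filter_upwards [eventually_ge_atTop t] with s hs
      exact hmono ht (show s ∈ Ioi t₃ from lt_of_lt_of_le ht hs) hs
    linarith
  have hycp : ∀ t, t₃ < t → y t ^ 2 ≤ c * p * n t := fun t ht => by
    have h1 := hlow' t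
    have h2 := mul_le_mul_of_nonneg_left (han t ht) hcp.le
    nlinarith [sq_nonneg (y t)]
  have hn'le : ∀ t, t₃ < t →
      n' t ≤ -(2 / p) * ((1 - 2 * ε t) * x t ^ 2 - (1 + ε t) * (c * p * n t)) := by
    intro t ht
    have h1 := hRle t ht (P (W t))
    have h2 := hycp t ht
    have h3 := hcross t
    have h4 := hε0 t ht
    have h5 : 0 ≤ c * p * n t := mul_nonneg hcp.le (hn0 t)
    have h6 : inner ℝ (R t) (P (W t)) ≤ 2 * ε t * x t ^ 2 + ε t * (c * p * n t) := by
      refine h1.trans ?_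
      have h7 : ε t * (x t + y t) * ‖P (W t)‖ = ε t * (x t ^ 2 + x t * y t) := by
        simp only [hx]; ring
      rw [h7]
      have h8 : x t ^ 2 + x t * y t ≤ 2 * x t ^ 2 + c * p * n t := by
        nlinarith [sq_nonneg (x t), sq_nonneg (y t)]
      nlinarith
    simp only [hn']
    nlinarith
  -- The rate defect 3 Λ ε collects 2 ε Λ from the stable part and at most ε Λ from the unstable
  -- part, the latter because y² ≤ c p n and c p < Λ.
  refine exists_sharp_exponential_bound (n := n) (n' := n') (t₁ := t₃)
    (k₁ := ρ / (4 * p) / c₂) (k₂ := 2 / p * (3 * Λ) * κ) (k₃ := ‖T‖ / c₁ + 1) (K := K)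
    (r := 2 * (Λ - c * p) / p) (η := η) (by positivity) (by positivity) (by positivity)
    (div_pos (by linarith) hp) hη hK (fun t _ => hn0 t) (fun t ht => he0 t (by linarith)) hnder
    ?_ ?_ ?_ (fun s t hs => hgrow s t (by linarith)) hlim
  · intro t ht
    refine (hn'le t ht).trans ?_
    have h1 := hhigh'' t
    have h2 := hερ t ht
    have h3 := hε0 t ht
    have h4 := hycp t ht
    have h5 := hup t (by linarith)
    have h6 : ρ / 4 * x t ^ 2 ≤ (1 - 2 * ε t) * x t ^ 2 - (1 + ε t) * (c * p * n t) := by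
      have h7 : (1 + ε t) * (c * p * n t) ≤ (1 + ε t) * ((1 - ρ) * x t ^ 2) :=
        mul_le_mul_of_nonneg_left h1 (by linarith)
      have h8 : 0 ≤ x t ^ 2 * (3 * ρ / 4 - 3 * ε t + ε t * ρ) :=
        mul_nonneg (sq_nonneg _) (by nlinarith)
      nlinarith
    -- Here y² ≤ c p n ≤ (1 - ρ) x², so the full norm of W is controlled by its stable component.
    have h9 : e t / c₂ ≤ 2 * x t ^ 2 := by
      rw [div_le_iff₀ hc₂]
      have h10 : ‖W t‖ ^ 2 ≤ 2 * x t ^ 2 := by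
        rw [hpyth]; nlinarith [sq_nonneg (x t)]
      nlinarith
    calc -(2 / p) * ((1 - 2 * ε t) * x t ^ 2 - (1 + ε t) * (c * p * n t))
        ≤ -(2 / p) * (ρ / 4 * x t ^ 2) := by nlinarith
      _ = -(ρ / (4 * p)) * (2 * x t ^ 2) := by field_simp
      _ ≤ -(ρ / (4 * p)) * (e t / c₂) := by
        have : 0 < ρ / (4 * p) := by positivity
        nlinarith
      _ = _ := by ring
  · intro t ht
    refine (hn'le t ht).trans ?_
    have h1 := hhigh' t
    have h2 := hερ t ht
    have h3 := hε0 t ht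
    have h4 : (1 - 2 * ε t) * (Λ * n t) ≤ (1 - 2 * ε t) * x t ^ 2 :=
      mul_le_mul_of_nonneg_left h1 (by linarith)
    have h5 : ε t * (c * p * n t) ≤ ε t * (Λ * n t) :=
      mul_le_mul_of_nonneg_left (mul_le_mul_of_nonneg_right hΛ.le (hn0 t)) h3
    have h6 : (Λ - c * p - 3 * Λ * ε t) * n t ≤
        (1 - 2 * ε t) * x t ^ 2 - (1 + ε t) * (c * p * n t) := by nlinarith
    calc -(2 / p) * ((1 - 2 * ε t) * x t ^ 2 - (1 + ε t) * (c * p * n t))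
        ≤ -(2 / p) * ((Λ - c * p - 3 * Λ * ε t) * n t) := by nlinarith
      _ = _ := by simp only [hε]; ring
  · intro t ht
    have h1 : n t ≤ ‖T‖ * ‖W t‖ ^ 2 := (hquad _).trans (mul_le_mul_of_nonneg_left
      (by rw [hpyth]; nlinarith [sq_nonneg (y t)]) (norm_nonneg _))
    have h2 : ‖W t‖ ^ 2 ≤ e t / c₁ := by
      rw [le_div_iff₀ hc₁]; linarith [hlo t (by linarith)]
    have h3 := he0 t (by linarith)
    calc n t ≤ ‖T‖ * (e t / c₁) := h1.trans (mul_le_mul_of_nonneg_left h2 (norm_nonneg _))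
      _ = ‖T‖ / c₁ * e t := by ring
      _ ≤ _ := mul_le_mul_of_nonneg_right (by linarith) h3

end

end Flow

/-! ### Pointwise inequalities in the ratio v / V -/

section Pointwise

/-- The function f(s) - m (s - 1)² has a minimum at s = 1. Multiplying the derivative condition by s
- 1 covers both sides of 1 at once. -/
theorem mul_sq_le_sub_of_hasDerivAt {f f' : ℝ → ℝ} {a b m : ℝ}
    (hf : ∀ s ∈ Icc a b, HasDerivAt f (f' s) s) (h1 : (1 : ℝ) ∈ Icc a b)
    (hm : ∀ s ∈ Icc a b, 2 * m * (s - 1) ^ 2 ≤ f' s * (s - 1)) {r : ℝ} (hr : r ∈ Icc a b) :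
    m * (r - 1) ^ 2 ≤ f r - f 1 := by
  set h : ℝ → ℝ := fun s => f s - m * (s - 1) ^ 2 with hh
  have hd : ∀ s ∈ Icc a b, HasDerivAt h (f' s - 2 * m * (s - 1)) s := fun s hs => by
    have h2 : HasDerivAt (fun s : ℝ => m * (s - 1) ^ 2) (2 * m * (s - 1)) s := by
      have h3 := (((hasDerivAt_id s).sub_const 1).pow 2).const_mul m
      refine h3.congr_deriv ?_
      simp only [id_eq]; push_cast; ring
    exact (hf s hs).sub h2
  suffices h 1 ≤ h r by
    simp only [hh] at this
    linarith
  rcases le_total r 1 with hr1 | hr1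
  · have hsub : Icc r 1 ⊆ Icc a b := Icc_subset_Icc hr.1 h1.2
    refine antitoneOn_of_deriv_nonpos (convex_Icc r 1)
      (fun s hs => (hd s (hsub hs)).continuousAt.continuousWithinAt)
      (fun s hs => (hd s (hsub (interior_subset hs))).differentiableAt.differentiableWithinAt)
      (fun s hs => ?_) (left_mem_Icc.mpr hr1) (right_mem_Icc.mpr hr1) hr1
    rw [interior_Icc] at hs
    have hs' := hsub (Ioo_subset_Icc_self hs)
    rw [(hd s hs').deriv]
    have := hm s hs'
    have hneg : s - 1 < 0 := by linarith [hs.2]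
    nlinarith
  · have hsub : Icc 1 r ⊆ Icc a b := Icc_subset_Icc h1.1 hr.2
    refine monotoneOn_of_deriv_nonneg (convex_Icc 1 r)
      (fun s hs => (hd s (hsub hs)).continuousAt.continuousWithinAt)
      (fun s hs => (hd s (hsub (interior_subset hs))).differentiableAt.differentiableWithinAt)
      (fun s hs => ?_) (left_mem_Icc.mpr hr1) (right_mem_Icc.mpr hr1) hr1
    rw [interior_Icc] at hs
    have hs' := hsub (Ioo_subset_Icc_self hs)
    rw [(hd s hs').deriv]
    have := hm s hs'
    have hpos : 0 < s - 1 := by linarith [hs.1]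
    nlinarith

theorem sub_le_mul_sq_of_hasDerivAt {f f' : ℝ → ℝ} {a b m : ℝ}
    (hf : ∀ s ∈ Icc a b, HasDerivAt f (f' s) s) (h1 : (1 : ℝ) ∈ Icc a b)
    (hm : ∀ s ∈ Icc a b, f' s * (s - 1) ≤ 2 * m * (s - 1) ^ 2) {r : ℝ} (hr : r ∈ Icc a b) :
    f r - f 1 ≤ m * (r - 1) ^ 2 := by
  have := mul_sq_le_sub_of_hasDerivAt (f := fun s => -f s) (f' := fun s => -f' s) (m := -m)
    (fun s hs => (hf s hs).neg) h1 (fun s hs => by linarith [hm s hs]) hr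
  linarith

theorem exists_abs_rpow_sub_rpow_le (q : ℝ) : ∃ C : ℝ, 0 ≤ C ∧
    ∀ r ∈ Icc (3 / 4 : ℝ) (5 / 4), ∀ s ∈ Icc (3 / 4 : ℝ) (5 / 4), |r ^ q - s ^ q| ≤ C * |r - s| := by
  have hpos : ∀ x ∈ Icc (3 / 4 : ℝ) (5 / 4), 0 < x := fun x hx => by linarith [hx.1]
  have hcont : ContinuousOn (fun s : ℝ => q * s ^ (q - 1)) (Icc (3 / 4) (5 / 4)) :=
    (continuousOn_id.rpow_const fun x hx => Or.inl (hpos x hx).ne').const_mul q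
  obtain ⟨C, hC⟩ := isCompact_Icc.exists_bound_of_continuousOn hcont
  refine ⟨C, (norm_nonneg _).trans (hC 1 (by norm_num)), fun r hr s hs => ?_⟩
  exact (convex_Icc (3 / 4 : ℝ) (5 / 4)).norm_image_sub_le_of_norm_hasDerivWithin_le
    (fun x hx => (Real.hasDerivAt_rpow_const (p := q) (Or.inl (hpos x hx).ne')).hasDerivWithinAt)
    hC hs hr

variable {p : ℝ}

theorem abs_sub_le_abs_rpow_sub_rpow (hp : 1 < p) : ∃ C : ℝ, 0 ≤ C ∧
    ∀ r ∈ Icc (3 / 4 : ℝ) (5 / 4), ∀ s ∈ Icc (3 / 4 : ℝ) (5 / 4), |r - s| ≤ C * |r ^ p - s ^ p| := by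
  have hkey : ∀ r ∈ Icc (3 / 4 : ℝ) (5 / 4), ∀ s ∈ Icc (3 / 4 : ℝ) (5 / 4), s ≤ r →
      (3 / 4 : ℝ) ^ (p - 1) * (r - s) ≤ r ^ p - s ^ p := by
    intro r hr s hs hsr
    have hs0 : 0 < s := by linarith [hs.1]
    have hr0 : 0 < r := by linarith [hr.1]
    have h1 : r ^ p = r ^ (p - 1) * r := by
      rw [← Real.rpow_add_one hr0.ne', sub_add_cancel]
    have h2 : s ^ p = s ^ (p - 1) * s := by
      rw [← Real.rpow_add_one hs0.ne', sub_add_cancel]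
    have h3 : s ^ (p - 1) ≤ r ^ (p - 1) := Real.rpow_le_rpow hs0.le hsr (by linarith)
    have h4 : (3 / 4 : ℝ) ^ (p - 1) ≤ s ^ (p - 1) :=
      Real.rpow_le_rpow (by norm_num) hs.1 (by linarith)
    rw [h1, h2]
    nlinarith
  have hc : 0 < (3 / 4 : ℝ) ^ (p - 1) := by positivity
  refine ⟨((3 / 4 : ℝ) ^ (p - 1))⁻¹, by positivity, fun r hr s hs => ?_⟩
  rw [inv_mul_eq_div, le_div_iff₀ hc, mul_comm]
  rcases le_total s r with h | h
  · rw [abs_of_nonneg (sub_nonneg.mpr h)]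
    exact (hkey r hr s hs h).trans (le_abs_self _)
  · rw [abs_sub_comm r, abs_sub_comm (r ^ p), abs_of_nonneg (sub_nonneg.mpr h)]
    exact (hkey s hs r hr h).trans (le_abs_self _)

theorem abs_sub_one_le_abs_rpow_sub_one (hp : 1 < p) {r : ℝ} (hr : 0 ≤ r) :
    |r - 1| ≤ |r ^ p - 1| := by
  rcases le_total 1 r with h | h
  · have h1 : r ≤ r ^ p := by
      simpa using Real.rpow_le_rpow_of_exponent_le h hp.le
    rw [abs_of_nonneg (by linarith), abs_of_nonneg (by linarith)]
    linarith
  · have h1 : r ^ p ≤ r := by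
      rcases eq_or_lt_of_le hr with rfl | h0
      · rw [Real.zero_rpow (by linarith)]
      · simpa using Real.rpow_le_rpow_of_exponent_ge h0 h hp.le
    rw [abs_of_nonpos (by linarith), abs_of_nonpos (by linarith)]
    linarith

theorem exists_abs_rpow_sub_linear_le (hp : 1 < p) : ∃ C : ℝ, 0 ≤ C ∧
    ∀ r ∈ Icc (3 / 4 : ℝ) (5 / 4), |r ^ p - 1 - p * (r - 1)| ≤ C * (r - 1) ^ 2 := by
  obtain ⟨C, hC0, hC⟩ := exists_abs_rpow_sub_rpow_le (p - 1)
  have h1 : (1 : ℝ) ∈ Icc (3 / 4 : ℝ) (5 / 4) := by norm_num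
  have hd : ∀ s ∈ Icc (3 / 4 : ℝ) (5 / 4),
      HasDerivAt (fun s : ℝ => s ^ p - 1 - p * (s - 1)) (p * s ^ (p - 1) - p) s := fun s hs => by
    have h2 := (Real.hasDerivAt_rpow_const (p := p)
      (Or.inl (show s ≠ 0 by linarith [hs.1]))).sub_const 1
    have h3 := ((hasDerivAt_id s).sub_const 1).const_mul p
    refine (h2.sub h3).congr_deriv ?_
    ring
  have hb : ∀ s ∈ Icc (3 / 4 : ℝ) (5 / 4),
      |(p * s ^ (p - 1) - p) * (s - 1)| ≤ p * C * (s - 1) ^ 2 := fun s hs => by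
    have h2 := hC s hs 1 h1
    rw [Real.one_rpow] at h2
    rw [show (p * s ^ (p - 1) - p) * (s - 1) = p * ((s ^ (p - 1) - 1) * (s - 1)) by ring, abs_mul,
      abs_of_pos (by linarith : 0 < p), abs_mul, mul_assoc, ← sq_abs (s - 1), sq, ← mul_assoc C]
    exact mul_le_mul_of_nonneg_left (mul_le_mul_of_nonneg_right h2 (abs_nonneg _)) (by linarith)
  refine ⟨p * C / 2, by positivity, fun r hr => ?_⟩
  rw [abs_le]
  have hu := sub_le_mul_sq_of_hasDerivAt hd h1 (m := p * C / 2)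
    (fun s hs => by linarith [(abs_le.mp (hb s hs)).2]) hr
  have hl := mul_sq_le_sub_of_hasDerivAt hd h1 (m := -(p * C / 2))
    (fun s hs => by linarith [(abs_le.mp (hb s hs)).1]) hr
  simp only [Real.one_rpow, sub_self, mul_zero, sub_zero] at hu hl
  exact ⟨by linarith, hu⟩

/-- The derivative of the middle expression is (p+1) r^(p-1) (r-1), and r^(p-1) lies between its
values at 3/4 and 5/4. -/
theorem exists_relative_entropy_bounds (hp : 1 < p) : ∃ c₁ c₂ : ℝ, 0 < c₁ ∧ 0 < c₂ ∧
    ∀ r ∈ Icc (3 / 4 : ℝ) (5 / 4),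
      c₁ * (r - 1) ^ 2 ≤ r ^ (p + 1) - 1 - (p + 1) / p * (r ^ p - 1) ∧
      r ^ (p + 1) - 1 - (p + 1) / p * (r ^ p - 1) ≤ c₂ * (r - 1) ^ 2 := by
  have h1 : (1 : ℝ) ∈ Icc (3 / 4 : ℝ) (5 / 4) := by norm_num
  have hp0 : 0 < p := by linarith
  have hd : ∀ s ∈ Icc (3 / 4 : ℝ) (5 / 4),
      HasDerivAt (fun s : ℝ => s ^ (p + 1) - 1 - (p + 1) / p * (s ^ p - 1))
        ((p + 1) * (s ^ (p - 1) * (s - 1))) s := fun s hs => by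
    have hs0 : s ≠ 0 := by linarith [hs.1]
    have h2 := (Real.hasDerivAt_rpow_const (p := p + 1) (Or.inl hs0)).sub_const 1
    have h3 := ((Real.hasDerivAt_rpow_const (p := p) (Or.inl hs0)).sub_const 1).const_mul
      ((p + 1) / p)
    refine (h2.sub h3).congr_deriv ?_
    rw [show p + 1 - 1 = p - 1 + 1 by ring, Real.rpow_add_one hs0]
    field_simp
  refine ⟨(p + 1) * (3 / 4) ^ (p - 1) / 2, (p + 1) * (5 / 4) ^ (p - 1) / 2, by positivity,
    by positivity, fun r hr => ⟨?_, ?_⟩⟩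
  · have := mul_sq_le_sub_of_hasDerivAt hd h1 (m := (p + 1) * (3 / 4) ^ (p - 1) / 2)
      (fun s hs => by
        have h4 : (3 / 4 : ℝ) ^ (p - 1) ≤ s ^ (p - 1) :=
          Real.rpow_le_rpow (by norm_num) hs.1 (by linarith)
        have h5 := mul_le_mul_of_nonneg_left h4 (show 0 ≤ (p + 1) * (s - 1) ^ 2 by positivity)
        linarith) hr
    simpa using this
  · have := sub_le_mul_sq_of_hasDerivAt hd h1 (m := (p + 1) * (5 / 4) ^ (p - 1) / 2)
      (fun s hs => by
        have h4 : s ^ (p - 1) ≤ (5 / 4 : ℝ) ^ (p - 1) :=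
          Real.rpow_le_rpow (by linarith [hs.1]) hs.2 (by linarith)
        have h5 := mul_le_mul_of_nonneg_left h4 (show 0 ≤ (p + 1) * (s - 1) ^ 2 by positivity)
        linarith) hr
    simpa using this

/-- The weight `V^{(p-1)/2}`. -/
noncomputable def sqrtWeight (p V : ℝ) : ℝ := V ^ ((p - 1) / 2)

/-- The entropy density `(v^{p+1} - V^{p+1}) - ((p+1)/p) (v^p - V^p) V`. -/
noncomputable def entropyDensity (p V v : ℝ) : ℝ :=
  (v ^ (p + 1) - V ^ (p + 1)) - (p + 1) / p * (v ^ p - V ^ p) * V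

theorem sqrtWeight_pos {V : ℝ} (hV : 0 < V) : 0 < sqrtWeight p V := Real.rpow_pos_of_pos hV _

theorem sqrtWeight_sq {V : ℝ} (hV : 0 < V) : sqrtWeight p V ^ 2 = V ^ (p - 1) := by
  rw [sqrtWeight, ← Real.rpow_natCast, ← Real.rpow_mul hV.le]
  congr 1; push_cast; ring

theorem sqrtWeight_mul_self {V : ℝ} (hV : 0 < V) :
    sqrtWeight p V * sqrtWeight p V = V ^ (p - 1) := by rw [← sq, sqrtWeight_sq hV]

/-- With v = r V each relevant quantity is a power of V times a function of r alone. Estimates for r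
in [3/4, 5/4] thus hold uniformly, even where V tends to 0 at the boundary. -/
theorem sqrtWeight_mul_rpow {V r : ℝ} (hV : 0 < V) (hr : 0 ≤ r) :
    ((r * V) ^ p - V ^ p) / sqrtWeight p V = sqrtWeight p V * V * (r ^ p - 1) := by
  rw [div_eq_iff (sqrtWeight_pos hV).ne', Real.mul_rpow hr hV.le]
  have h1 : V ^ p = V ^ (p - 1) * V := by rw [← Real.rpow_add_one hV.ne', sub_add_cancel]
  rw [h1, ← sqrtWeight_mul_self hV]
  ring

theorem entropyDensity_scaling {V r : ℝ} (hV : 0 < V) (hr : 0 ≤ r) :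
    entropyDensity p V (r * V) =
      (sqrtWeight p V * V) ^ 2 * (r ^ (p + 1) - 1 - (p + 1) / p * (r ^ p - 1)) := by
  rw [entropyDensity, Real.mul_rpow hr hV.le, Real.mul_rpow hr hV.le, mul_pow, sqrtWeight_sq hV]
  have h1 : V ^ p = V ^ (p - 1) * V := by rw [← Real.rpow_add_one hV.ne', sub_add_cancel]
  have h2 : V ^ (p + 1) = V ^ (p - 1) * V * V := by rw [Real.rpow_add_one hV.ne', h1]
  rw [h2, h1]
  ring

theorem exists_mul_eq_of_abs_sub_le {V v θ : ℝ} (hV : 0 < V) (h : |v - V| ≤ θ * V) :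
    ∃ r, v = r * V ∧ |r - 1| ≤ θ := by
  refine ⟨v / V, by field_simp, ?_⟩
  rw [show v / V - 1 = (v - V) / V by field_simp, abs_div, abs_of_pos hV, div_le_iff₀ hV]
  exact h

theorem mem_Icc_of_abs_sub_one_le {r : ℝ} (h : |r - 1| ≤ 1 / 4) :
    r ∈ Icc (3 / 4 : ℝ) (5 / 4) := by
  rw [abs_le] at h
  constructor <;> linarith

theorem exists_entropyDensity_bounds (hp : 1 < p) : ∃ c₁ c₂ : ℝ, 0 < c₁ ∧ 0 < c₂ ∧
    ∀ V v : ℝ, 0 < V → |v - V| ≤ 1 / 4 * V →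
      c₁ * ((v ^ p - V ^ p) / sqrtWeight p V) ^ 2 ≤ entropyDensity p V v ∧
      entropyDensity p V v ≤ c₂ * ((v ^ p - V ^ p) / sqrtWeight p V) ^ 2 := by
  obtain ⟨c₁, c₂, hc₁, hc₂, hb⟩ := exists_relative_entropy_bounds hp
  obtain ⟨L, hL0, hL⟩ := exists_abs_rpow_sub_rpow_le p
  -- The added 1 keeps the denominator positive whatever the value of L.
  refine ⟨c₁ / (L ^ 2 + 1), c₂, by positivity, hc₂, fun V v hV hv => ?_⟩
  obtain ⟨r, rfl, hr⟩ := exists_mul_eq_of_abs_sub_le hV hv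
  have hr' := mem_Icc_of_abs_sub_one_le hr
  have hr0 : 0 ≤ r := by linarith [hr'.1]
  obtain ⟨h1, h2⟩ := hb r hr'
  rw [sqrtWeight_mul_rpow hV hr0, entropyDensity_scaling hV hr0, mul_pow]
  have hs : 0 ≤ (sqrtWeight p V * V) ^ 2 := sq_nonneg _
  have h3 := hL r hr' 1 (by norm_num)
  rw [Real.one_rpow] at h3
  have h4 : (r ^ p - 1) ^ 2 ≤ L ^ 2 * (r - 1) ^ 2 := by
    rw [← sq_abs, ← sq_abs (r - 1), ← mul_pow]
    exact pow_le_pow_left₀ (abs_nonneg _) h3 2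
  have h5 : (r - 1) ^ 2 ≤ (r ^ p - 1) ^ 2 :=
    sq_le_sq.mpr (abs_sub_one_le_abs_rpow_sub_one hp hr0)
  constructor
  · have h6 : c₁ / (L ^ 2 + 1) * (r ^ p - 1) ^ 2 ≤ c₁ * (r - 1) ^ 2 := by
      rw [div_mul_eq_mul_div, div_le_iff₀ (by positivity), mul_assoc]
      exact mul_le_mul_of_nonneg_left (by nlinarith [sq_nonneg (r - 1)]) hc₁.le
    calc _ = (sqrtWeight p V * V) ^ 2 * (c₁ / (L ^ 2 + 1) * (r ^ p - 1) ^ 2) := by ring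
      _ ≤ _ := mul_le_mul_of_nonneg_left (h6.trans h1) hs
  · calc _ ≤ (sqrtWeight p V * V) ^ 2 * (c₂ * (r ^ p - 1) ^ 2) :=
        mul_le_mul_of_nonneg_left (h2.trans (mul_le_mul_of_nonneg_left h5 hc₂.le)) hs
      _ = _ := by ring

theorem abs_sqrtWeight_mul_sub_le (hp : 1 < p) {V v : ℝ} (hV : 0 < V)
    (hv : |v - V| ≤ 1 / 4 * V) :
    |sqrtWeight p V * (v - V)| ≤ |(v ^ p - V ^ p) / sqrtWeight p V| := by
  obtain ⟨r, rfl, hr⟩ := exists_mul_eq_of_abs_sub_le hV hv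
  have hr0 : 0 ≤ r := by linarith [(mem_Icc_of_abs_sub_one_le hr).1]
  rw [sqrtWeight_mul_rpow hV hr0,
    show sqrtWeight p V * (r * V - V) = sqrtWeight p V * V * (r - 1) by ring,
    abs_mul (sqrtWeight p V * V), abs_mul (sqrtWeight p V * V)]
  exact mul_le_mul_of_nonneg_left (abs_sub_one_le_abs_rpow_sub_one hp hr0) (abs_nonneg _)

theorem exists_linearization_error_le (hp : 1 < p) : ∃ C : ℝ, 0 ≤ C ∧
    ∀ V v θ : ℝ, 0 < V → |v - V| ≤ 1 / 4 * V → |v - V| ≤ θ * V →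
      |(v ^ p - V ^ p) / sqrtWeight p V - p * (sqrtWeight p V * (v - V))| ≤
        C * θ * |(v ^ p - V ^ p) / sqrtWeight p V| := by
  obtain ⟨C, hC0, hC⟩ := exists_abs_rpow_sub_linear_le hp
  refine ⟨C, hC0, fun V v θ hV hv hθ => ?_⟩
  obtain ⟨r, rfl, hr⟩ := exists_mul_eq_of_abs_sub_le hV hv
  have hrθ : |r - 1| ≤ θ := by
    rwa [show r * V - V = (r - 1) * V by ring, abs_mul, abs_of_pos hV,
      mul_le_mul_iff_left₀ hV] at hθ
  have hr' := mem_Icc_of_abs_sub_one_le hr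
  have hr0 : 0 ≤ r := by linarith [hr'.1]
  rw [sqrtWeight_mul_rpow hV hr0, show sqrtWeight p V * V * (r ^ p - 1) -
    p * (sqrtWeight p V * (r * V - V)) = sqrtWeight p V * V * (r ^ p - 1 - p * (r - 1)) by ring,
    abs_mul, abs_mul _ (r ^ p - 1)]
  have h1 : C * (r - 1) ^ 2 ≤ C * θ * |r ^ p - 1| := by
    rw [← sq_abs, sq, mul_assoc]
    exact mul_le_mul_of_nonneg_left (mul_le_mul hrθ (abs_sub_one_le_abs_rpow_sub_one hp hr0)
      (abs_nonneg _) ((abs_nonneg _).trans hrθ)) hC0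
  calc _ ≤ |sqrtWeight p V * V| * (C * θ * |r ^ p - 1|) :=
        mul_le_mul_of_nonneg_left ((hC r hr').trans h1) (abs_nonneg _)
    _ = _ := by ring

/-- Since (w V)² = V · V^p and the ratios stay in a bounded interval, squares are dominated by first
powers of |v^p - u^p|. This converts continuity of v^p in L¹ into continuity in L² of the weighted
classes. -/
theorem exists_sq_difference_le (hp : 1 < p) : ∃ C : ℝ, 0 ≤ C ∧
    ∀ V v u : ℝ, 0 < V → |v - V| ≤ 1 / 4 * V → |u - V| ≤ 1 / 4 * V →
      ((v ^ p - V ^ p) / sqrtWeight p V - (u ^ p - V ^ p) / sqrtWeight p V) ^ 2 ≤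
        C * V * |v ^ p - u ^ p| ∧
      (sqrtWeight p V * (v - V) - sqrtWeight p V * (u - V)) ^ 2 ≤ C * V * |v ^ p - u ^ p| := by
  obtain ⟨L, hL0, hL⟩ := exists_abs_rpow_sub_rpow_le p
  obtain ⟨M, hM0, hM⟩ := abs_sub_le_abs_rpow_sub_rpow hp
  refine ⟨L + M, by positivity, fun V v u hV hv hu => ?_⟩
  obtain ⟨r, rfl, hr⟩ := exists_mul_eq_of_abs_sub_le hV hv
  obtain ⟨s, rfl, hs⟩ := exists_mul_eq_of_abs_sub_le hV hu
  have hr' := mem_Icc_of_abs_sub_one_le hr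
  have hs' := mem_Icc_of_abs_sub_one_le hs
  have hr0 : 0 ≤ r := by linarith [hr'.1]
  have hs0 : 0 ≤ s := by linarith [hs'.1]
  have hrs : |r - s| ≤ 1 := by
    rw [abs_le]; constructor <;> linarith [hr'.1, hr'.2, hs'.1, hs'.2]
  rw [sqrtWeight_mul_rpow hV hr0, sqrtWeight_mul_rpow hV hs0, Real.mul_rpow hr0 hV.le,
    Real.mul_rpow hs0 hV.le, ← sub_mul, abs_mul, abs_of_pos (Real.rpow_pos_of_pos hV p)]
  have hsq : (sqrtWeight p V * V) ^ 2 = V * V ^ p := by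
    have h1 : V ^ p = V ^ (p - 1) * V := by rw [← Real.rpow_add_one hV.ne', sub_add_cancel]
    rw [mul_pow, sqrtWeight_sq hV, h1]; ring
  have hVV : 0 ≤ V * V ^ p := by positivity
  have ha := abs_nonneg (r ^ p - s ^ p)
  have h1 := hL r hr' s hs'
  have h2 := hM r hr' s hs'
  constructor
  · have h3 : (r ^ p - s ^ p) ^ 2 ≤ (L + M) * |r ^ p - s ^ p| := by
      rw [← sq_abs, sq]
      exact mul_le_mul_of_nonneg_right (h1.trans (by nlinarith)) ha
    calc _ = (sqrtWeight p V * V) ^ 2 * (r ^ p - s ^ p) ^ 2 := by ring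
      _ ≤ V * V ^ p * ((L + M) * |r ^ p - s ^ p|) := by
        rw [hsq]; exact mul_le_mul_of_nonneg_left h3 hVV
      _ = _ := by ring
  · have h3 : (r - s) ^ 2 ≤ (L + M) * |r ^ p - s ^ p| := by
      rw [← sq_abs, sq]
      calc |r - s| * |r - s| ≤ 1 * (M * |r ^ p - s ^ p|) :=
            mul_le_mul hrs h2 (abs_nonneg _) zero_le_one
        _ ≤ _ := by nlinarith
    calc _ = (sqrtWeight p V * V) ^ 2 * (r - s) ^ 2 := by ring
      _ ≤ V * V ^ p * ((L + M) * |r ^ p - s ^ p|) := by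
        rw [hsq]; exact mul_le_mul_of_nonneg_left h3 hVV
      _ = _ := by ring

/-- The entropy density is convex in z = v^p, with derivative ((p+1)/p) (v - V); this is the tangent
inequality at v. It amounts to Young's inequality for the product v u^p with exponents p+1 and
(p+1)/p. -/
theorem entropyDensity_sub_le (hp : 1 < p) {V v u : ℝ} (hV : 0 < V) (hv : 0 ≤ v) (hu : 0 ≤ u) :
    entropyDensity p V v - entropyDensity p V u ≤ (p + 1) / p * ((sqrtWeight p V * (v - V)) *
      ((v ^ p - V ^ p) / sqrtWeight p V - (u ^ p - V ^ p) / sqrtWeight p V)) := by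
  have hp0 : 0 < p := by linarith
  have hw := (sqrtWeight_pos (p := p) hV).ne'
  have h1 : (sqrtWeight p V * (v - V)) *
      ((v ^ p - V ^ p) / sqrtWeight p V - (u ^ p - V ^ p) / sqrtWeight p V) =
      (v - V) * (v ^ p - u ^ p) := by
    field_simp; ring
  have hconj : (p + 1).HolderConjugate ((p + 1) / p) := by
    rw [Real.holderConjugate_iff]
    refine ⟨by linarith, ?_⟩
    field_simp
    ring
  have hY := Real.young_inequality_of_nonneg hv (Real.rpow_nonneg hu p) hconj
  have h2 : (u ^ p) ^ ((p + 1) / p) = u ^ (p + 1) := by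
    rw [← Real.rpow_mul hu]; congr 1; field_simp
  rw [h2] at hY
  have hvv : v ^ (p + 1) = v * v ^ p := by
    rw [Real.rpow_add_one' hv (by linarith), mul_comm]
  have h3 : (p + 1) * (v * u ^ p) ≤ v ^ (p + 1) + p * u ^ (p + 1) := by
    have := mul_le_mul_of_nonneg_left hY (show 0 ≤ p + 1 by linarith)
    refine this.trans_eq ?_
    field_simp
  rw [h1]
  simp only [entropyDensity]
  have h4 : v ^ (p + 1) - u ^ (p + 1) ≤ (p + 1) / p * (v * v ^ p - v * u ^ p) := by
    rw [div_mul_eq_mul_div, le_div_iff₀ hp0, ← hvv]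
    linarith
  linarith

end Pointwise

/-! ### Translation estimates, Poincaré's inequality and grid averages -/

section Translation

open scoped ENNReal

theorem sq_lintegral_le {α : Type*} [MeasurableSpace α] (μ : Measure α) {f : α → ℝ≥0∞}
    (hf : AEMeasurable f μ) : (∫⁻ x, f x ∂μ) ^ 2 ≤ μ univ * ∫⁻ x, f x ^ 2 ∂μ := by
  have h := ENNReal.lintegral_mul_le_Lp_mul_Lq μ (p := 2) (q := 2)
    (by rw [Real.holderConjugate_iff]; norm_num) hf (g := fun _ => 1) aemeasurable_const
  simp only [Pi.mul_apply, mul_one, ENNReal.one_rpow, lintegral_const, one_mul] at h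
  calc (∫⁻ x, f x ∂μ) ^ 2
      ≤ ((∫⁻ x, f x ^ (2 : ℝ) ∂μ) ^ (1 / 2 : ℝ) * μ univ ^ (1 / 2 : ℝ)) ^ 2 := by gcongr
    _ = μ univ * ∫⁻ x, f x ^ 2 ∂μ := by
      rw [mul_pow, ← ENNReal.rpow_natCast, ← ENNReal.rpow_mul, ← ENNReal.rpow_natCast (n := 2),
        ← ENNReal.rpow_mul]
      norm_num
      rw [mul_comm]

variable {N : ℕ}

theorem continuous_gradient {ψ : Eucl N → ℝ} (hψ : ContDiff ℝ 1 ψ) : Continuous (gradient ψ) := by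
  unfold gradient
  exact (LinearIsometryEquiv.continuous _).comp (hψ.continuous_fderiv (by norm_num))

/-- The difference is the integral of the directional derivative along the segment from x to x + z;
Cauchy–Schwarz squares it. -/
theorem enorm_translate_sub_sq_le {ψ : Eucl N → ℝ} (hψ : ContDiff ℝ 1 ψ) (x z : Eucl N) :
    ‖ψ (x + z) - ψ x‖ₑ ^ 2 ≤ ‖z‖ₑ ^ 2 * ∫⁻ s in Ioc (0 : ℝ) 1, ‖gradient ψ (x + s • z)‖ₑ ^ 2 := by
  have hg := continuous_gradient hψ
  have hcont : Continuous fun s : ℝ => inner ℝ (gradient ψ (x + s • z)) z := by fun_prop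
  have hder : ∀ s ∈ uIcc (0 : ℝ) 1, HasDerivAt (fun s : ℝ => ψ (x + s • z))
      (inner ℝ (gradient ψ (x + s • z)) z) s := fun s _ => by
    have h1 : HasDerivAt (fun s : ℝ => x + s • z) z s := by
      simpa using ((hasDerivAt_id s).smul_const z).const_add x
    have h2 := ((hψ.differentiable (by norm_num)) (x + s • z)).hasFDerivAt.comp_hasDerivAt s h1
    rw [inner_gradient_left]
    exact h2
  have hint := intervalIntegral.integral_eq_sub_of_hasDerivAt hder (hcont.intervalIntegrable _ _)
  simp only [one_smul, zero_smul, add_zero] at hint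
  rw [← hint, intervalIntegral.integral_of_le zero_le_one]
  have hm : Measurable fun s : ℝ => ‖gradient ψ (x + s • z)‖ₑ := by
    have : Continuous fun s : ℝ => gradient ψ (x + s • z) := by fun_prop
    exact this.measurable.enorm
  calc ‖∫ s in Ioc (0 : ℝ) 1, inner ℝ (gradient ψ (x + s • z)) z‖ₑ ^ 2
      ≤ (∫⁻ s in Ioc (0 : ℝ) 1, ‖gradient ψ (x + s • z)‖ₑ * ‖z‖ₑ) ^ 2 := by
        gcongr
        refine (enorm_integral_le_lintegral_enorm _).trans (lintegral_mono fun s => ?_)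
        rw [← enorm_norm (gradient ψ _), ← enorm_norm z, ← enorm_mul]
        refine enorm_le_iff_norm_le.mpr ?_
        refine (norm_inner_le_norm _ _).trans (le_of_eq ?_)
        rw [norm_mul, norm_norm, norm_norm]
    _ = ‖z‖ₑ ^ 2 * (∫⁻ s in Ioc (0 : ℝ) 1, ‖gradient ψ (x + s • z)‖ₑ) ^ 2 := by
        rw [lintegral_mul_const _ hm, mul_pow, mul_comm]
    _ ≤ _ := by
        gcongr
        have h := sq_lintegral_le (volume.restrict (Ioc (0 : ℝ) 1)) hm.aemeasurable
        simpa using h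

/-- The `L²` modulus of continuity of a `C¹` function is controlled by its gradient. -/
theorem lintegral_translate_sub_sq_le {ψ : Eucl N → ℝ} (hψ : ContDiff ℝ 1 ψ) (z : Eucl N) :
    ∫⁻ x, ‖ψ (x + z) - ψ x‖ₑ ^ 2 ≤ ‖z‖ₑ ^ 2 * ∫⁻ x, ‖gradient ψ x‖ₑ ^ 2 := by
  have hg := continuous_gradient hψ
  have hm : Measurable fun q : Eucl N × ℝ => ‖gradient ψ (q.1 + q.2 • z)‖ₑ ^ 2 := by
    have : Continuous fun q : Eucl N × ℝ => gradient ψ (q.1 + q.2 • z) := by fun_prop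
    exact this.measurable.enorm.pow_const 2
  calc ∫⁻ x, ‖ψ (x + z) - ψ x‖ₑ ^ 2
      ≤ ∫⁻ x, ‖z‖ₑ ^ 2 * ∫⁻ s in Ioc (0 : ℝ) 1, ‖gradient ψ (x + s • z)‖ₑ ^ 2 :=
        lintegral_mono fun x => enorm_translate_sub_sq_le hψ x z
    _ = ‖z‖ₑ ^ 2 * ∫⁻ s in Ioc (0 : ℝ) 1, ∫⁻ x, ‖gradient ψ (x + s • z)‖ₑ ^ 2 := by
        rw [lintegral_const_mul' _ _ (by simp), lintegral_lintegral_swap hm.aemeasurable]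
    _ = _ := by
        congr 1
        simp_rw [lintegral_add_right_eq_self (fun x => ‖gradient ψ x‖ₑ ^ 2)]
        simp

/-- Poincaré inequality for functions supported in a ball. -/
theorem lintegral_sq_le_of_support_subset {ψ : Eucl N → ℝ} (hN : 1 ≤ N) (hψ : ContDiff ℝ 1 ψ)
    {R : ℝ} (hR : 0 ≤ R) (hsupp : ∀ x, ψ x ≠ 0 → ‖x‖ ≤ R) :
    ∫⁻ x, ‖ψ x‖ₑ ^ 2 ≤ ENNReal.ofReal ((2 * R + 1) ^ 2) * ∫⁻ x, ‖gradient ψ x‖ₑ ^ 2 := by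
  have : Nonempty (Fin N) := ⟨⟨0, hN⟩⟩
  have : Nontrivial (Eucl N) := inferInstance
  -- A translation longer than the diameter of the ball moves the support off itself, so on the
  -- support the difference ψ(x+z) - ψ(x) is -ψ(x). The hypothesis N ≥ 1 provides such a vector.
  obtain ⟨z, hz⟩ := exists_norm_eq (Eucl N) (show 0 ≤ 2 * R + 1 by linarith)
  have hpt : ∀ x, ‖ψ x‖ₑ ^ 2 ≤ ‖ψ (x + z) - ψ x‖ₑ ^ 2 := fun x => by
    by_cases hx : ψ x = 0
    · simp [hx]
    · have hxz : ψ (x + z) = 0 := by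
        by_contra hne
        have h1 := hsupp x hx
        have h2 := hsupp (x + z) hne
        have h3 : ‖z‖ ≤ ‖x + z‖ + ‖x‖ := by simpa using norm_sub_le (x + z) x
        linarith
      simp [hxz]
  refine (lintegral_mono hpt).trans ((lintegral_translate_sub_sq_le hψ z).trans_eq ?_)
  rw [← ofReal_norm, hz, ENNReal.ofReal_pow (by linarith)]

/-- The `L²` distance between a function and its average over the cells of a partition. -/
theorem lintegral_sub_average_sq_le {ψ : Eucl N → ℝ} (hψ : ContDiff ℝ 1 ψ)
    (hc : HasCompactSupport ψ) {ι : Type*} (A : Finset ι) (Q : ι → Set (Eucl N))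
    (hQm : ∀ i, MeasurableSet (Q i)) (hdisj : ∀ i j, i ≠ j → Disjoint (Q i) (Q j))
    {q d : ℝ} (hq : 0 < q) (hvol : ∀ i, volume (Q i) = ENNReal.ofReal q)
    (hd : ∀ i, ∀ x ∈ Q i, ∀ y ∈ Q i, ‖y - x‖ ≤ d) {Ω : Set (Eucl N)}
    (hcover : ∀ x ∈ Ω, ∃ i ∈ A, x ∈ Q i) (hΩ : MeasurableSet Ω) :
    ∫⁻ x in Ω, ‖ψ x - ∑ i ∈ A, (q⁻¹ * ∫ y in Q i, ψ y) * (Q i).indicator 1 x‖ₑ ^ 2 ≤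
      ENNReal.ofReal (q⁻¹) * volume (Metric.closedBall (0 : Eucl N) d) *
        (ENNReal.ofReal d ^ 2 * ∫⁻ x, ‖gradient ψ x‖ₑ ^ 2) := by
  have hcont := hψ.continuous
  have hψi : Integrable ψ := hcont.integrable_of_hasCompactSupport hc
  have hq' : ENNReal.ofReal q ≠ 0 := by simpa using hq
  -- By Cauchy–Schwarz the squared deviation from the mean is at most the mean of the squared
  -- differences over the cell. The cell, seen from x, lies in the ball of radius d, which makes the
  -- bound independent of the cell.
  have hpt : ∀ x ∈ Ω, ‖ψ x - ∑ i ∈ A, (q⁻¹ * ∫ y in Q i, ψ y) * (Q i).indicator 1 x‖ₑ ^ 2 ≤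
      ENNReal.ofReal q⁻¹ * ∫⁻ z in Metric.closedBall (0 : Eucl N) d, ‖ψ (x + z) - ψ x‖ₑ ^ 2 := by
    intro x hx
    obtain ⟨i, hiA, hxi⟩ := hcover x hx
    have hsum : ∑ j ∈ A, (q⁻¹ * ∫ y in Q j, ψ y) * (Q j).indicator 1 x =
        q⁻¹ * ∫ y in Q i, ψ y := by
      rw [Finset.sum_eq_single_of_mem i hiA]
      · simp [hxi]
      · intro j _ hji
        have : x ∉ Q j := fun h => (disjoint_left.mp (hdisj j i hji)) h hxi
        simp [this]
    have hvr : volume.real (Q i) = q := by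
      rw [measureReal_def, hvol, ENNReal.toReal_ofReal hq.le]
    have havg : ψ x - q⁻¹ * ∫ y in Q i, ψ y = -(q⁻¹ * ∫ y in Q i, (ψ y - ψ x)) := by
      rw [integral_sub hψi.integrableOn (integrableOn_const (by rw [hvol]; simp)),
        setIntegral_const, hvr, smul_eq_mul, mul_sub, inv_mul_cancel_left₀ hq.ne']
      ring
    have hmy : Measurable fun y => ‖ψ y - ψ x‖ₑ := (hcont.sub continuous_const).measurable.enorm
    rw [hsum, havg, enorm_neg, enorm_mul]
    have h1 : ‖∫ y in Q i, (ψ y - ψ x)‖ₑ ^ 2 ≤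
        ENNReal.ofReal q * ∫⁻ y in Q i, ‖ψ y - ψ x‖ₑ ^ 2 := by
      calc ‖∫ y in Q i, (ψ y - ψ x)‖ₑ ^ 2 ≤ (∫⁻ y in Q i, ‖ψ y - ψ x‖ₑ) ^ 2 := by
            gcongr; exact enorm_integral_le_lintegral_enorm _
        _ ≤ _ := by
            have := sq_lintegral_le (volume.restrict (Q i)) hmy.aemeasurable
            rwa [Measure.restrict_apply_univ, hvol] at this
    have h2 : ‖q⁻¹‖ₑ = ENNReal.ofReal q⁻¹ := Real.enorm_of_nonneg (by positivity)
    have h3 : ENNReal.ofReal q⁻¹ * ENNReal.ofReal q = 1 := by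
      rw [← ENNReal.ofReal_mul (by positivity), inv_mul_cancel₀ hq.ne', ENNReal.ofReal_one]
    have h4 : ∫⁻ y in Q i, ‖ψ y - ψ x‖ₑ ^ 2 ≤
        ∫⁻ z in Metric.closedBall (0 : Eucl N) d, ‖ψ (x + z) - ψ x‖ₑ ^ 2 := by
      rw [← lintegral_indicator (hQm i), ← lintegral_indicator measurableSet_closedBall,
        ← lintegral_add_left_eq_self _ x]
      refine lintegral_mono fun z => ?_
      by_cases hz : x + z ∈ Q i
      · have hzd : z ∈ Metric.closedBall (0 : Eucl N) d := by
          simpa using hd i x hxi (x + z) hz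
        rw [indicator_of_mem hz, indicator_of_mem hzd]
      · rw [indicator_of_notMem hz]; exact zero_le
    rw [mul_pow, h2]
    calc ENNReal.ofReal q⁻¹ ^ 2 * ‖∫ y in Q i, (ψ y - ψ x)‖ₑ ^ 2
        ≤ ENNReal.ofReal q⁻¹ ^ 2 * (ENNReal.ofReal q * ∫⁻ y in Q i, ‖ψ y - ψ x‖ₑ ^ 2) := by gcongr
      _ = ENNReal.ofReal q⁻¹ * ((ENNReal.ofReal q⁻¹ * ENNReal.ofReal q) *
          ∫⁻ y in Q i, ‖ψ y - ψ x‖ₑ ^ 2) := by ring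
      _ ≤ _ := by rw [h3, one_mul]; gcongr
  have hm2 : Measurable fun w : Eucl N × Eucl N => ‖ψ (w.1 + w.2) - ψ w.1‖ₑ ^ 2 := by
    have : Continuous fun w : Eucl N × Eucl N => ψ (w.1 + w.2) - ψ w.1 := by fun_prop
    exact this.measurable.enorm.pow_const 2
  calc _ ≤ ∫⁻ x in Ω, ENNReal.ofReal q⁻¹ *
          ∫⁻ z in Metric.closedBall (0 : Eucl N) d, ‖ψ (x + z) - ψ x‖ₑ ^ 2 :=
        setLIntegral_mono' hΩ hpt
    _ ≤ ∫⁻ x, ENNReal.ofReal q⁻¹ *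
          ∫⁻ z in Metric.closedBall (0 : Eucl N) d, ‖ψ (x + z) - ψ x‖ₑ ^ 2 :=
        setLIntegral_le_lintegral _ _
    _ = ENNReal.ofReal q⁻¹ *
          ∫⁻ z in Metric.closedBall (0 : Eucl N) d, ∫⁻ x, ‖ψ (x + z) - ψ x‖ₑ ^ 2 := by
        rw [lintegral_const_mul' _ _ (by simp), lintegral_lintegral_swap hm2.aemeasurable]
    _ ≤ ENNReal.ofReal q⁻¹ * ∫⁻ z in Metric.closedBall (0 : Eucl N) d,
          (ENNReal.ofReal d ^ 2 * ∫⁻ x, ‖gradient ψ x‖ₑ ^ 2) := by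
        gcongr ENNReal.ofReal q⁻¹ * ?_
        refine setLIntegral_mono' measurableSet_closedBall fun z hz => ?_
        refine (lintegral_translate_sub_sq_le hψ z).trans ?_
        gcongr
        rw [← ofReal_norm]
        exact ENNReal.ofReal_le_ofReal (by simpa using hz)
    _ = _ := by
        rw [lintegral_const, Measure.restrict_apply_univ]
        ring

/-- The cubes `∏ (ν_i / n, (ν_i + 1) / n]`. -/
def gridCell (N n : ℕ) [NeZero n] (ν : Fin N → ℤ) : Set (Eucl N) :=
  (MeasurableEquiv.toLp 2 (Fin N → ℝ)).symm ⁻¹' (BoxIntegral.unitPartition.box n ν : Set _)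

theorem measurableSet_gridCell (n : ℕ) [NeZero n] (ν : Fin N → ℤ) :
    MeasurableSet (gridCell N n ν) :=
  (MeasurableEquiv.measurable _) (BoxIntegral.unitPartition.box n ν).measurableSet_coe

theorem volume_gridCell (n : ℕ) [NeZero n] (ν : Fin N → ℤ) :
    volume (gridCell N n ν) = ENNReal.ofReal (((n : ℝ) ^ N)⁻¹) := by
  have hn : 0 < (n : ℝ) := Nat.cast_pos.mpr (NeZero.pos n)
  rw [gridCell, (EuclideanSpace.volume_preserving_symm_measurableEquiv_toLp
    (Fin N)).measure_preimage (BoxIntegral.unitPartition.box n ν).measurableSet_coe.nullMeasurableSet,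
    BoxIntegral.unitPartition.volume_box, ENNReal.ofReal_inv_of_pos (by positivity),
    ENNReal.ofReal_pow hn.le, ENNReal.ofReal_natCast, one_div, Fintype.card_fin]

theorem mem_gridCell {n : ℕ} [NeZero n] {ν : Fin N → ℤ} {x : Eucl N} :
    x ∈ gridCell N n ν ↔ BoxIntegral.unitPartition.index n (fun i => x i) = ν := by
  rw [gridCell, mem_preimage, BoxIntegral.Box.mem_coe]
  exact BoxIntegral.unitPartition.mem_box_iff_index

theorem norm_sub_le_of_mem_gridCell {n : ℕ} [NeZero n] {ν : Fin N → ℤ} {x y : Eucl N}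
    (hx : x ∈ gridCell N n ν) (hy : y ∈ gridCell N n ν) : ‖y - x‖ ≤ N / n := by
  have hn : 0 < (n : ℝ) := Nat.cast_pos.mpr (NeZero.pos n)
  have hmem : ∀ {z : Eucl N}, z ∈ gridCell N n ν →
      ∀ i, (ν i : ℝ) / n < z i ∧ z i ≤ (ν i + 1) / n := fun {z} hz => by
    rw [gridCell, mem_preimage, BoxIntegral.Box.mem_coe] at hz
    exact BoxIntegral.unitPartition.mem_box_iff.mp hz
  have hi : ∀ i, (y i - x i) ^ 2 ≤ (1 / n : ℝ) ^ 2 := fun i => by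
    have h1 := hmem hx i
    have h2 := hmem hy i
    rw [add_div] at h1 h2
    refine sq_le_sq' ?_ ?_ <;> linarith [h1.1, h1.2, h2.1, h2.2]
  refine le_of_sq_le_sq ?_ (by positivity)
  rw [EuclideanSpace.real_norm_sq_eq]
  calc ∑ i, (y - x) i ^ 2 ≤ ∑ _i : Fin N, (1 / n : ℝ) ^ 2 := Finset.sum_le_sum fun i _ => hi i
    _ = N * (1 / n : ℝ) ^ 2 := by simp
    -- The crude diameter N / n replaces √N / n.
    _ ≤ (N : ℝ) ^ 2 * (1 / n : ℝ) ^ 2 := by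
      refine mul_le_mul_of_nonneg_right ?_ (sq_nonneg _)
      exact_mod_cast Nat.le_self_pow two_ne_zero N
    _ = (N / n : ℝ) ^ 2 := by ring

theorem exists_finset_gridCell_cover {Ω : Set (Eucl N)} (hΩ : Bornology.IsBounded Ω)
    (n : ℕ) [NeZero n] : ∃ A : Finset (Fin N → ℤ), ∀ x ∈ Ω, ∃ ν ∈ A, x ∈ gridCell N n ν := by
  obtain ⟨R, hR⟩ := hΩ.exists_norm_le
  set M : ℤ := ⌈(n : ℝ) * R⌉ + 1 with hM
  -- A grid index is a ceiling minus one; the bounds are generous enough to absorb the shift.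
  refine ⟨Finset.Icc (fun _ => -M - 1) (fun _ => M), fun x hx =>
    ⟨_, ?_, mem_gridCell.mpr rfl⟩⟩
  rw [Finset.mem_Icc, Pi.le_def, Pi.le_def]
  have hn : 0 < (n : ℝ) := Nat.cast_pos.mpr (NeZero.pos n)
  have hi : ∀ i, |(n : ℝ) * x i| ≤ n * R := fun i => by
    rw [abs_mul, abs_of_pos hn]
    refine mul_le_mul_of_nonneg_left ?_ hn.le
    exact ((Real.norm_eq_abs _).symm.le.trans (PiLp.norm_apply_le x i)).trans (hR x hx)
  constructor <;> intro i <;> rw [BoxIntegral.unitPartition.index_apply]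
  · have h1 := (abs_le.mp (hi i)).1
    have h2 := Int.le_ceil ((n : ℝ) * R)
    have h3 := Int.le_ceil ((n : ℝ) * x i)
    have h4 : -(⌈(n : ℝ) * R⌉ : ℝ) ≤ ⌈(n : ℝ) * x i⌉ := by linarith
    have h5 : -⌈(n : ℝ) * R⌉ ≤ ⌈(n : ℝ) * x i⌉ := by exact_mod_cast h4
    rw [hM]; omega
  · have h5 := Int.ceil_le_ceil (abs_le.mp (hi i)).2
    rw [hM]; omega

/-- The ball has radius proportional to 1/n and the cells have volume n^(-N), so the quotient of
volumes does not depend on n. The averaging error is therefore of order 1/n. -/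
theorem volume_closedBall_div (n : ℕ) [NeZero n] :
    ENNReal.ofReal ((((n : ℝ) ^ N)⁻¹)⁻¹) * volume (Metric.closedBall (0 : Eucl N) (N / n)) =
      ENNReal.ofReal ((N : ℝ) ^ N) * volume (Metric.ball (0 : Eucl N) 1) := by
  have hn : 0 < (n : ℝ) := Nat.cast_pos.mpr (NeZero.pos n)
  rw [Measure.addHaar_closedBall _ _ (by positivity), ← mul_assoc,
    ← ENNReal.ofReal_mul (by positivity), finrank_euclideanSpace_fin]
  congr 2
  rw [inv_inv, ← mul_pow, mul_div_cancel₀ _ hn.ne']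

end Translation

/-! ### The space of weak gradients and Rellich's theorem -/

section SobolevSpace

open scoped ENNReal

theorem ofReal_norm_sq_toLp {α F : Type*} [MeasurableSpace α] {μ : Measure α}
    [NormedAddCommGroup F] {f : α → F} (hf : MemLp f 2 μ) :
    ENNReal.ofReal (‖hf.toLp f‖ ^ 2) = ∫⁻ x, ‖f x‖ₑ ^ 2 ∂μ := by
  rw [Lp.norm_toLp, ← ENNReal.toReal_pow, ENNReal.ofReal_toReal (ENNReal.pow_ne_top hf.2.ne),
    eLpNorm_eq_lintegral_rpow_enorm_toReal two_ne_zero ENNReal.ofNat_ne_top,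
    ← ENNReal.rpow_natCast, ← ENNReal.rpow_mul]
  norm_num

variable {N : ℕ} {Ω : Set (Eucl N)} {ψ φ : Eucl N → ℝ}

theorem IsTestFunction.contDiff_one (h : IsTestFunction Ω ψ) : ContDiff ℝ 1 ψ :=
  h.1.of_le (by exact_mod_cast le_top)

theorem IsTestFunction.differentiable (h : IsTestFunction Ω ψ) : Differentiable ℝ ψ :=
  h.contDiff_one.differentiable (by norm_num)

theorem IsTestFunction.add (hψ : IsTestFunction Ω ψ) (hφ : IsTestFunction Ω φ) :
    IsTestFunction Ω (ψ + φ) :=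
  ⟨hψ.1.add hφ.1, hψ.2.1.add hφ.2.1, (tsupport_add ψ φ).trans (union_subset hψ.2.2 hφ.2.2)⟩

theorem IsTestFunction.const_smul (hψ : IsTestFunction Ω ψ) (a : ℝ) :
    IsTestFunction Ω (a • ψ) :=
  ⟨contDiff_const.smul hψ.1, hψ.2.1.smul_left (f := fun _ => a),
    (tsupport_smul_subset_right (fun _ => a) ψ).trans hψ.2.2⟩

theorem isTestFunction_zero : IsTestFunction Ω (0 : Eucl N → ℝ) :=
  ⟨contDiff_const, HasCompactSupport.zero, by simp⟩

theorem gradient_add_apply (hψ : Differentiable ℝ ψ) (hφ : Differentiable ℝ φ) (x : Eucl N) :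
    gradient (ψ + φ) x = gradient ψ x + gradient φ x := by
  simp only [gradient]
  rw [fderiv_add (hψ x) (hφ x), map_add]

theorem gradient_const_smul_apply (hψ : Differentiable ℝ ψ) (a : ℝ) (x : Eucl N) :
    gradient (a • ψ) x = a • gradient ψ x := by
  simp only [gradient]
  rw [fderiv_const_smul (hψ x), map_smul]

theorem gradient_eq_zero_of_notMem_tsupport {x : Eucl N} (hx : x ∉ tsupport ψ) :
    gradient ψ x = 0 := by
  have h : fderiv ℝ ψ x = 0 := by
    by_contra hne
    exact hx (support_fderiv_subset ℝ hne)
  rw [gradient, h, map_zero]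

theorem hasCompactSupport_gradient (h : HasCompactSupport ψ) : HasCompactSupport (gradient ψ) :=
  h.of_isClosed_subset isClosed_closure (closure_minimal (fun x hx => by
    by_contra hne
    exact hx (gradient_eq_zero_of_notMem_tsupport hne)) isClosed_closure)

theorem IsTestFunction.memLp (h : IsTestFunction Ω ψ) (q : ℝ≥0∞) :
    MemLp ψ q (volume.restrict Ω) :=
  (h.1.continuous.memLp_of_hasCompactSupport h.2.1).mono_measure Measure.restrict_le_self

theorem IsTestFunction.memLp_gradient (h : IsTestFunction Ω ψ) :
    MemLp (gradient ψ) 2 (volume.restrict Ω) :=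
  ((continuous_gradient h.contDiff_one).memLp_of_hasCompactSupport
    (hasCompactSupport_gradient h.2.1)).mono_measure Measure.restrict_le_self

/-- The space `C_c^∞(Ω)`. -/
def testSpace (Ω : Set (Eucl N)) : Submodule ℝ (Eucl N → ℝ) where
  carrier := {ψ | IsTestFunction Ω ψ}
  add_mem' h h' := h.add h'
  zero_mem' := isTestFunction_zero
  smul_mem' a _ h := h.const_smul a

/-- A test function as an element of `L²(Ω)`. -/
noncomputable def testToLp (Ω : Set (Eucl N)) :
    testSpace Ω →ₗ[ℝ] Lp ℝ 2 (volume.restrict Ω) where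
  toFun ψ := MemLp.toLp ψ.1 (IsTestFunction.memLp ψ.2 2)
  map_add' _ _ := rfl
  map_smul' _ _ := rfl

theorem coeFn_testToLp (ψ : testSpace Ω) : testToLp Ω ψ =ᵐ[volume.restrict Ω] ψ.1 :=
  MemLp.coeFn_toLp (IsTestFunction.memLp ψ.2 2)

/-- The gradient of a test function as an element of `L²(Ω)`. -/
noncomputable def testGradToLp (Ω : Set (Eucl N)) :
    testSpace Ω →ₗ[ℝ] Lp (Eucl N) 2 (volume.restrict Ω) where
  toFun ψ := MemLp.toLp (gradient ψ.1) (IsTestFunction.memLp_gradient ψ.2)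
  map_add' ψ φ := by
    rw [← MemLp.toLp_add]
    exact MemLp.toLp_congr _ _ (Eventually.of_forall fun x => gradient_add_apply
      (IsTestFunction.differentiable ψ.2) (IsTestFunction.differentiable φ.2) x)
  map_smul' a ψ := by
    rw [RingHom.id_apply, ← MemLp.toLp_const_smul]
    exact MemLp.toLp_congr _ _ (Eventually.of_forall fun x => gradient_const_smul_apply
      (IsTestFunction.differentiable ψ.2) a x)

/-- The closure in `L²(Ω)` of the gradients of test functions. -/
noncomputable def gradSubmodule (Ω : Set (Eucl N)) :
    Submodule ℝ (Lp (Eucl N) 2 (volume.restrict Ω)) :=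
  (LinearMap.range (testGradToLp Ω)).topologicalClosure

/-- The Hilbert space of the weak gradients of functions in `H¹₀(Ω)`. -/
def GradSpace (Ω : Set (Eucl N)) : Type := gradSubmodule Ω

noncomputable instance : NormedAddCommGroup (GradSpace Ω) :=
  inferInstanceAs (NormedAddCommGroup (gradSubmodule Ω))

noncomputable instance : InnerProductSpace ℝ (GradSpace Ω) :=
  inferInstanceAs (InnerProductSpace ℝ (gradSubmodule Ω))

instance : CompleteSpace (GradSpace Ω) :=
  (Submodule.isClosed_topologicalClosure (LinearMap.range (testGradToLp Ω))).completeSpace_coe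

/-- The element of `GradSpace Ω` given by a class in `L²(Ω)`. -/
def GradSpace.mk (f : Lp (Eucl N) 2 (volume.restrict Ω)) (hf : f ∈ gradSubmodule Ω) :
    GradSpace Ω := ⟨f, hf⟩

/-- The class in `L²(Ω)` of an element of `GradSpace Ω`. -/
def GradSpace.val (y : GradSpace Ω) : Lp (Eucl N) 2 (volume.restrict Ω) := Subtype.val y

theorem GradSpace.val_mem (y : GradSpace Ω) : y.val ∈ gradSubmodule Ω := Subtype.property y

theorem GradSpace.tendsto_iff {ι : Type*} {l : Filter ι} {z : ι → GradSpace Ω}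
    {y : GradSpace Ω} :
    Tendsto z l (𝓝 y) ↔ Tendsto (fun i => (z i).val) l (𝓝 y.val) :=
  tendsto_subtype_rng

/-- The gradient of a test function as an element of `GradSpace Ω`. -/
noncomputable def testGrad (Ω : Set (Eucl N)) : testSpace Ω →ₗ[ℝ] GradSpace Ω :=
  (testGradToLp Ω).codRestrict (gradSubmodule Ω) fun ψ =>
    Submodule.le_topologicalClosure _ (LinearMap.mem_range_self _ ψ)

theorem denseRange_testGrad : DenseRange (testGrad Ω) := by
  intro y
  rw [Metric.mem_closure_iff]
  intro ε hε
  obtain ⟨_, ⟨ψ, rfl⟩, h⟩ := Metric.mem_closure_iff.mp y.val_mem ε hε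
  exact ⟨testGrad Ω ψ, ⟨ψ, rfl⟩, h⟩

/-- The gradient of a test function vanishes outside Ω, so its norm in L²(Ω) is an integral over the
whole space, where translation estimates apply. -/
theorem norm_sq_testGrad (ψ : testSpace Ω) :
    ENNReal.ofReal (‖testGrad Ω ψ‖ ^ 2) = ∫⁻ x, ‖gradient ψ.1 x‖ₑ ^ 2 := by
  have h1 : ENNReal.ofReal (‖testGrad Ω ψ‖ ^ 2) = ∫⁻ x in Ω, ‖gradient ψ.1 x‖ₑ ^ 2 :=
    ofReal_norm_sq_toLp (IsTestFunction.memLp_gradient ψ.2)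
  rw [h1]
  refine setLIntegral_eq_of_support_subset fun x hx => ?_
  by_contra hne
  apply hx
  simp [gradient_eq_zero_of_notMem_tsupport (fun h => hne (ψ.2.2.2 h))]

theorem norm_sq_testToLp (ψ : testSpace Ω) :
    ENNReal.ofReal (‖testToLp Ω ψ‖ ^ 2) = ∫⁻ x in Ω, ‖ψ.1 x‖ₑ ^ 2 :=
  ofReal_norm_sq_toLp (IsTestFunction.memLp ψ.2 2)

/-- Poincaré's inequality makes ∇ψ ↦ ψ bounded, hence extendable from the dense gradients of test
functions to all of `GradSpace Ω`. -/
theorem exists_norm_testToLp_le (hN : 1 ≤ N) (hΩ : Bornology.IsBounded Ω) :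
    ∃ C, ∀ ψ : testSpace Ω, ‖testToLp Ω ψ‖ ≤ C * ‖testGrad Ω ψ‖ := by
  obtain ⟨R, hR⟩ := hΩ.exists_norm_le
  have hC0 : 0 ≤ 2 * |R| + 1 := by positivity
  refine ⟨2 * |R| + 1, fun ψ => ?_⟩
  refine le_of_sq_le_sq ?_ (by positivity)
  rw [mul_pow, ← ENNReal.ofReal_le_ofReal_iff (by positivity), ENNReal.ofReal_mul (by positivity),
    norm_sq_testToLp, norm_sq_testGrad]
  refine (setLIntegral_le_lintegral _ _).trans ?_
  refine lintegral_sq_le_of_support_subset hN (IsTestFunction.contDiff_one ψ.2) (abs_nonneg R)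
    fun x hx => ?_
  exact (hR x (ψ.2.2.2 (subset_tsupport _ hx))).trans (le_abs_self R)

/-- The operator recovering a function of `H¹₀(Ω)` from its weak gradient. -/
noncomputable def potential (Ω : Set (Eucl N)) :
    GradSpace Ω →L[ℝ] Lp ℝ 2 (volume.restrict Ω) :=
  (testToLp Ω).extendOfNorm (testGrad Ω)

theorem potential_testGrad (hN : 1 ≤ N) (hΩ : Bornology.IsBounded Ω) (ψ : testSpace Ω) :
    potential Ω (testGrad Ω ψ) = testToLp Ω ψ :=
  LinearMap.extendOfNorm_eq denseRange_testGrad (exists_norm_testToLp_le hN hΩ) ψ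

/-- Averaging over the cells of a grid, as an operator on `L²(Ω)`. -/
noncomputable def gridAverage (Ω : Set (Eucl N)) (n : ℕ) [NeZero n]
    (A : Finset (Fin N → ℤ)) :
    Lp ℝ 2 (volume.restrict Ω) →L[ℝ] Lp ℝ 2 (volume.restrict Ω) :=
  ∑ ν ∈ A, ((n : ℝ) ^ N) • (innerSL ℝ (indicatorConstLp 2 (measurableSet_gridCell n ν)
      ((Measure.restrict_apply_le Ω _).trans_lt (by rw [volume_gridCell]; simp)).ne
      (1 : ℝ))).smulRight
    (indicatorConstLp 2 (measurableSet_gridCell n ν)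
      ((Measure.restrict_apply_le Ω _).trans_lt (by rw [volume_gridCell]; simp)).ne (1 : ℝ))

theorem isCompactOperator_finset_sum_rank_one {H F : Type*} [NormedAddCommGroup H]
    [InnerProductSpace ℝ H] [NormedAddCommGroup F] [NormedSpace ℝ F] {ι : Type*} (A : Finset ι)
    (a : ι → ℝ) (u : ι → H) (w : ι → F) :
    IsCompactOperator (∑ i ∈ A, a i • (innerSL ℝ (u i)).smulRight (w i) : H →L[ℝ] F) := by
  classical
  induction A using Finset.induction_on with
  | empty => simpa using isCompactOperator_zero
  | insert i s hi ih =>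
    rw [Finset.sum_insert hi]
    refine IsCompactOperator.add ?_ ih
    have h1 : IsCompactOperator (innerSL ℝ (u i) : H →L[ℝ] ℝ) :=
      isCompactOperator_of_locallyCompactSpace_dom _
    exact h1.clm_comp (a i • ContinuousLinearMap.toSpanSingleton ℝ (w i))

theorem coeFn_sum_smul {α ι : Type*} [MeasurableSpace α] {μ : Measure α} (A : Finset ι)
    (a : ι → ℝ) (w : ι → Lp ℝ 2 μ) :
    (∑ i ∈ A, a i • w i : Lp ℝ 2 μ) =ᵐ[μ] fun x => ∑ i ∈ A, a i * w i x := by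
  classical
  induction A using Finset.induction_on with
  | empty => exact (Lp.coeFn_zero ℝ 2 μ).trans (by simp; rfl)
  | insert i s hi ih =>
    rw [Finset.sum_insert hi]
    filter_upwards [Lp.coeFn_add (a i • w i) (∑ j ∈ s, a j • w j), ih,
      Lp.coeFn_smul (a i) (w i)] with x h1 h2 h3
    rw [h1, Pi.add_apply, h2, h3, Finset.sum_insert hi]
    rfl

/-- The inner product over a cell sees only its part in Ω, but ψ vanishes elsewhere. The double
inverse is q⁻¹ for the cell volume q = n^(-N), as in `lintegral_sub_average_sq_le`. -/
theorem gridAverage_testToLp (n : ℕ) [NeZero n] (A : Finset (Fin N → ℤ)) (ψ : testSpace Ω) :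
    gridAverage Ω n A (testToLp Ω ψ) =ᵐ[volume.restrict Ω] fun x => ∑ ν ∈ A,
      ((((n : ℝ) ^ N)⁻¹)⁻¹ * ∫ y in gridCell N n ν, ψ.1 y) * (gridCell N n ν).indicator 1 x := by
  set w : (Fin N → ℤ) → Lp ℝ 2 (volume.restrict Ω) := fun ν =>
    indicatorConstLp 2 (measurableSet_gridCell n ν)
      ((Measure.restrict_apply_le Ω _).trans_lt (by rw [volume_gridCell]; simp)).ne (1 : ℝ) with hw
  have hcoef : ∀ ν, inner ℝ (w ν) (testToLp Ω ψ) = ∫ y in gridCell N n ν, ψ.1 y := fun ν => by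
    have h1 := L2.inner_indicatorConstLp_one (𝕜 := ℝ) (measurableSet_gridCell n ν)
      ((Measure.restrict_apply_le Ω (gridCell N n ν)).trans_lt
        (by rw [volume_gridCell]; simp)).ne (testToLp Ω ψ)
    refine h1.trans ?_
    have h2 : ∫ y in gridCell N n ν, (testToLp Ω ψ) y ∂(volume.restrict Ω) =
        ∫ y in gridCell N n ν, ψ.1 y ∂(volume.restrict Ω) := by
      exact integral_congr_ae (ae_restrict_of_ae (coeFn_testToLp ψ))
    rw [h2, Measure.restrict_restrict (measurableSet_gridCell n ν)]
    refine (setIntegral_eq_of_subset_of_forall_sdiff_eq_zero (measurableSet_gridCell n ν)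
      inter_subset_left fun x hx => ?_).symm
    by_contra hne
    exact hx.2 ⟨hx.1, ψ.2.2.2 (subset_tsupport _ hne)⟩
  have happ : gridAverage Ω n A (testToLp Ω ψ) =
      ∑ ν ∈ A, ((n : ℝ) ^ N * ∫ y in gridCell N n ν, ψ.1 y) • w ν := by
    simp only [gridAverage, sum_apply, smul_apply,
      ContinuousLinearMap.smulRight_apply, innerSL_apply_apply, smul_smul]
    exact Finset.sum_congr rfl fun ν _ => by rw [← hcoef ν]
  rw [happ]
  have hind : ∀ᵐ x ∂(volume.restrict Ω), ∀ ν, w ν x = (gridCell N n ν).indicator 1 x :=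
    ae_all_iff.mpr fun ν => indicatorConstLp_coeFn
  filter_upwards [coeFn_sum_smul A (fun ν => (n : ℝ) ^ N * ∫ y in gridCell N n ν, ψ.1 y) w, hind]
    with x h1 h2
  rw [h1]
  exact Finset.sum_congr rfl fun ν _ => by rw [h2, inv_inv]

theorem exists_norm_sub_gridAverage_le (hΩo : MeasurableSet Ω) :
    ∃ C : ℝ, 0 ≤ C ∧ ∀ (n : ℕ) [NeZero n] (A : Finset (Fin N → ℤ)),
      (∀ x ∈ Ω, ∃ ν ∈ A, x ∈ gridCell N n ν) → ∀ ψ : testSpace Ω,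
        ‖testToLp Ω ψ - gridAverage Ω n A (testToLp Ω ψ)‖ ≤ C / n * ‖testGrad Ω ψ‖ := by
  set B : ℝ≥0∞ := ENNReal.ofReal ((N : ℝ) ^ N) * volume (Metric.ball (0 : Eucl N) 1) with hB
  have hBtop : B ≠ ⊤ := ENNReal.mul_ne_top ENNReal.ofReal_ne_top measure_ball_lt_top.ne
  refine ⟨√B.toReal * N, by positivity, fun n _ A hA ψ => ?_⟩
  have hn : 0 < (n : ℝ) := Nat.cast_pos.mpr (NeZero.pos n)
  refine le_of_sq_le_sq ?_ (by positivity)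
  set u := testToLp Ω ψ - gridAverage Ω n A (testToLp Ω ψ) with hu
  have h1 : ENNReal.ofReal (‖u‖ ^ 2) = ∫⁻ x in Ω, ‖u x‖ₑ ^ 2 := by
    have := ofReal_norm_sq_toLp (Lp.memLp u)
    rwa [Lp.toLp_coeFn] at this
  have h2 : ∫⁻ x in Ω, ‖u x‖ₑ ^ 2 = ∫⁻ x in Ω, ‖ψ.1 x - ∑ ν ∈ A,
      ((((n : ℝ) ^ N)⁻¹)⁻¹ * ∫ y in gridCell N n ν, ψ.1 y) *
        (gridCell N n ν).indicator 1 x‖ₑ ^ 2 := by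
    refine lintegral_congr_ae ?_
    filter_upwards [Lp.coeFn_sub (testToLp Ω ψ) (gridAverage Ω n A (testToLp Ω ψ)),
      gridAverage_testToLp n A ψ, coeFn_testToLp ψ] with x h4 h5 h6
    rw [hu, h4, Pi.sub_apply, h5, h6]
  have h3 := lintegral_sub_average_sq_le (IsTestFunction.contDiff_one ψ.2) ψ.2.2.1 A
    (gridCell N n) (measurableSet_gridCell n)
    (fun i j hij => disjoint_left.mpr fun x hx hx' =>
      hij ((mem_gridCell.mp hx).symm.trans (mem_gridCell.mp hx')))
    (q := ((n : ℝ) ^ N)⁻¹) (d := N / n) (by positivity) (volume_gridCell n)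
    (fun i x hx y hy => norm_sub_le_of_mem_gridCell hx hy) hA hΩo
  rw [← ENNReal.ofReal_le_ofReal_iff (by positivity), h1, h2]
  refine h3.trans_eq ?_
  rw [volume_closedBall_div, ← norm_sq_testGrad, ← hB]
  nth_rewrite 1 [← ENNReal.ofReal_toReal hBtop]
  rw [← ENNReal.ofReal_pow (by positivity), ← ENNReal.ofReal_mul (by positivity),
    ← ENNReal.ofReal_mul (by positivity)]
  congr 1
  rw [mul_pow _ ‖testGrad Ω ψ‖, div_pow, div_pow, mul_pow, Real.sq_sqrt (by positivity)]
  ring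

/-- Rellich's theorem: the embedding of `H¹₀(Ω)` into `L²(Ω)` is compact. -/
theorem isCompactOperator_potential (hN : 1 ≤ N) (hΩ : Bornology.IsBounded Ω)
    (hΩm : MeasurableSet Ω) : IsCompactOperator (potential Ω) := by
  obtain ⟨C, hC0, hC⟩ := exists_norm_sub_gridAverage_le hΩm
  choose A hA using fun n : ℕ => exists_finset_gridCell_cover hΩ (n + 1)
  -- The finite-rank grid averages converge to the embedding in operator norm at rate C / (n+1);
  -- density reduces the estimate to test functions.
  refine isCompactOperator_of_tendsto (l := atTop)
    (F := fun n : ℕ => gridAverage Ω (n + 1) (A n) ∘L potential Ω) ?_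
    (Eventually.of_forall fun n =>
      IsCompactOperator.comp_clm (isCompactOperator_finset_sum_rank_one _ _ _ _) _)
  refine (tendsto_iff_norm_sub_tendsto_zero
    (E := GradSpace Ω →L[ℝ] Lp ℝ 2 (volume.restrict Ω))).mpr ?_
  have hlim : Tendsto (fun n : ℕ => C / ((n + 1 : ℕ) : ℝ)) atTop (𝓝 0) :=
    (tendsto_const_div_atTop_nhds_zero_nat C).comp (tendsto_add_atTop_nat 1)
  refine squeeze_zero (fun n => ContinuousLinearMap.opNorm_nonneg _) (fun n => ?_) hlim
  refine ContinuousLinearMap.opNorm_le_bound _ (by positivity) fun y => ?_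
  refine denseRange_testGrad.induction_on y (isClosed_le
    (ContinuousLinearMap.continuous _).norm (continuous_const.mul continuous_norm)) fun ψ => ?_
  rw [sub_apply, ContinuousLinearMap.comp_apply, potential_testGrad hN hΩ, norm_sub_rev]
  exact hC (n + 1) (A n) (hA n) ψ

end SobolevSpace

/-! ### The operator T = w (-Δ)⁻¹ w -/

section WeightedOperator

open scoped ENNReal

variable {N : ℕ} {Ω : Set (Eucl N)} {w : Eucl N → ℝ}

/-- Multiplication by a bounded function on `L²(Ω)`. -/
noncomputable def mulLp (hw : MemLp w ⊤ (volume.restrict Ω)) :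
    Lp ℝ 2 (volume.restrict Ω) →L[ℝ] Lp ℝ 2 (volume.restrict Ω) :=
  (ContinuousLinearMap.mul ℝ ℝ).holderL (volume.restrict Ω) ⊤ 2 2 (hw.toLp w)

theorem coeFn_mulLp (hw : MemLp w ⊤ (volume.restrict Ω)) (f : Lp ℝ 2 (volume.restrict Ω)) :
    mulLp hw f =ᵐ[volume.restrict Ω] fun x => w x * f x := by
  filter_upwards [(ContinuousLinearMap.mul ℝ ℝ).coeFn_holder (r := 2) (hw.toLp w) f,
    hw.coeFn_toLp] with x h1 h2
  rw [h2] at h1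
  exact h1

/-- The operator `∇ψ ↦ w ψ` from the space of gradients into `L²(Ω)`. -/
noncomputable def weightedPotential (hw : MemLp w ⊤ (volume.restrict Ω)) :
    GradSpace Ω →L[ℝ] Lp ℝ 2 (volume.restrict Ω) :=
  mulLp hw ∘L potential Ω

/-- The solution operator `f ↦ w (-Δ)⁻¹ (w f)` of the Dirichlet problem on `L²(Ω)`. -/
noncomputable def weightedInverse (hw : MemLp w ⊤ (volume.restrict Ω)) :
    Lp ℝ 2 (volume.restrict Ω) →L[ℝ] Lp ℝ 2 (volume.restrict Ω) :=
  weightedPotential hw ∘L ContinuousLinearMap.adjoint (weightedPotential hw)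

/-- Writing A for `weightedPotential hw`, T = A A*, so the form of T is the Dirichlet product of two
solution gradients. Symmetry and positivity are read off from this. -/
theorem inner_weightedInverse (hw : MemLp w ⊤ (volume.restrict Ω))
    (x y : Lp ℝ 2 (volume.restrict Ω)) :
    inner ℝ (weightedInverse hw x) y = inner ℝ
      (ContinuousLinearMap.adjoint (weightedPotential hw) x)
      (ContinuousLinearMap.adjoint (weightedPotential hw) y) :=
  (ContinuousLinearMap.adjoint_inner_right (weightedPotential hw) _ _).symm

theorem isSymmetric_weightedInverse (hw : MemLp w ⊤ (volume.restrict Ω)) :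
    (weightedInverse hw).IsSymmetric := fun x y =>
  (inner_weightedInverse hw x y).trans <|
    (real_inner_comm _ _).trans <| (inner_weightedInverse hw y x).symm.trans (real_inner_comm _ _)

theorem isCompactOperator_weightedInverse (hN : 1 ≤ N) (hΩ : Bornology.IsBounded Ω)
    (hΩm : MeasurableSet Ω) (hw : MemLp w ⊤ (volume.restrict Ω)) :
    IsCompactOperator (weightedInverse hw) :=
  ((isCompactOperator_potential hN hΩ hΩm).clm_comp (mulLp hw)).comp_clm
    (ContinuousLinearMap.adjoint (weightedPotential hw))

theorem coeFn_weightedPotential_testGrad (hN : 1 ≤ N) (hΩ : Bornology.IsBounded Ω)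
    (hw : MemLp w ⊤ (volume.restrict Ω)) (ψ : testSpace Ω) :
    weightedPotential hw (testGrad Ω ψ) =ᵐ[volume.restrict Ω] fun x => w x * ψ.1 x := by
  have h : weightedPotential hw (testGrad Ω ψ) = mulLp hw (testToLp Ω ψ) := by
    rw [← potential_testGrad hN hΩ]
    rfl
  rw [h]
  filter_upwards [coeFn_mulLp hw (testToLp Ω ψ), coeFn_testToLp ψ] with x h1 h2
  rw [h1, h2]

/-- This identifies the adjoint applied to x as the gradient of the weak solution φ of -Δφ = w x. -/
theorem inner_adjoint_testGrad (hN : 1 ≤ N) (hΩ : Bornology.IsBounded Ω)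
    (hw : MemLp w ⊤ (volume.restrict Ω)) (x : Lp ℝ 2 (volume.restrict Ω)) (ψ : testSpace Ω) :
    inner ℝ (ContinuousLinearMap.adjoint (weightedPotential hw) x) (testGrad Ω ψ) =
      ∫ z in Ω, x z * (w z * ψ.1 z) := by
  rw [ContinuousLinearMap.adjoint_inner_left, L2.inner_def]
  refine integral_congr_ae ?_
  filter_upwards [coeFn_weightedPotential_testGrad hN hΩ hw ψ] with z hz
  rw [hz]
  simp [mul_comm]

/-- If the adjoint annihilates x, then w x integrates to 0 against every test function, hence
vanishes almost everywhere; and w > 0. -/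
theorem adjoint_weightedPotential_injective (hN : 1 ≤ N) (hΩ : Bornology.IsBounded Ω)
    (hΩo : IsOpen Ω) (hw : MemLp w ⊤ (volume.restrict Ω)) (hpos : ∀ x ∈ Ω, 0 < w x)
    {x : Lp ℝ 2 (volume.restrict Ω)}
    (hx : ContinuousLinearMap.adjoint (weightedPotential hw) x = 0) : x = 0 := by
  have hfin : IsFiniteMeasure (volume.restrict Ω) := ⟨by
    rw [Measure.restrict_apply_univ]; exact hΩ.measure_lt_top⟩
  have hint : IntegrableOn (fun z => w z * x z) Ω := by
    have h1 : Integrable (mulLp hw x) (volume.restrict Ω) :=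
      (Lp.memLp (mulLp hw x)).integrable one_le_two
    exact h1.congr (coeFn_mulLp hw x)
  have h0 := hΩo.ae_eq_zero_of_integral_contDiff_smul_eq_zero
    hint.locallyIntegrableOn fun g hg1 hg2 hg3 => ?_
  · refine (Lp.eq_zero_iff_ae_eq_zero).mpr ?_
    filter_upwards [(ae_restrict_iff' hΩo.measurableSet).mpr h0,
      ae_restrict_mem hΩo.measurableSet] with z h1 h2
    exact (mul_eq_zero.mp h1).resolve_left (hpos z h2).ne'
  · have h1 := inner_adjoint_testGrad hN hΩ hw x ⟨g, hg1, hg2, hg3⟩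
    rw [hx, inner_zero_left] at h1
    rw [← setIntegral_eq_integral_of_forall_compl_eq_zero (s := Ω), h1]
    · exact integral_congr_ae (Eventually.of_forall fun z => by simp only [smul_eq_mul]; ring)
    · intro z hz
      rw [image_eq_zero_of_notMem_tsupport (fun h => hz (hg3 h)), zero_smul]

theorem inner_weightedInverse_self_pos (hN : 1 ≤ N) (hΩ : Bornology.IsBounded Ω)
    (hΩo : IsOpen Ω) (hw : MemLp w ⊤ (volume.restrict Ω)) (hpos : ∀ x ∈ Ω, 0 < w x)
    (x : Lp ℝ 2 (volume.restrict Ω)) (hx : x ≠ 0) : 0 < inner ℝ (weightedInverse hw x) x := by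
  rw [inner_weightedInverse]
  exact real_inner_self_pos.mpr
    fun h => hx (adjoint_weightedPotential_injective hN hΩ hΩo hw hpos h)

/-- An open set contains infinitely many disjoint nonempty open subsets, whose indicators are
orthogonal and nonzero. This guarantees that eigenvalues of T reach down to 0, so a next weighted
eigenvalue always exists. -/
theorem not_finiteDimensional_lp (hN : 1 ≤ N) (hΩo : IsOpen Ω) (hne : Ω.Nonempty)
    (hΩ : Bornology.IsBounded Ω) : ¬ FiniteDimensional ℝ (Lp ℝ 2 (volume.restrict Ω)) := by
  intro hfd
  have : Nonempty (Fin N) := ⟨⟨0, hN⟩⟩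
  obtain ⟨x, hx⟩ := hne
  have : (𝓝[≠] x).NeBot := Module.punctured_nhds_neBot ℝ (Eucl N) x
  have : Infinite Ω := (infinite_of_mem_nhds x (hΩo.mem_nhds hx)).to_subtype
  obtain ⟨U, hU1, hU2, hU3⟩ := exists_seq_infinite_isOpen_pairwise_disjoint Ω
  set A : ℕ → Set (Eucl N) := fun n => Subtype.val '' U n with hA
  have hAo : ∀ n, IsOpen (A n) := fun n => hΩo.isOpenMap_subtype_val _ (hU2 n)
  have hAΩ : ∀ n, A n ⊆ Ω := fun n => by rintro _ ⟨z, -, rfl⟩; exact z.2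
  have hAne : ∀ n, (A n).Nonempty := fun n => (hU1 n).nonempty.image _
  have hAd : Pairwise (Function.onFun Disjoint A) := fun i j hij =>
    (disjoint_image_iff Subtype.val_injective).mpr (hU3 hij)
  have hAm : ∀ n, MeasurableSet (A n) := fun n => (hAo n).measurableSet
  have hAv : ∀ n, (volume.restrict Ω) (A n) = volume (A n) := fun n => by
    rw [Measure.restrict_apply (hAm n), inter_eq_left.mpr (hAΩ n)]
  have hAf : ∀ n, (volume.restrict Ω) (A n) ≠ ⊤ := fun n => by
    rw [hAv]; exact ((measure_mono (hAΩ n)).trans_lt hΩ.measure_lt_top).ne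
  set f : ℕ → Lp ℝ 2 (volume.restrict Ω) := fun n => indicatorConstLp 2 (hAm n) (hAf n) 1 with hf
  have hinner : ∀ i j, inner ℝ (f i) (f j) = (volume.restrict Ω).real (A i ∩ A j) := fun i j => by
    rw [hf, L2.inner_indicatorConstLp_one, integral_congr_ae
      ((ae_restrict_of_ae (indicatorConstLp_coeFn (hs := hAm j) (hμs := hAf j) (c := (1 : ℝ))))),
      setIntegral_indicator (hAm j)]
    simp
  have hLI : LinearIndependent ℝ f := by
    refine linearIndependent_of_ne_zero_of_inner_eq_zero (fun n hn => ?_) fun i j hij => ?_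
    · have h1 := hinner n n
      rw [hn, inner_zero_left, inter_self, eq_comm, measureReal_eq_zero_iff (hAf n), hAv] at h1
      exact (hAo n).measure_pos volume (hAne n) |>.ne' h1
    · change inner ℝ (f i) (f j) = 0
      rw [hinner, (hAd hij).inter_eq]
      simp
  exact not_finite_iff_infinite.mpr inferInstance hLI.finite

theorem MemH10.toLp_mem {u : Eucl N → ℝ} {G : Eucl N → Eucl N} (h : MemH10 Ω u G) :
    h.2.1.toLp G ∈ gradSubmodule Ω := by
  obtain ⟨hu, hG, ψ, hψ, -, hlim⟩ := h
  have h1 := (Lp.tendsto_Lp_iff_tendsto_eLpNorm'' (fun n => gradient (ψ n))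
    (fun n => (hψ n).memLp_gradient) G hG).mpr hlim
  exact mem_closure_of_tendsto h1 (Eventually.of_forall fun n => ⟨⟨ψ n, hψ n⟩, rfl⟩)

/-- With `memH10_potential` this identifies the concrete pairs (u, G) of H¹₀(Ω) with the elements of
`GradSpace Ω`. -/
theorem MemH10.potential_toLp (hN : 1 ≤ N) (hΩ : Bornology.IsBounded Ω)
    {u : Eucl N → ℝ} {G : Eucl N → Eucl N} (h : MemH10 Ω u G) :
    potential Ω (GradSpace.mk _ h.toLp_mem) = h.1.toLp u := by
  obtain ⟨ψ, hψ, hlim1, hlim2⟩ := h.2.2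
  have h1 := (Lp.tendsto_Lp_iff_tendsto_eLpNorm'' (fun n => gradient (ψ n))
    (fun n => (hψ n).memLp_gradient) G h.2.1).mpr hlim2
  have h2 := (Lp.tendsto_Lp_iff_tendsto_eLpNorm'' ψ (fun n => (hψ n).memLp 2) u h.1).mpr hlim1
  have h3 : Tendsto (fun n => testGrad Ω ⟨ψ n, hψ n⟩) atTop (𝓝 (.mk _ h.toLp_mem)) :=
    GradSpace.tendsto_iff.mpr h1
  have h4 := ((potential Ω).continuous.tendsto _).comp h3
  refine tendsto_nhds_unique h4 (h2.congr fun n => ?_)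
  exact (potential_testGrad hN hΩ ⟨ψ n, hψ n⟩).symm

theorem memH10_potential (hN : 1 ≤ N) (hΩ : Bornology.IsBounded Ω) (y : GradSpace Ω) :
    MemH10 Ω (potential Ω y) y.val := by
  refine ⟨Lp.memLp _, Lp.memLp _, ?_⟩
  obtain ⟨y', hy'1, hy'2⟩ := mem_closure_iff_seq_limit.mp (denseRange_testGrad y)
  choose ψ hψ using hy'1
  obtain rfl : (fun n => testGrad Ω (ψ n)) = y' := funext hψ
  refine ⟨fun n => (ψ n).1, fun n => (ψ n).2, ?_, ?_⟩
  · have h1 := ((potential Ω).continuous.tendsto _).comp hy'2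
    have h2 := (Lp.tendsto_Lp_iff_tendsto_eLpNorm' _ _).mp h1
    refine h2.congr fun n => eLpNorm_congr_ae ?_
    simp only [Function.comp_apply, potential_testGrad hN hΩ]
    filter_upwards [coeFn_testToLp (ψ n)] with x hx
    rw [Pi.sub_apply, hx]
  · have h1 := (Lp.tendsto_Lp_iff_tendsto_eLpNorm' _ _).mp (GradSpace.tendsto_iff.mp hy'2)
    refine h1.congr fun n => eLpNorm_congr_ae ?_
    have h2 : (testGrad Ω (ψ n)).val =ᵐ[
        volume.restrict Ω] gradient (ψ n).1 :=
      MemLp.coeFn_toLp (IsTestFunction.memLp_gradient (ψ n).2)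
    filter_upwards [h2] with x hx
    rw [Pi.sub_apply, hx]

theorem inner_toLp_testGrad {G : Eucl N → Eucl N} (hG : MemLp G 2 (volume.restrict Ω))
    (hmem : hG.toLp G ∈ gradSubmodule Ω) (ψ : testSpace Ω) :
    inner ℝ (GradSpace.mk _ hmem) (testGrad Ω ψ) =
      ∫ x in Ω, inner ℝ (G x) (gradient ψ.1 x) := by
  change inner ℝ (hG.toLp G) (MemLp.toLp _ (IsTestFunction.memLp_gradient ψ.2)) = _
  rw [L2.inner_def]
  refine integral_congr_ae ?_
  filter_upwards [hG.coeFn_toLp, MemLp.coeFn_toLp (IsTestFunction.memLp_gradient ψ.2)] with x h1 h2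
  rw [h1, h2]

end WeightedOperator

/-! ### Weighted eigenvalues and the spectral gap -/

section WeightedEigenvalues

open scoped ENNReal

variable {N : ℕ} {Ω : Set (Eucl N)} {p : ℝ} {V : Eucl N → ℝ}

theorem IsPositiveStationarySolution.exists_le {c : ℝ} (hV : IsPositiveStationarySolution Ω p c V)
    (hΩ : Bornology.IsBounded Ω) : ∃ B, 0 < B ∧ ∀ x ∈ Ω, V x ≤ B := by
  have hcpt : IsCompact (closure Ω) := Metric.isCompact_of_isClosed_isBounded isClosed_closure
    hΩ.closure
  obtain ⟨B, hB⟩ := hcpt.exists_bound_of_continuousOn hV.continuousOn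
  exact ⟨|B| + 1, by positivity, fun x hx => (le_abs_self _).trans
    ((hB x (subset_closure hx)).trans ((le_abs_self B).trans (by linarith)))⟩

theorem IsPositiveStationarySolution.aemeasurable {c : ℝ}
    (hV : IsPositiveStationarySolution Ω p c V) (hΩm : MeasurableSet Ω) :
    AEMeasurable V (volume.restrict Ω) :=
  (hV.continuousOn.mono subset_closure).aemeasurable hΩm

theorem IsPositiveStationarySolution.memLp_sqrtWeight {c : ℝ} (hp : 1 < p)
    (hV : IsPositiveStationarySolution Ω p c V) (hΩ : Bornology.IsBounded Ω)
    (hΩm : MeasurableSet Ω) :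
    MemLp (fun x => sqrtWeight p (V x)) ⊤ (volume.restrict Ω) := by
  obtain ⟨B, hB0, hB⟩ := hV.exists_le hΩ
  refine memLp_top_of_bound ((hV.aemeasurable hΩm).pow_const _).aestronglyMeasurable
    (B ^ ((p - 1) / 2)) ?_
  filter_upwards [ae_restrict_mem hΩm] with x hx
  rw [Real.norm_of_nonneg (sqrtWeight_pos (hV.pos x hx)).le]
  exact Real.rpow_le_rpow (hV.pos x hx).le (hB x hx) (by linarith)

/-- Testing on a dense range yields y = μ A* x, and A is then applied. With y the gradient of an
eigenfunction, this is the weak eigenvalue equation in operator form. -/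
theorem smul_map_adjoint_eq {H Y ι : Type*} [NormedAddCommGroup H] [InnerProductSpace ℝ H]
    [CompleteSpace H] [NormedAddCommGroup Y] [InnerProductSpace ℝ Y] [CompleteSpace Y]
    (A : Y →L[ℝ] H) {f : ι → Y} (hf : DenseRange f) {x : H} {y : Y} {μ : ℝ}
    (h : ∀ i, inner ℝ y (f i) = μ * inner ℝ (ContinuousLinearMap.adjoint A x) (f i)) :
    μ • (A ∘L ContinuousLinearMap.adjoint A) x = A y := by
  have hy : y = μ • ContinuousLinearMap.adjoint A x :=
    hf.eq_of_inner_left ℝ fun i => by rw [real_inner_smul_left, h i]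
  rw [hy, map_smul]
  rfl

/-- For a weighted eigenfunction φ, the function x = w φ satisfies μ T x = x; positivity of T forces
μ > 0. -/
theorem hasEigenvalue_inv_of_isWeightedEigenvalue (hN : 1 ≤ N) (hΩ : Bornology.IsBounded Ω)
    (hΩo : IsOpen Ω) (hpos : ∀ x ∈ Ω, 0 < V x)
    (hw : MemLp (fun x => sqrtWeight p (V x)) ⊤ (volume.restrict Ω)) {μ : ℝ}
    (hμ : IsWeightedEigenvalue Ω p V μ) :
    0 < μ ∧ Module.End.HasEigenvalue (weightedInverse hw : Module.End ℝ (Lp ℝ 2 (volume.restrict Ω))) μ⁻¹ := by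
  obtain ⟨φ, ⟨G, hmem, hweak⟩, hφ⟩ := hμ
  set y := GradSpace.mk _ hmem.toLp_mem with hy
  set x := weightedPotential hw y with hxdef
  have hx : x =ᵐ[volume.restrict Ω] fun z => sqrtWeight p (V z) * φ z := by
    have h1 : x = mulLp hw (hmem.1.toLp φ) := by
      rw [← hmem.potential_toLp hN hΩ]
      rfl
    rw [h1]
    filter_upwards [coeFn_mulLp hw (hmem.1.toLp φ), hmem.1.coeFn_toLp] with z h2 h3
    rw [h2, h3]
  have hx0 : x ≠ 0 := fun h0 => hφ <| by
    filter_upwards [hx, (Lp.eq_zero_iff_ae_eq_zero).mp h0, ae_restrict_mem hΩo.measurableSet]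
      with z h1 h2 h3
    rw [h2] at h1
    exact (mul_eq_zero.mp h1.symm).resolve_left (sqrtWeight_pos (hpos z h3)).ne'
  have hTx : μ • weightedInverse hw x = x := by
    refine smul_map_adjoint_eq (weightedPotential hw) denseRange_testGrad (y := y) fun ψ => ?_
    rw [inner_adjoint_testGrad hN hΩ, hy, inner_toLp_testGrad, hweak ψ.1 ψ.2]
    congr 1
    refine integral_congr_ae ?_
    filter_upwards [hx, ae_restrict_mem hΩo.measurableSet] with z h1 h2
    rw [h1, ← sqrtWeight_mul_self (hpos z h2)]
    ring
  have hμpos : 0 < μ := by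
    have h1 := inner_weightedInverse_self_pos hN hΩ hΩo hw
      (fun z hz => sqrtWeight_pos (hpos z hz)) x hx0
    have h2 : 0 < μ * inner ℝ (weightedInverse hw x) x := by
      rw [← real_inner_smul_left, hTx]
      exact real_inner_self_pos.mpr hx0
    exact (pos_iff_pos_of_mul_pos h2).mpr h1
  refine ⟨hμpos, Module.End.hasEigenvalue_of_hasEigenvector (x := x)
    ⟨Module.End.mem_eigenspace_iff.mpr ?_, hx0⟩⟩
  conv_rhs => rw [← hTx]
  rw [smul_smul, inv_mul_cancel₀ hμpos.ne', one_smul]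
  rfl

/-- Conversely, for T x = ν x the function φ = (-Δ)⁻¹(w x) satisfies w φ = ν x, so w x = ν⁻¹ w² φ
and φ solves the weighted equation. -/
theorem isWeightedEigenvalue_inv_of_hasEigenvalue (hN : 1 ≤ N) (hΩ : Bornology.IsBounded Ω)
    (hΩo : IsOpen Ω) (hpos : ∀ x ∈ Ω, 0 < V x)
    (hw : MemLp (fun x => sqrtWeight p (V x)) ⊤ (volume.restrict Ω)) {ν : ℝ}
    (hν : Module.End.HasEigenvalue (weightedInverse hw : Module.End ℝ (Lp ℝ 2 (volume.restrict Ω))) ν) :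
    0 < ν ∧ IsWeightedEigenvalue Ω p V ν⁻¹ := by
  obtain ⟨x, hx⟩ := hν.exists_hasEigenvector
  have hTx : weightedInverse hw x = ν • x := hx.apply_eq_smul
  have hνpos : 0 < ν := by
    have h1 := inner_weightedInverse_self_pos hN hΩ hΩo hw
      (fun z hz => sqrtWeight_pos (hpos z hz)) x hx.2
    rw [hTx, real_inner_smul_left] at h1
    exact (pos_iff_pos_of_mul_pos h1).mpr (real_inner_self_pos.mpr hx.2)
  refine ⟨hνpos, ?_⟩
  set y := ContinuousLinearMap.adjoint (weightedPotential hw) x with hy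
  have hφ : (fun z => ν * x z) =ᵐ[volume.restrict Ω]
      fun z => sqrtWeight p (V z) * potential Ω y z := by
    have h1 : ν • x = mulLp hw (potential Ω y) := hTx.symm
    filter_upwards [coeFn_mulLp hw (potential Ω y), Lp.coeFn_smul ν x] with z h2 h3
    rw [← h2, ← h1, h3]
    rfl
  refine ⟨potential Ω y, ⟨_, memH10_potential hN hΩ y, fun ψ hψ => ?_⟩, fun h0 => hx.2 ?_⟩
  · have h1 := inner_adjoint_testGrad hN hΩ hw x ⟨ψ, hψ⟩
    have h2 := inner_toLp_testGrad (Lp.memLp y.val)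
      (by rw [Lp.toLp_coeFn]; exact y.val_mem) ⟨ψ, hψ⟩
    simp only [Lp.toLp_coeFn] at h2
    rw [← h2]
    refine h1.trans ?_
    rw [← integral_const_mul]
    refine integral_congr_ae ?_
    filter_upwards [hφ, ae_restrict_mem hΩo.measurableSet] with z h3 h4
    rw [← sqrtWeight_mul_self (hpos z h4), eq_inv_mul_iff_mul_eq₀ hνpos.ne', ← mul_assoc, h3]
    ring
  · refine (Lp.eq_zero_iff_ae_eq_zero).mpr ?_
    filter_upwards [hφ, h0] with z h1 h2
    rw [h2, mul_zero] at h1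
    exact (mul_eq_zero.mp h1).resolve_left hνpos.ne'

theorem finite_isWeightedEigenvalue_le (hN : 1 ≤ N) (hΩ : Bornology.IsBounded Ω)
    (hΩo : IsOpen Ω) (hpos : ∀ x ∈ Ω, 0 < V x)
    (hw : MemLp (fun x => sqrtWeight p (V x)) ⊤ (volume.restrict Ω)) (M : ℝ) :
    {μ | IsWeightedEigenvalue Ω p V μ ∧ μ ≤ M}.Finite := by
  rcases le_or_gt M 0 with hM | hM
  · refine Set.finite_empty.subset fun μ hμ => ?_
    exact absurd (hasEigenvalue_inv_of_isWeightedEigenvalue hN hΩ hΩo hpos hw hμ.1).1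
      (not_lt.mpr (hμ.2.trans hM))
  · refine ((finite_eigenvalues_of_isCompactOperator (isSymmetric_weightedInverse hw)
      (isCompactOperator_weightedInverse hN hΩ hΩo.measurableSet hw)
      (inv_pos.mpr hM)).image (·⁻¹)).subset fun μ hμ => ?_
    obtain ⟨h1, h2⟩ := hasEigenvalue_inv_of_isWeightedEigenvalue hN hΩ hΩo hpos hw hμ.1
    exact ⟨μ⁻¹, ⟨h2, inv_anti₀ h1 hμ.2⟩, inv_inv μ⟩

theorem exists_isWeightedEigenvalue_gt (hN : 1 ≤ N) (hΩ : Bornology.IsBounded Ω)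
    (hΩo : IsOpen Ω) (hne : Ω.Nonempty) (hpos : ∀ x ∈ Ω, 0 < V x)
    (hw : MemLp (fun x => sqrtWeight p (V x)) ⊤ (volume.restrict Ω)) (M : ℝ) :
    ∃ μ, IsWeightedEigenvalue Ω p V μ ∧ M < μ := by
  obtain ⟨ν, h1, h2, h3⟩ := exists_eigenvalue_lt (isSymmetric_weightedInverse hw)
    (isCompactOperator_weightedInverse hN hΩ hΩo.measurableSet hw)
    (inner_weightedInverse_self_pos hN hΩ hΩo hw fun z hz => sqrtWeight_pos (hpos z hz))
    (not_finiteDimensional_lp hN hΩo hne hΩ) (r := (|M| + 1)⁻¹) (by positivity)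
  refine ⟨ν⁻¹, (isWeightedEigenvalue_inv_of_hasEigenvalue hN hΩ hΩo hpos hw h1).2, ?_⟩
  have h4 : |M| + 1 < ν⁻¹ := (lt_inv_comm₀ (by positivity) h2).mpr h3
  linarith [le_abs_self M]

/-- Eigenvalues do not accumulate at finite distance and are unbounded, so the infimum in the
definition is over a nonempty set and is attained. -/
theorem isLeast_weightedEigenvalue_succ
    (hfin : ∀ M, {μ | IsWeightedEigenvalue Ω p V μ ∧ μ ≤ M}.Finite)
    (hunb : ∀ M, ∃ μ, IsWeightedEigenvalue Ω p V μ ∧ M < μ) (k : ℕ) :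
    IsLeast {μ : ℝ | IsWeightedEigenvalue Ω p V μ ∧ weightedEigenvalue Ω p V k < μ}
      (weightedEigenvalue Ω p V (k + 1)) := by
  obtain ⟨μ₀, h1, h2⟩ := hunb (weightedEigenvalue Ω p V k)
  set A := {μ : ℝ | IsWeightedEigenvalue Ω p V μ ∧ weightedEigenvalue Ω p V k < μ}
  have hAfin : {μ ∈ A | μ ≤ μ₀}.Finite := (hfin μ₀).subset fun μ hμ => ⟨hμ.1.1, hμ.2⟩
  obtain ⟨m, hm1, hm2⟩ := Set.exists_min_image _ id hAfin ⟨μ₀, ⟨h1, h2⟩, le_rfl⟩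
  have hm : IsLeast A m := ⟨hm1.1, fun μ hμ => by
    rcases le_total μ μ₀ with h | h
    · exact hm2 μ ⟨hμ, h⟩
    · exact hm1.2.trans h⟩
  have h3 : weightedEigenvalue Ω p V (k + 1) = m := hm.csInf_eq
  rwa [h3]

/-- Discreteness makes the set defining k_p finite, so its supremum is a maximum. The next
eigenvalue is then at least p c, and nondegeneracy rules out equality. -/
theorem lambdaP_spec {c : ℝ} (hpc : 0 < p * c)
    (hfin : ∀ M, {μ | IsWeightedEigenvalue Ω p V μ ∧ μ ≤ M}.Finite)
    (hunb : ∀ M, ∃ μ, IsWeightedEigenvalue Ω p V μ ∧ M < μ)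
    (hnd : NondegeneracyCondition Ω p c V) :
    0 < lambdaP Ω p c V ∧
      ∀ μ, IsWeightedEigenvalue Ω p V μ → μ < c * p ∨ c * p + lambdaP Ω p c V ≤ μ := by
  have hleast := isLeast_weightedEigenvalue_succ hfin hunb
  have hmono : StrictMono (weightedEigenvalue Ω p V) :=
    strictMono_nat_of_lt_succ fun k => (hleast k).1.2
  set A := {k : ℕ | weightedEigenvalue Ω p V k < p * c} with hA
  have hAfin : A.Finite := by
    refine Set.Finite.of_finite_image (f := weightedEigenvalue Ω p V)
      (((hfin (p * c)).insert 0).subset ?_) hmono.injective.injOn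
    rintro _ ⟨k, hk, rfl⟩
    cases k with
    | zero => exact Or.inl rfl
    | succ k => exact Or.inr ⟨(hleast k).1.1, le_of_lt hk⟩
  have hA0 : A.Nonempty := ⟨0, hpc⟩
  have hmem : indexKp Ω p c V ∈ A := Nat.sSup_mem hA0 hAfin.bddAbove
  have hnot : indexKp Ω p c V + 1 ∉ A := fun h =>
    (Nat.lt_succ_self _).not_ge (le_csSup hAfin.bddAbove h)
  have hle : p * c ≤ weightedEigenvalue Ω p V (indexKp Ω p c V + 1) := not_lt.mp hnot
  have hneq : weightedEigenvalue Ω p V (indexKp Ω p c V + 1) ≠ c * p := fun h => by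
    obtain ⟨φ, hφ1, hφ2⟩ := (hleast (indexKp Ω p c V)).1.1
    rw [h] at hφ1
    exact hφ2 (hnd φ hφ1)
  refine ⟨?_, fun μ hμ => ?_⟩
  · rw [lambdaP, sub_pos]
    exact lt_of_le_of_ne (mul_comm p c ▸ hle) hneq.symm
  · rw [lambdaP, add_sub_cancel]
    rcases lt_or_ge (weightedEigenvalue Ω p V (indexKp Ω p c V)) μ with h | h
    · exact Or.inr ((hleast _).2 ⟨hμ, h⟩)
    · exact Or.inl (h.trans_lt (mul_comm p c ▸ hmem))

/-- The spectral decomposition of `L²(Ω)` at the gap between `c p` and the next eigenvalue. -/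
theorem exists_weighted_spectral_projection (hN : 1 ≤ N) (hΩ : Bornology.IsBounded Ω)
    (hΩo : IsOpen Ω) (hpos : ∀ x ∈ Ω, 0 < V x)
    (hw : MemLp (fun x => sqrtWeight p (V x)) ⊤ (volume.restrict Ω)) {a Λ : ℝ} (ha : 0 < a)
    (haΛ : a < Λ) (hgap : ∀ μ, IsWeightedEigenvalue Ω p V μ → μ < a ∨ Λ ≤ μ) :
    ∃ P : Lp ℝ 2 (volume.restrict Ω) →L[ℝ] Lp ℝ 2 (volume.restrict Ω), ∃ σ : ℝ, 0 < σ ∧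
      P.IsSymmetric ∧ (∀ x, P (P x) = P x) ∧
      (∀ x, weightedInverse hw (P x) = P (weightedInverse hw x)) ∧
      (∀ x, Λ * inner ℝ (weightedInverse hw (P x)) (P x) ≤ ‖P x‖ ^ 2) ∧
      ∀ x, (1 + σ) * ‖x - P x‖ ^ 2 ≤
        a * inner ℝ (weightedInverse hw (x - P x)) (x - P x) := by
  have hsym := isSymmetric_weightedInverse hw
  have hcpt := isCompactOperator_weightedInverse hN hΩ hΩo.measurableSet hw
  have hgap' : ∀ ν, Module.End.HasEigenvalue (weightedInverse hw : Module.End ℝ (Lp ℝ 2 (volume.restrict Ω))) ν →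
      ν ≤ Λ⁻¹ ∨ a⁻¹ < ν := fun ν hν => by
    obtain ⟨h1, h2⟩ := isWeightedEigenvalue_inv_of_hasEigenvalue hN hΩ hΩo hpos hw hν
    rcases hgap _ h2 with h | h
    · exact Or.inr ((inv_lt_comm₀ h1 ha).mp h)
    · exact Or.inl ((le_inv_comm₀ (ha.trans haΛ) h1).mp h)
  -- b' is the smallest eigenvalue of T above a⁻¹, or any larger number if there is none. The strict
  -- inequality b' > a⁻¹ yields σ = a b' - 1 > 0.
  obtain ⟨b', hab, hb'⟩ : ∃ b', a⁻¹ < b' ∧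
      ∀ ν, Module.End.HasEigenvalue (weightedInverse hw : Module.End ℝ (Lp ℝ 2 (volume.restrict Ω))) ν →
        a⁻¹ < ν → b' ≤ ν := by
    have hfin : {ν | Module.End.HasEigenvalue
        (weightedInverse hw : Module.End ℝ (Lp ℝ 2 (volume.restrict Ω))) ν ∧ a⁻¹ < ν}.Finite :=
      (finite_eigenvalues_of_isCompactOperator hsym hcpt (inv_pos.mpr ha)).subset
        fun ν hν => ⟨hν.1, hν.2.le⟩
    rcases Set.eq_empty_or_nonempty
      {ν | Module.End.HasEigenvalue (weightedInverse hw : Module.End ℝ (Lp ℝ 2 (volume.restrict Ω))) ν ∧ a⁻¹ < ν} with h | h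
    · refine ⟨a⁻¹ + 1, by linarith, fun ν h1 h2 => ?_⟩
      have h3 : ν ∈ (∅ : Set ℝ) := h ▸ ⟨h1, h2⟩
      exact h3.elim
    · obtain ⟨m, hm1, hm2⟩ := Set.exists_min_image _ id hfin h
      exact ⟨m, hm1.2, fun ν h1 h2 => hm2 ν ⟨h1, h2⟩⟩
  obtain ⟨P, hP, hPP, hTP, hhigh, hlow⟩ := exists_spectral_projection hsym hcpt hgap' hb'
  refine ⟨P, a * b' - 1, ?_, hP, hPP, hTP, fun x => ?_, fun x => ?_⟩
  · have := mul_lt_mul_of_pos_left hab ha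
    rw [mul_inv_cancel₀ ha.ne'] at this
    linarith
  · have := mul_le_mul_of_nonneg_left (hhigh x) (ha.trans haΛ).le
    rwa [← mul_assoc, mul_inv_cancel₀ (ha.trans haΛ).ne', one_mul] at this
  · have := mul_le_mul_of_nonneg_left (hlow x) ha.le
    linarith

end WeightedEigenvalues

/-! ### From distributional to classical time derivatives -/

section WeakDerivative

/-- θ is the primitive from a; the zero mean of ζ makes it vanish again beyond b. -/
theorem exists_deriv_eq_of_integral_eq_zero {ζ : ℝ → ℝ} {a b : ℝ} (hζ : ContDiff ℝ ∞ ζ)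
    (hsupp : Function.support ζ ⊆ Ioo a b) (hint : ∫ t in a..b, ζ t = 0) :
    ∃ θ : ℝ → ℝ, ContDiff ℝ ∞ θ ∧ Function.support θ ⊆ Icc a b ∧ deriv θ = ζ := by
  have hd : ∀ t, HasDerivAt (fun t => ∫ s in a..t, ζ s) (ζ t) t := fun t =>
    intervalIntegral.integral_hasDerivAt_right (hζ.continuous.intervalIntegrable _ _)
      (hζ.continuous.stronglyMeasurableAtFilter _ _) hζ.continuous.continuousAt
  have hderiv : deriv (fun t => ∫ s in a..t, ζ s) = ζ := funext fun t => (hd t).deriv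
  refine ⟨fun t => ∫ s in a..t, ζ s, ?_, ?_, hderiv⟩
  · rw [contDiff_infty_iff_deriv, hderiv]
    exact ⟨fun t => (hd t).differentiableAt, hζ⟩
  · intro t ht
    by_contra hmem
    apply ht
    rcases lt_or_ge t a with h | h
    · refine intervalIntegral.integral_zero_ae (Eventually.of_forall fun s hs => ?_)
      rw [uIoc_of_ge h.le] at hs
      by_contra hne
      exact absurd (hsupp hne).1 (not_lt.mpr hs.2)
    · have hbt : b < t := not_le.mp fun h2 => hmem ⟨h, h2⟩
      have h3 : ∫ s in b..t, ζ s = 0 := by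
        refine intervalIntegral.integral_zero_ae (Eventually.of_forall fun s hs => ?_)
        rw [uIoc_of_le hbt.le] at hs
        by_contra hne
        exact absurd (hsupp hne).2 (not_lt.mpr hs.1.le)
      change ∫ s in a..t, ζ s = 0
      rw [← intervalIntegral.integral_add_adjacent_intervals (b := b)
        (hζ.continuous.intervalIntegrable _ _) (hζ.continuous.intervalIntegrable _ _), hint, h3,
        zero_add]

theorem exists_subset_Ioo_of_isCompact {K : Set ℝ} {t₁ : ℝ} (hK : IsCompact K)
    (hKt : K ⊆ Ioi t₁) : ∃ a b, t₁ < a ∧ a < b ∧ K ⊆ Ioo a b := by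
  rcases K.eq_empty_or_nonempty with rfl | hne
  · exact ⟨t₁ + 1, t₁ + 2, by linarith, by linarith, empty_subset _⟩
  · obtain ⟨m, hm, hm'⟩ := hK.exists_isLeast hne
    obtain ⟨M, hM, hM'⟩ := hK.exists_isGreatest hne
    have h1 : t₁ < m := hKt hm
    have h2 : m ≤ M := hm' hM
    exact ⟨(t₁ + m) / 2, M + 1, by linarith, by linarith, fun x hx =>
      ⟨by linarith [hm' hx], by linarith [hM' hx]⟩⟩

theorem integrable_mul_of_tsupport_subset {g f : ℝ → ℝ} {t₁ : ℝ} (hg : Continuous g)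
    (hgc : HasCompactSupport g) (hgs : tsupport g ⊆ Ioi t₁) (hf : ContinuousOn f (Ioi t₁)) :
    Integrable fun t => g t * f t := by
  have hs : tsupport (fun t => g t * f t) ⊆ tsupport g := tsupport_mul_subset_left
  refine Continuous.integrable_of_hasCompactSupport ?_ hgc.mul_right
  exact (hg.continuousOn.mul hf).continuous_of_tsupport_subset isOpen_Ioi (hs.trans hgs)

/-- A continuous function whose distributional derivative vanishes is constant. -/
theorem eq_of_integral_deriv_mul_eq_zero {f : ℝ → ℝ} {t₁ : ℝ} (hf : ContinuousOn f (Ioi t₁))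
    (h : ∀ θ : ℝ → ℝ, ContDiff ℝ ∞ θ → HasCompactSupport θ → tsupport θ ⊆ Ioi t₁ →
      ∫ t, deriv θ t * f t = 0) {s t : ℝ} (hs : t₁ < s) (ht : t₁ < t) : f s = f t := by
  -- Du Bois-Reymond's argument: subtracting from a test function g its mass times a bump χ of unit
  -- mass leaves a derivative, so g sees f as the constant ∫ χ f.
  obtain ⟨χ, hχ, hχc, hχs, hχ1⟩ : ∃ χ : ℝ → ℝ, ContDiff ℝ ∞ χ ∧ HasCompactSupport χ ∧
      tsupport χ ⊆ Ioi t₁ ∧ ∫ t, χ t = 1 := by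
    let B : ContDiffBump s := ⟨(s - t₁) / 4, (s - t₁) / 2, by linarith, by linarith⟩
    refine ⟨B.normed volume, B.contDiff_normed, B.hasCompactSupport_normed, ?_, B.integral_normed⟩
    rw [B.tsupport_normed_eq]
    intro x hx
    rw [Real.closedBall_eq_Icc] at hx
    have h1 : s - (s - t₁) / 2 ≤ x := hx.1
    rw [mem_Ioi]
    linarith
  have key : ∀ g : ℝ → ℝ, ContDiff ℝ ∞ g → HasCompactSupport g → tsupport g ⊆ Ioi t₁ →
      ∫ t, g t • (f t - ∫ r, χ r * f r) = 0 := by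
    intro g hg hgc hgs
    set A := ∫ r, g r with hA
    set ζ : ℝ → ℝ := fun r => g r - A * χ r with hζ
    obtain ⟨a, b, ha, hab, hKab⟩ := exists_subset_Ioo_of_isCompact (hgc.isCompact.union hχc.isCompact)
      (union_subset hgs hχs)
    have hgi : Integrable g := hg.continuous.integrable_of_hasCompactSupport hgc
    have hχi : Integrable χ := hχ.continuous.integrable_of_hasCompactSupport hχc
    have hζsupp : Function.support ζ ⊆ Ioo a b := fun r hr => by
      by_contra hne
      have h1 : r ∉ tsupport g := fun h' => hne (hKab (Or.inl h'))
      have h2 : r ∉ tsupport χ := fun h' => hne (hKab (Or.inr h'))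
      apply hr
      simp only [hζ, image_eq_zero_of_notMem_tsupport h1, image_eq_zero_of_notMem_tsupport h2]
      ring
    have hζint : ∫ r in a..b, ζ r = 0 := by
      rw [intervalIntegral.integral_eq_integral_of_support_subset
        (hζsupp.trans Ioo_subset_Ioc_self), integral_sub hgi (hχi.const_mul A),
        integral_const_mul, hχ1, mul_one, sub_self]
    obtain ⟨θ, hθ1, hθ2, hθ3⟩ := exists_deriv_eq_of_integral_eq_zero
      (hg.sub (contDiff_const.mul hχ)) hζsupp hζint
    have hθs : tsupport θ ⊆ Icc a b := closure_minimal hθ2 isClosed_Icc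
    have h0 := h θ hθ1 (HasCompactSupport.intro isCompact_Icc fun x hx => by
      by_contra hne
      exact hx (hθ2 hne)) (hθs.trans fun x hx => ha.trans_le hx.1)
    rw [hθ3] at h0
    have hgf := integrable_mul_of_tsupport_subset hg.continuous hgc hgs hf
    have hχf := integrable_mul_of_tsupport_subset hχ.continuous hχc hχs hf
    have h1 : ∫ t, ζ t * f t = (∫ t, g t * f t) - A * ∫ t, χ t * f t := by
      rw [← integral_const_mul, ← integral_sub hgf (hχf.const_mul A)]
      exact integral_congr_ae (Eventually.of_forall fun r => by simp only [hζ]; ring)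
    have h2 : ∫ t, g t • (f t - ∫ r, χ r * f r) = (∫ t, g t * f t) - A * ∫ t, χ t * f t := by
      rw [hA, ← integral_mul_const, ← integral_sub hgf (hgi.mul_const _)]
      exact integral_congr_ae (Eventually.of_forall fun r => by simp only [smul_eq_mul]; ring)
    rw [h2, ← h1, h0]
  have hae := isOpen_Ioi.ae_eq_zero_of_integral_contDiff_smul_eq_zero
    ((hf.sub continuousOn_const).locallyIntegrableOn measurableSet_Ioi) key
  have heq := Measure.eqOn_open_of_ae_eq
    ((ae_restrict_iff' measurableSet_Ioi).mpr hae : _ =ᵐ[volume.restrict (Ioi t₁)] fun _ => (0 : ℝ))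
    isOpen_Ioi (hf.sub continuousOn_const) continuousOn_const
  have h1 : f s - _ = 0 := heq hs
  have h2 : f t - _ = 0 := heq ht
  linarith

/-- A continuous function with continuous distributional derivative is differentiable. -/
theorem hasDerivAt_of_integral_deriv_mul {f k : ℝ → ℝ} {t₁ : ℝ} (hf : ContinuousOn f (Ioi t₁))
    (hk : ContinuousOn k (Ioi t₁))
    (h : ∀ θ : ℝ → ℝ, ContDiff ℝ ∞ θ → HasCompactSupport θ → tsupport θ ⊆ Ioi t₁ →
      ∫ t, (deriv θ t * f t + θ t * k t) = 0) {t : ℝ} (ht : t₁ < t) : HasDerivAt f (k t) t := by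
  have hint : ∀ r, t₁ < r → IntervalIntegrable k volume t r := fun r hr =>
    (hk.mono fun x hx => (lt_min ht hr).trans_le hx.1).intervalIntegrable
  have hd : ∀ r, t₁ < r → HasDerivAt (fun r => ∫ s in t..r, k s) (k r) r := fun r hr =>
    intervalIntegral.integral_hasDerivAt_right (hint r hr)
      (hk.stronglyMeasurableAtFilter isOpen_Ioi r hr) (hk.continuousAt (Ioi_mem_nhds hr))
  -- Integration by parts shows that f minus the primitive K of k has zero distributional
  -- derivative.
  set K : ℝ → ℝ := fun r => ∫ s in t..r, k s with hK
  have hKc : ContinuousOn K (Ioi t₁) := fun r hr => (hd r hr).continuousAt.continuousWithinAt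
  have hconst : ∀ r, t₁ < r → f r - K r = f t - K t := fun r hr => by
    refine eq_of_integral_deriv_mul_eq_zero (hf.sub hKc) (fun θ hθ hθc hθs => ?_) hr ht
    have hθ' : Continuous (deriv θ) := hθ.continuous_deriv (by simp)
    have hθ's : tsupport (deriv θ) ⊆ Ioi t₁ := (closure_minimal support_deriv_subset
      isClosed_closure).trans hθs
    have i1 := integrable_mul_of_tsupport_subset hθ' hθc.deriv hθ's hf
    have i2 := integrable_mul_of_tsupport_subset hθ' hθc.deriv hθ's hKc
    have i3 := integrable_mul_of_tsupport_subset hθ.continuous hθc hθs hk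
    have i4 := integrable_mul_of_tsupport_subset hθ.continuous hθc hθs hKc
    have hparts : ∫ x, K x * deriv θ x = -∫ x, k x * θ x :=
      integral_mul_deriv_eq_deriv_mul_of_integrable (fun x hx => hd x (hθs hx))
        (fun x _ => (hθ.differentiable (by simp) x).hasDerivAt)
        (i2.congr (Eventually.of_forall fun x => mul_comm _ _))
        (i3.congr (Eventually.of_forall fun x => mul_comm _ _))
        (i4.congr (Eventually.of_forall fun x => mul_comm _ _))
    have h0 := h θ hθ hθc hθs
    rw [integral_add i1 i3] at h0
    have h1 : ∫ x, deriv θ x * (f - K) x = (∫ x, deriv θ x * f x) - ∫ x, K x * deriv θ x := by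
      rw [← integral_sub i1 (i2.congr (Eventually.of_forall fun x => mul_comm _ _))]
      exact integral_congr_ae (Eventually.of_forall fun x => by simp only [Pi.sub_apply]; ring)
    have h2 : ∫ x, k x * θ x = ∫ x, θ x * k x := by simp only [mul_comm]
    refine Eq.trans h1 ?_
    rw [hparts, h2]
    linarith
  refine ((hd t ht).add_const (f t - K t)).congr_of_eventuallyEq ?_
  filter_upwards [Ioi_mem_nhds ht] with r hr
  rw [← hconst r hr]
  ring

/-- Scalar derivatives identify Z(r) - Z(t) with the vector integral of Q, which is differentiable
in norm because Q is continuous. -/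
theorem hasDerivAt_of_inner {H : Type*} [NormedAddCommGroup H] [InnerProductSpace ℝ H]
    [CompleteSpace H] {Z Q : ℝ → H} {t₁ : ℝ} (hQ : ContinuousOn Q (Ioi t₁))
    (h : ∀ x t, t₁ < t → HasDerivAt (fun t => inner ℝ x (Z t)) (inner ℝ x (Q t)) t) {t : ℝ}
    (ht : t₁ < t) : HasDerivAt Z (Q t) t := by
  have hsub : ∀ r, t₁ < r → uIcc t r ⊆ Ioi t₁ := fun r hr x hx => (lt_min ht hr).trans_le hx.1
  have hint : ∀ r, t₁ < r → IntervalIntegrable Q volume t r := fun r hr =>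
    (hQ.mono (hsub r hr)).intervalIntegrable
  have hd : HasDerivAt (fun r => ∫ s in t..r, Q s) (Q t) t :=
    intervalIntegral.integral_hasDerivAt_right (hint t ht)
      (hQ.stronglyMeasurableAtFilter isOpen_Ioi t ht) (hQ.continuousAt (Ioi_mem_nhds ht))
  refine (hd.add_const (Z t)).congr_of_eventuallyEq ?_
  filter_upwards [Ioi_mem_nhds ht] with r hr
  rw [← sub_eq_iff_eq_add]
  refine ext_inner_left ℝ fun x => ?_
  have h1 := (innerSL ℝ x).intervalIntegral_comp_comm (hint r hr)
  simp only [innerSL_apply_apply] at h1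
  rw [← h1, intervalIntegral.integral_eq_sub_of_hasDerivAt
    (fun s hs => h x s (hsub r hr hs))
    ((continuousOn_const.inner (hQ.mono (hsub r hr))).intervalIntegrable), inner_sub_right]

/-- A continuous function with values in a Hilbert space and with continuous distributional
derivative is differentiable. -/
theorem hasDerivAt_of_integral_deriv_mul_inner {H : Type*} [NormedAddCommGroup H]
    [InnerProductSpace ℝ H] [CompleteSpace H] {Z Q : ℝ → H} {t₁ : ℝ}
    (hZ : ContinuousOn Z (Ioi t₁)) (hQ : ContinuousOn Q (Ioi t₁))
    (h : ∀ (x : H) (θ : ℝ → ℝ) (a b : ℝ), t₁ < a → a < b → ContDiff ℝ ∞ θ →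
      HasCompactSupport θ → tsupport θ ⊆ Ioo a b →
      ∫ t in Ioo a b, (deriv θ t * inner ℝ x (Z t) + θ t * inner ℝ x (Q t)) = 0)
    {t : ℝ} (ht : t₁ < t) : HasDerivAt Z (Q t) t := by
  refine hasDerivAt_of_inner hQ (fun x t ht => ?_) ht
  refine hasDerivAt_of_integral_deriv_mul (k := fun t => inner ℝ x (Q t))
    (continuousOn_const.inner hZ) (continuousOn_const.inner hQ) (fun θ hθ hθc hθs => ?_) ht
  obtain ⟨a, b, ha, hab, hsub⟩ := exists_subset_Ioo_of_isCompact hθc.isCompact hθs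
  rw [← h x θ a b ha hab hθ hθc hsub, setIntegral_eq_integral_of_forall_compl_eq_zero]
  intro t ht
  have h1 : t ∉ tsupport θ := fun h => ht (hsub h)
  have h2 : deriv θ t = 0 := by
    by_contra hne
    exact h1 (support_deriv_subset hne)
  rw [h2, image_eq_zero_of_notMem_tsupport h1, zero_mul, zero_mul, add_zero]

/-- By the mean value theorem f(t+1) - f(t) is a value of f' at a time beyond t, and it tends to 0.
-/
theorem eq_zero_of_tendsto_of_tendsto_deriv {f f' : ℝ → ℝ} {t₁ L L' : ℝ}
    (hd : ∀ t, t₁ < t → HasDerivAt f (f' t) t) (hf : Tendsto f atTop (𝓝 L))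
    (hf' : Tendsto f' atTop (𝓝 L')) : L' = 0 := by
  have h1 : ∀ t, t₁ < t → ∃ s, t < s ∧ f' s = f (t + 1) - f t := fun t ht => by
    obtain ⟨s, hs, h⟩ := exists_hasDerivAt_eq_slope f f' (show t < t + 1 by linarith)
      (fun x hx => (hd x (ht.trans_le hx.1)).continuousAt.continuousWithinAt)
      (fun x hx => hd x (ht.trans hx.1))
    exact ⟨s, hs.1, by rw [h, add_sub_cancel_left, div_one]⟩
  have h2 : ∀ t : ℝ, ∃ s, t ≤ s ∧ (t₁ < t → f' s = f (t + 1) - f t) := fun t => by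
    by_cases ht : t₁ < t
    · obtain ⟨s, hs, h⟩ := h1 t ht
      exact ⟨s, hs.le, fun _ => h⟩
    · exact ⟨t, le_rfl, fun h => absurd h ht⟩
  choose s hs hs' using h2
  have h3 : Tendsto (fun t => f' (s t)) atTop (𝓝 L') :=
    hf'.comp (tendsto_atTop_mono hs tendsto_id)
  have h4 : Tendsto (fun t => f (t + 1) - f t) atTop (𝓝 (L - L)) :=
    (hf.comp (tendsto_atTop_add_const_right _ 1 tendsto_id)).sub hf
  rw [sub_self] at h4
  refine tendsto_nhds_unique h3 (h4.congr' ?_)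
  filter_upwards [eventually_gt_atTop t₁] with t ht
  exact (hs' t ht).symm

end WeakDerivative

/-! ### The L² classes of v^p / w and w v, and the entropy -/

section EnergyClasses

open scoped ENNReal

variable {N : ℕ} {Ω : Set (Eucl N)} {p c : ℝ} {V v u : Eucl N → ℝ}

/-- The class in `L²(Ω)` of a square integrable function. -/
noncomputable def l2Class (Ω : Set (Eucl N)) (f : Eucl N → ℝ) : Lp ℝ 2 (volume.restrict Ω) :=
  open scoped Classical in if h : MemLp f 2 (volume.restrict Ω) then h.toLp f else 0

theorem coeFn_l2Class {f : Eucl N → ℝ} (h : MemLp f 2 (volume.restrict Ω)) :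
    l2Class Ω f =ᵐ[volume.restrict Ω] f := by
  rw [l2Class, dif_pos h]
  exact h.coeFn_toLp

theorem norm_sq_eq_integral_norm_sq {α E : Type*} [MeasurableSpace α] {μ : Measure α}
    [NormedAddCommGroup E] [InnerProductSpace ℝ E] (f : Lp E 2 μ) :
    ‖f‖ ^ 2 = ∫ x, ‖f x‖ ^ 2 ∂μ := by
  rw [← real_inner_self_eq_norm_sq, L2.inner_def]
  simp only [real_inner_self_eq_norm_sq]

/-- The function `v` is measurable and has relative distance at most `1/4` from `V`. -/
def IsNear (Ω : Set (Eucl N)) (V v : Eucl N → ℝ) : Prop :=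
  AEMeasurable v (volume.restrict Ω) ∧ ∀ᵐ x ∂(volume.restrict Ω), |v x - V x| ≤ 1 / 4 * V x

/-- The class of `v^p V^{-(p-1)/2}` in `L²(Ω)`. -/
noncomputable def powClass (Ω : Set (Eucl N)) (p : ℝ) (V v : Eucl N → ℝ) :
    Lp ℝ 2 (volume.restrict Ω) :=
  l2Class Ω fun x => v x ^ p / sqrtWeight p (V x)

/-- The class of `V^{(p-1)/2} v` in `L²(Ω)`. -/
noncomputable def linClass (Ω : Set (Eucl N)) (p : ℝ) (V v : Eucl N → ℝ) :
    Lp ℝ 2 (volume.restrict Ω) :=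
  l2Class Ω fun x => sqrtWeight p (V x) * v x

theorem IsPositiveStationarySolution.isNear (hV : IsPositiveStationarySolution Ω p c V)
    (hΩm : MeasurableSet Ω) : IsNear Ω V V := by
  refine ⟨hV.aemeasurable hΩm, ?_⟩
  filter_upwards [ae_restrict_mem hΩm] with x hx
  have := hV.pos x hx
  rw [sub_self, abs_zero]
  positivity

theorem aemeasurable_sqrtWeight (hV : AEMeasurable V (volume.restrict Ω)) :
    AEMeasurable (fun x => sqrtWeight p (V x)) (volume.restrict Ω) :=
  hV.pow_const _

theorem isFiniteMeasure_restrict (hΩ : Bornology.IsBounded Ω) :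
    IsFiniteMeasure (volume.restrict Ω) :=
  ⟨by rw [Measure.restrict_apply_univ]; exact hΩ.measure_lt_top⟩

/-- Division by the weight, which degenerates at the boundary, is harmless: v is comparable with V
and p - (p-1)/2 = (p+1)/2 is positive. -/
theorem rpow_div_sqrtWeight_le {V v B : ℝ} (hp : 1 < p) (hV : 0 < V) (hVB : V ≤ B)
    (h : |v - V| ≤ 1 / 4 * V) : |v ^ p / sqrtWeight p V| ≤ 2 ^ p * B ^ ((p + 1) / 2) := by
  have hv : 0 ≤ v := by linarith [(abs_le.mp h).1]
  have hv2 : v ≤ 2 * V := by linarith [(abs_le.mp h).2]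
  have hs := sqrtWeight_pos (p := p) hV
  rw [abs_of_nonneg (div_nonneg (Real.rpow_nonneg hv p) hs.le), div_le_iff₀ hs]
  calc v ^ p ≤ (2 * V) ^ p := Real.rpow_le_rpow hv hv2 (by linarith)
    _ = 2 ^ p * V ^ ((p + 1) / 2) * sqrtWeight p V := by
      rw [Real.mul_rpow zero_le_two hV.le, sqrtWeight, mul_assoc, ← Real.rpow_add hV]
      congr 2; ring
    _ ≤ _ := by
      gcongr

theorem sqrtWeight_mul_le {V v B : ℝ} (hp : 1 < p) (hV : 0 < V) (hVB : V ≤ B)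
    (h : |v - V| ≤ 1 / 4 * V) : |sqrtWeight p V * v| ≤ B ^ ((p - 1) / 2) * (2 * B) := by
  have hv : 0 ≤ v := by linarith [(abs_le.mp h).1]
  have hv2 : v ≤ 2 * V := by linarith [(abs_le.mp h).2]
  have hs := sqrtWeight_pos (p := p) hV
  rw [abs_of_nonneg (mul_nonneg hs.le hv)]
  have h1 : sqrtWeight p V ≤ B ^ ((p - 1) / 2) := Real.rpow_le_rpow hV.le hVB (by linarith)
  exact mul_le_mul h1 (by linarith) hv (Real.rpow_nonneg (hV.le.trans hVB) _)

theorem IsNear.memLp_pow (hp : 1 < p) (hΩ : Bornology.IsBounded Ω) (hΩm : MeasurableSet Ω)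
    (hV : IsPositiveStationarySolution Ω p c V) (hv : IsNear Ω V v) :
    MemLp (fun x => v x ^ p / sqrtWeight p (V x)) 2 (volume.restrict Ω) := by
  have := isFiniteMeasure_restrict hΩ
  obtain ⟨B, -, hB⟩ := hV.exists_le hΩ
  refine MemLp.of_bound ((hv.1.pow_const p).div
    (aemeasurable_sqrtWeight (hV.aemeasurable hΩm))).aestronglyMeasurable
    (2 ^ p * B ^ ((p + 1) / 2)) ?_
  filter_upwards [hv.2, ae_restrict_mem hΩm] with x h1 h2
  exact rpow_div_sqrtWeight_le hp (hV.pos x h2) (hB x h2) h1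

theorem IsNear.memLp_lin (hp : 1 < p) (hΩ : Bornology.IsBounded Ω) (hΩm : MeasurableSet Ω)
    (hV : IsPositiveStationarySolution Ω p c V) (hv : IsNear Ω V v) :
    MemLp (fun x => sqrtWeight p (V x) * v x) 2 (volume.restrict Ω) := by
  have := isFiniteMeasure_restrict hΩ
  obtain ⟨B, -, hB⟩ := hV.exists_le hΩ
  refine MemLp.of_bound ((aemeasurable_sqrtWeight
    (hV.aemeasurable hΩm)).mul hv.1).aestronglyMeasurable (B ^ ((p - 1) / 2) * (2 * B)) ?_
  filter_upwards [hv.2, ae_restrict_mem hΩm] with x h1 h2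
  exact sqrtWeight_mul_le hp (hV.pos x h2) (hB x h2) h1

theorem coeFn_powClass_sub (hp : 1 < p) (hΩ : Bornology.IsBounded Ω) (hΩm : MeasurableSet Ω)
    (hV : IsPositiveStationarySolution Ω p c V) (hv : IsNear Ω V v) :
    (powClass Ω p V v - powClass Ω p V V : Lp ℝ 2 (volume.restrict Ω)) =ᵐ[volume.restrict Ω]
      fun x => (v x ^ p - V x ^ p) / sqrtWeight p (V x) := by
  filter_upwards [Lp.coeFn_sub (powClass Ω p V v) (powClass Ω p V V),
    coeFn_l2Class (hv.memLp_pow hp hΩ hΩm hV),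
    coeFn_l2Class ((hV.isNear hΩm).memLp_pow hp hΩ hΩm hV)] with x h1 h2 h3
  rw [h1, Pi.sub_apply, powClass, powClass, h2, h3, sub_div]

theorem coeFn_linClass_sub (hp : 1 < p) (hΩ : Bornology.IsBounded Ω) (hΩm : MeasurableSet Ω)
    (hV : IsPositiveStationarySolution Ω p c V) (hv : IsNear Ω V v) :
    (linClass Ω p V v - linClass Ω p V V : Lp ℝ 2 (volume.restrict Ω)) =ᵐ[volume.restrict Ω]
      fun x => sqrtWeight p (V x) * (v x - V x) := by
  filter_upwards [Lp.coeFn_sub (linClass Ω p V v) (linClass Ω p V V),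
    coeFn_l2Class (hv.memLp_lin hp hΩ hΩm hV),
    coeFn_l2Class ((hV.isNear hΩm).memLp_lin hp hΩ hΩm hV)] with x h1 h2 h3
  rw [h1, Pi.sub_apply, linClass, linClass, h2, h3, mul_sub]

theorem exists_norm_sq_class_sub_le (hp : 1 < p) (hΩ : Bornology.IsBounded Ω)
    (hΩm : MeasurableSet Ω) (hV : IsPositiveStationarySolution Ω p c V) :
    ∃ C : ℝ, 0 ≤ C ∧ ∀ v u : Eucl N → ℝ, IsNear Ω V v → IsNear Ω V u →
      IntegrableOn (fun x => v x ^ p) Ω → IntegrableOn (fun x => u x ^ p) Ω →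
      ‖powClass Ω p V v - powClass Ω p V u‖ ^ 2 ≤ C * ∫ x in Ω, |v x ^ p - u x ^ p| ∧
      ‖linClass Ω p V v - linClass Ω p V u‖ ^ 2 ≤ C * ∫ x in Ω, |v x ^ p - u x ^ p| := by
  obtain ⟨B, hB0, hB⟩ := hV.exists_le hΩ
  obtain ⟨C, hC0, hC⟩ := exists_sq_difference_le hp
  refine ⟨C * B, by positivity, fun v u hv hu hvi hui => ?_⟩
  have hint : IntegrableOn (fun x => C * B * |v x ^ p - u x ^ p|) Ω :=
    (hvi.sub hui).abs.const_mul _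
  have key : ∀ f : Lp ℝ 2 (volume.restrict Ω), (∀ᵐ x ∂(volume.restrict Ω),
      f x ^ 2 ≤ C * V x * |v x ^ p - u x ^ p|) →
      ‖f‖ ^ 2 ≤ C * B * ∫ x in Ω, |v x ^ p - u x ^ p| := fun f hf => by
    rw [norm_sq_eq_integral_norm_sq, ← integral_const_mul]
    refine integral_mono_ae ((Lp.memLp f).integrable_norm_pow two_ne_zero) hint ?_
    filter_upwards [hf, ae_restrict_mem hΩm] with x h1 h2
    simp only [Real.norm_eq_abs, sq_abs]
    refine h1.trans ?_
    have := hB x h2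
    gcongr
  constructor
  · refine key _ ?_
    filter_upwards [coeFn_powClass_sub hp hΩ hΩm hV hv, coeFn_powClass_sub hp hΩ hΩm hV hu,
      Lp.coeFn_sub (powClass Ω p V v - powClass Ω p V V) (powClass Ω p V u - powClass Ω p V V),
      ae_restrict_mem hΩm, hv.2, hu.2] with x h1 h2 h3 h4 h5 h6
    rw [sub_sub_sub_cancel_right] at h3
    rw [h3, Pi.sub_apply, h1, h2]
    exact (hC _ _ _ (hV.pos x h4) h5 h6).1
  · refine key _ ?_
    filter_upwards [coeFn_linClass_sub hp hΩ hΩm hV hv, coeFn_linClass_sub hp hΩ hΩm hV hu,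
      Lp.coeFn_sub (linClass Ω p V v - linClass Ω p V V) (linClass Ω p V u - linClass Ω p V V),
      ae_restrict_mem hΩm, hv.2, hu.2] with x h1 h2 h3 h4 h5 h6
    rw [sub_sub_sub_cancel_right] at h3
    rw [h3, Pi.sub_apply, h1, h2]
    exact (hC _ _ _ (hV.pos x h4) h5 h6).2

theorem exists_norm_powClass_le (hp : 1 < p) (hΩ : Bornology.IsBounded Ω)
    (hΩm : MeasurableSet Ω) (hV : IsPositiveStationarySolution Ω p c V) :
    ∃ M : ℝ, ∀ v : Eucl N → ℝ, IsNear Ω V v → ‖powClass Ω p V v‖ ≤ M := by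
  have := isFiniteMeasure_restrict hΩ
  obtain ⟨B, hB0, hB⟩ := hV.exists_le hΩ
  refine ⟨_, fun v hv => Lp.norm_le_of_ae_bound (C := 2 ^ p * B ^ ((p + 1) / 2))
    (by positivity) ?_⟩
  filter_upwards [coeFn_l2Class (hv.memLp_pow hp hΩ hΩm hV), hv.2, ae_restrict_mem hΩm]
    with x h1 h2 h3
  rw [powClass, h1]
  exact rpow_div_sqrtWeight_le hp (hV.pos x h3) (hB x h3) h2

theorem exists_entropy_bounds (hp : 1 < p) (hΩ : Bornology.IsBounded Ω)
    (hΩm : MeasurableSet Ω) (hV : IsPositiveStationarySolution Ω p c V) :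
    ∃ c₁ c₂ : ℝ, 0 < c₁ ∧ 0 < c₂ ∧ ∀ v : Eucl N → ℝ, IsNear Ω V v →
      IntegrableOn (fun x => entropyDensity p (V x) (v x)) Ω ∧
      c₁ * ‖powClass Ω p V v - powClass Ω p V V‖ ^ 2 ≤ entropy Ω p V v ∧
      entropy Ω p V v ≤ c₂ * ‖powClass Ω p V v - powClass Ω p V V‖ ^ 2 := by
  obtain ⟨c₁, c₂, hc₁, hc₂, h⟩ := exists_entropyDensity_bounds hp
  refine ⟨c₁, c₂, hc₁, hc₂, fun v hv => ?_⟩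
  set f := powClass Ω p V v - powClass Ω p V V with hf
  have hbd : ∀ᵐ x ∂(volume.restrict Ω), c₁ * ‖f x‖ ^ 2 ≤ entropyDensity p (V x) (v x) ∧
      entropyDensity p (V x) (v x) ≤ c₂ * ‖f x‖ ^ 2 := by
    filter_upwards [coeFn_powClass_sub hp hΩ hΩm hV hv, ae_restrict_mem hΩm, hv.2] with x h1 h2 h3
    rw [hf, h1, Real.norm_eq_abs, sq_abs]
    exact h _ _ (hV.pos x h2) h3
  have hfi : Integrable (fun x => ‖f x‖ ^ 2) (volume.restrict Ω) :=
    (Lp.memLp f).integrable_norm_pow two_ne_zero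
  have hVm := hV.aemeasurable hΩm
  have hint : IntegrableOn (fun x => entropyDensity p (V x) (v x)) Ω := by
    refine (hfi.const_mul c₂).mono' ?_ ?_
    · exact (((hv.1.pow_const (p + 1)).sub (hVm.pow_const (p + 1))).sub
        ((((hv.1.pow_const p).sub (hVm.pow_const p)).const_mul ((p + 1) / p)).mul
          hVm)).aestronglyMeasurable
    · filter_upwards [hbd] with x hx
      rw [Real.norm_of_nonneg (le_trans (by positivity) hx.1)]
      exact hx.2
  refine ⟨hint, ?_, ?_⟩
  · rw [norm_sq_eq_integral_norm_sq, ← integral_const_mul]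
    exact integral_mono_ae (hfi.const_mul c₁) hint (hbd.mono fun x hx => hx.1)
  · rw [norm_sq_eq_integral_norm_sq, ← integral_const_mul]
    exact integral_mono_ae hint (hfi.const_mul c₂) (hbd.mono fun x hx => hx.2)

/-- The integrated tangent inequality: the linear class is, up to the factor (p+1)/p, the gradient
of the entropy as a convex functional of the power class. -/
theorem entropy_sub_le (hp : 1 < p) (hΩ : Bornology.IsBounded Ω)
    (hΩm : MeasurableSet Ω) (hV : IsPositiveStationarySolution Ω p c V) (hv : IsNear Ω V v)
    (hu : IsNear Ω V u) :
    entropy Ω p V v - entropy Ω p V u ≤ (p + 1) / p *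
      inner ℝ (linClass Ω p V v - linClass Ω p V V)
        ((powClass Ω p V v - powClass Ω p V V) - (powClass Ω p V u - powClass Ω p V V)) := by
  obtain ⟨_, _, _, _, h⟩ := exists_entropy_bounds hp hΩ hΩm hV
  have hvi := (h v hv).1
  have hui := (h u hu).1
  have h0 : entropy Ω p V v - entropy Ω p V u =
      ∫ x in Ω, (entropyDensity p (V x) (v x) - entropyDensity p (V x) (u x)) :=
    (integral_sub hvi hui).symm
  rw [h0, L2.inner_def, ← integral_const_mul]
  refine integral_mono_ae (hvi.sub hui) ((L2.integrable_inner _ _).const_mul _) ?_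
  filter_upwards [coeFn_powClass_sub hp hΩ hΩm hV hv, coeFn_powClass_sub hp hΩ hΩm hV hu,
    Lp.coeFn_sub (powClass Ω p V v - powClass Ω p V V) (powClass Ω p V u - powClass Ω p V V),
    coeFn_linClass_sub hp hΩ hΩm hV hv,
    ae_restrict_mem hΩm, hv.2, hu.2] with x h1 h2 h3 h4 h5 h6 h7
  have hVx := hV.pos x h5
  simp only [h3, Pi.sub_apply, h1, h2, h4]
  refine (entropyDensity_sub_le hp hVx (by linarith [(abs_le.mp h6).1])
    (by linarith [(abs_le.mp h7).1])).trans_eq ?_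
  simp [mul_comm]

theorem norm_linClass_sub_le (hp : 1 < p) (hΩ : Bornology.IsBounded Ω)
    (hΩm : MeasurableSet Ω) (hV : IsPositiveStationarySolution Ω p c V) (hv : IsNear Ω V v) :
    ‖linClass Ω p V v - linClass Ω p V V‖ ≤ ‖powClass Ω p V v - powClass Ω p V V‖ := by
  refine Lp.norm_le_norm_of_ae_le ?_
  filter_upwards [coeFn_powClass_sub hp hΩ hΩm hV hv, coeFn_linClass_sub hp hΩ hΩm hV hv,
    ae_restrict_mem hΩm, hv.2] with x h1 h2 h3 h4
  rw [h1, h2]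
  exact abs_sqrtWeight_mul_sub_le hp (hV.pos x h3) h4

theorem exists_norm_linearization_error_le (hp : 1 < p) (hΩ : Bornology.IsBounded Ω)
    (hΩm : MeasurableSet Ω) (hV : IsPositiveStationarySolution Ω p c V) :
    ∃ C : ℝ, 0 ≤ C ∧ ∀ (v : Eucl N → ℝ) (θ : ℝ), IsNear Ω V v →
      (∀ᵐ x ∂(volume.restrict Ω), |v x - V x| ≤ θ * V x) →
      ‖(powClass Ω p V v - powClass Ω p V V) - p • (linClass Ω p V v - linClass Ω p V V)‖ ≤
        C * θ * ‖powClass Ω p V v - powClass Ω p V V‖ := by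
  obtain ⟨C, hC0, hC⟩ := exists_linearization_error_le hp
  refine ⟨C, hC0, fun v θ hv hθ => ?_⟩
  refine Lp.norm_le_mul_norm_of_ae_le_mul ?_
  filter_upwards [coeFn_powClass_sub hp hΩ hΩm hV hv, coeFn_linClass_sub hp hΩ hΩm hV hv,
    Lp.coeFn_sub (powClass Ω p V v - powClass Ω p V V)
      (p • (linClass Ω p V v - linClass Ω p V V)),
    Lp.coeFn_smul p (linClass Ω p V v - linClass Ω p V V),
    ae_restrict_mem hΩm, hv.2, hθ] with x h1 h2 h3 h4 h5 h6 h7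
  rw [h3, Pi.sub_apply, h4, Pi.smul_apply, h1, h2]
  exact hC _ _ _ (hV.pos x h5) h6 h7

end EnergyClasses

/-! ### The weak equation with separated test functions -/

section WeakFormulation

open scoped ENNReal

variable {N : ℕ} {Ω : Set (Eucl N)} {p c δ t₀ a b : ℝ} {V : Eucl N → ℝ} {v : ℝ → Eucl N → ℝ}
  {G : ℝ → Eucl N → Eucl N} {θ : ℝ → ℝ}

theorem isSpaceTimeTestFunction_mul (hθ : ContDiff ℝ ∞ θ) (hθs : Function.support θ ⊆ Ioo a b)
    (ha : 0 < a) {ψ : Eucl N → ℝ} (hψ : IsTestFunction Ω ψ) :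
    IsSpaceTimeTestFunction Ω fun z : ℝ × Eucl N => θ z.1 * ψ z.2 := by
  have hsupp : tsupport (fun z : ℝ × Eucl N => θ z.1 * ψ z.2) ⊆ Icc a b ×ˢ tsupport ψ := by
    refine closure_minimal (fun z hz => ?_) (isClosed_Icc.prod isClosed_closure)
    have hz' : θ z.1 * ψ z.2 ≠ 0 := hz
    exact ⟨Ioo_subset_Icc_self (hθs (left_ne_zero_of_mul hz')),
      subset_tsupport _ (right_ne_zero_of_mul hz')⟩
  refine ⟨(hθ.comp contDiff_fst).mul (hψ.1.comp contDiff_snd), ?_, hsupp.trans ?_⟩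
  · exact (isCompact_Icc.prod hψ.2.1.isCompact).of_isClosed_subset isClosed_closure hsupp
  · exact prod_mono (fun x hx => ha.trans_le hx.1) hψ.2.2

/-- The relative error condition in space-time bounds v by 2 B for almost every (t, x), which
justifies Fubini's theorem. -/
theorem integrable_prod_rpow_mul (hΩ : Bornology.IsBounded Ω) (hΩo : IsOpen Ω) (hp : 1 < p)
    (hV : IsPositiveStationarySolution Ω p c V)
    (hm : AEStronglyMeasurable (fun z : ℝ × Eucl N => v z.1 z.2)
      (volume.restrict (Ioi (0 : ℝ) ×ˢ Ω)))
    (hrel : RelativeErrorCondition Ω V v δ t₀) (hδ0 : 0 < δ) (hδ : δ < 1) (ht₀ : 0 < t₀)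
    (ha : t₀ < a) {g : ℝ → ℝ} (hg : Continuous g) (hgc : HasCompactSupport g)
    {ψ : Eucl N → ℝ} (hψ : IsTestFunction Ω ψ) :
    Integrable (fun z : ℝ × Eucl N => g z.1 * (v z.1 z.2 ^ p * ψ z.2))
      ((volume.restrict (Ioo a b)).prod (volume.restrict Ω)) := by
  have := isFiniteMeasure_restrict hΩ
  obtain ⟨B, hB0, hB⟩ := hV.exists_le hΩ
  obtain ⟨C₁, hC₁⟩ := hgc.exists_bound_of_continuous hg
  obtain ⟨C₂, hC₂⟩ := hψ.2.1.exists_bound_of_continuous hψ.1.continuous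
  have hsub : Ioo a b ×ˢ Ω ⊆ Ioi (0 : ℝ) ×ˢ Ω :=
    prod_mono (fun x hx => (ht₀.trans ha).trans hx.1) subset_rfl
  have hsub' : Ioo a b ×ˢ Ω ⊆ Ici t₀ ×ˢ Ω :=
    prod_mono (fun x hx => (ha.trans hx.1).le) subset_rfl
  have hm' := (hm.mono_measure (Measure.restrict_mono hsub le_rfl)).aemeasurable.pow_const p
  have hr := ae_restrict_of_ae_restrict_of_subset hsub' hrel
  have hmem := ae_restrict_mem (μ := (volume : Measure (ℝ × Eucl N)))
    (measurableSet_Ioo (a := a) (b := b)|>.prod hΩo.measurableSet)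
  rw [Measure.volume_eq_prod, ← Measure.prod_restrict] at hm' hr hmem
  refine Integrable.of_bound ?_ (C₁ * ((2 * B) ^ p * C₂)) ?_
  · exact ((hg.measurable.comp measurable_fst).aestronglyMeasurable).mul
      (hm'.aestronglyMeasurable.mul
        ((hψ.1.continuous.measurable.comp measurable_snd).aestronglyMeasurable))
  · filter_upwards [hr, hmem] with z h1 h2
    have hVz := hV.pos z.2 h2.2
    have h3 : |v z.1 z.2 ^ p| ≤ (2 * B) ^ p := by
      refine (Real.abs_rpow_le_abs_rpow _ _).trans
        (Real.rpow_le_rpow (abs_nonneg _) ?_ (by linarith))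
      have h4 : |v z.1 z.2| ≤ |v z.1 z.2 - V z.2| + |V z.2| := by
        simpa using abs_add_le (v z.1 z.2 - V z.2) (V z.2)
      rw [abs_of_pos hVz] at h4
      have h5 := hB z.2 h2.2
      nlinarith
    rw [norm_mul, norm_mul]
    have h6 := hC₁ z.1
    have h7 := hC₂ z.2
    have h8 : 0 ≤ C₁ := (norm_nonneg _).trans h6
    have h9 : ‖v z.1 z.2 ^ p‖ ≤ (2 * B) ^ p := h3
    gcongr

theorem integrable_prod_mul_inner_gradient (hΩ : Bornology.IsBounded Ω)
    (hG : MemLp (fun z : ℝ × Eucl N => G z.1 z.2) 2 (volume.restrict (Ioo a b ×ˢ Ω)))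
    (hθ : Continuous θ) (hθc : HasCompactSupport θ) {ψ : Eucl N → ℝ} (hψ : IsTestFunction Ω ψ) :
    Integrable (fun z : ℝ × Eucl N => θ z.1 * inner ℝ (G z.1 z.2) (gradient ψ z.2))
      ((volume.restrict (Ioo a b)).prod (volume.restrict Ω)) := by
  have := isFiniteMeasure_restrict hΩ
  obtain ⟨C₁, hC₁⟩ := hθc.exists_bound_of_continuous hθ
  have hgrad := continuous_gradient hψ.contDiff_one
  obtain ⟨C₂, hC₂⟩ := (hasCompactSupport_gradient hψ.2.1).exists_bound_of_continuous hgrad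
  rw [Measure.volume_eq_prod, ← Measure.prod_restrict] at hG
  refine ((hG.integrable one_le_two).norm.const_mul (C₁ * C₂)).mono' ?_ ?_
  · exact ((hθ.measurable.comp measurable_fst).aestronglyMeasurable).mul
      (hG.1.inner ((hgrad.measurable.comp measurable_snd).aestronglyMeasurable))
  · refine Eventually.of_forall fun z => ?_
    have h6 := hC₁ z.1
    have h7 := hC₂ z.2
    have h8 : 0 ≤ C₁ := (norm_nonneg _).trans h6
    calc ‖θ z.1 * inner ℝ (G z.1 z.2) (gradient ψ z.2)‖
        ≤ C₁ * (‖G z.1 z.2‖ * C₂) := by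
          rw [norm_mul]
          have := norm_inner_le_norm (𝕜 := ℝ) (G z.1 z.2) (gradient ψ z.2)
          have h10 : ‖G z.1 z.2‖ * ‖gradient ψ z.2‖ ≤ ‖G z.1 z.2‖ * C₂ := by gcongr
          exact mul_le_mul h6 (this.trans h10) (norm_nonneg _) h8
      _ = _ := by ring

/-- The weak formulation tested with a product, after integration in space. -/
theorem integral_separated_test_eq_zero (hΩ : Bornology.IsBounded Ω) (hΩo : IsOpen Ω)
    (hp : 1 < p) (hV : IsPositiveStationarySolution Ω p c V)
    (hm : AEStronglyMeasurable (fun z : ℝ × Eucl N => v z.1 z.2)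
      (volume.restrict (Ioi (0 : ℝ) ×ˢ Ω)))
    (hrel : RelativeErrorCondition Ω V v δ t₀) (hδ0 : 0 < δ) (hδ : δ < 1) (ht₀ : 0 < t₀)
    (hG : MemLp (fun z : ℝ × Eucl N => G z.1 z.2) 2 (volume.restrict (Ioo a b ×ˢ Ω)))
    (hweak : ∀ φ : ℝ × Eucl N → ℝ, IsSpaceTimeTestFunction Ω φ →
      ∫ z in Ioi (0 : ℝ) ×ˢ Ω,
        (v z.1 z.2 ^ p * deriv (fun s => φ (s, z.2)) z.1
          - inner ℝ (G z.1 z.2) (gradient (fun y => φ (z.1, y)) z.2)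
          + c * v z.1 z.2 ^ p * φ z) = 0)
    (ha : t₀ < a) (hθ : ContDiff ℝ ∞ θ) (hθc : HasCompactSupport θ)
    (hθs : tsupport θ ⊆ Ioo a b) {ψ : Eucl N → ℝ} (hψ : IsTestFunction Ω ψ) :
    Integrable (fun t => (deriv θ t + c * θ t) * (∫ x in Ω, v t x ^ p * ψ x)
      - θ t * ∫ x in Ω, inner ℝ (G t x) (gradient ψ x)) (volume.restrict (Ioo a b)) ∧
    ∫ t in Ioo a b, ((deriv θ t + c * θ t) * (∫ x in Ω, v t x ^ p * ψ x)
      - θ t * ∫ x in Ω, inner ℝ (G t x) (gradient ψ x)) = 0 := by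
  have := isFiniteMeasure_restrict hΩ
  have hθ' : Continuous (deriv θ) := hθ.continuous_deriv (by simp)
  have i1 := integrable_prod_rpow_mul (b := b) hΩ hΩo hp hV hm hrel hδ0 hδ ht₀ ha
    (g := fun t => deriv θ t + c * θ t) (hθ'.add (continuous_const.mul hθ.continuous))
    (hθc.deriv.add hθc.mul_left) hψ
  have i2 := integrable_prod_mul_inner_gradient hΩ hG hθ.continuous hθc hψ
  have j1 := i1.integral_prod_left
  have j2 := i2.integral_prod_left
  simp only [integral_const_mul] at j1 j2
  refine ⟨j1.sub j2, ?_⟩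
  rw [integral_sub j1 j2]
  have e1 := integral_prod _ i1
  have e2 := integral_prod _ i2
  simp only [integral_const_mul] at e1 e2
  rw [← e1, ← e2, ← integral_sub i1 i2, Measure.prod_restrict, ← Measure.volume_eq_prod]
  have h0 := hweak _ (isSpaceTimeTestFunction_mul hθ ((subset_tsupport θ).trans hθs)
    (ht₀.trans ha) hψ)
  rw [← h0]
  have hsub : Ioo a b ×ˢ Ω ⊆ Ioi (0 : ℝ) ×ˢ Ω :=
    prod_mono (fun x hx => (ht₀.trans ha).trans hx.1) subset_rfl
  have hgrad : ∀ t x, gradient (fun y => θ t * ψ y) x = θ t • gradient ψ x := fun t x =>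
    gradient_const_smul_apply hψ.differentiable (θ t) x
  have hder : ∀ t x, deriv (fun s => θ s * ψ x) t = deriv θ t * ψ x := fun t x =>
    deriv_mul_const ((hθ.differentiable (by simp)) t) _
  rw [← setIntegral_eq_of_subset_of_forall_sdiff_eq_zero
    (measurableSet_Ioi.prod hΩo.measurableSet) hsub]
  · refine integral_congr_ae (Eventually.of_forall fun z => ?_)
    simp only [hgrad, hder, real_inner_smul_right]
    ring
  · intro z hz
    have hz1 : z.1 ∉ tsupport θ := fun h => hz.2 ⟨hθs h, hz.1.2⟩
    have hz2 : deriv θ z.1 = 0 := by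
      by_contra hne
      exact hz1 (support_deriv_subset hne)
    simp only [hz2, image_eq_zero_of_notMem_tsupport hz1]
    simp

end WeakFormulation

/-! ### Testing with solutions of the Dirichlet problem -/

section EvolutionEquation

open scoped ENNReal

variable {N : ℕ} {Ω : Set (Eucl N)} {p c δ t₀ t₁ a b : ℝ} {V : Eucl N → ℝ}
  {v : ℝ → Eucl N → ℝ} {G : ℝ → Eucl N → Eucl N} {θ : ℝ → ℝ}

theorem weightedPotential_toLp_eq_linClass (hN : 1 ≤ N) (hΩ : Bornology.IsBounded Ω)
    (hΩm : MeasurableSet Ω) (hp : 1 < p) (hV : IsPositiveStationarySolution Ω p c V)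
    (hw : MemLp (fun x => sqrtWeight p (V x)) ⊤ (volume.restrict Ω))
    {u : Eucl N → ℝ} {g : Eucl N → Eucl N} (h : MemH10 Ω u g) (hu : IsNear Ω V u) :
    weightedPotential hw (.mk _ h.toLp_mem) = linClass Ω p V u := by
  have h1 : weightedPotential hw (.mk _ h.toLp_mem) = mulLp hw (h.1.toLp u) := by
    rw [← h.potential_toLp hN hΩ]
    rfl
  rw [h1]
  refine Lp.ext ?_
  filter_upwards [coeFn_mulLp hw (h.1.toLp u), h.1.coeFn_toLp,
    coeFn_l2Class (hu.memLp_lin hp hΩ hΩm hV)] with x h2 h3 h4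
  rw [h2, h3, linClass, h4]

theorem inner_adjoint_powClass_testGrad (hN : 1 ≤ N) (hΩ : Bornology.IsBounded Ω)
    (hΩm : MeasurableSet Ω) (hp : 1 < p) (hV : IsPositiveStationarySolution Ω p c V)
    (hw : MemLp (fun x => sqrtWeight p (V x)) ⊤ (volume.restrict Ω))
    {u : Eucl N → ℝ} (hu : IsNear Ω V u) (ψ : testSpace Ω) :
    inner ℝ (ContinuousLinearMap.adjoint (weightedPotential hw) (powClass Ω p V u))
      (testGrad Ω ψ) = ∫ x in Ω, u x ^ p * ψ.1 x := by
  rw [inner_adjoint_testGrad hN hΩ]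
  refine integral_congr_ae ?_
  filter_upwards [coeFn_l2Class (hu.memLp_pow hp hΩ hΩm hV), ae_restrict_mem hΩm] with x h1 h2
  have h3 := (sqrtWeight_pos (p := p) (hV.pos x h2)).ne'
  rw [powClass, h1, ← mul_assoc, div_mul_cancel₀ _ h3]

theorem exists_seq_tendsto_testGrad (y : GradSpace Ω) :
    ∃ ψ : ℕ → testSpace Ω, Tendsto (fun n => testGrad Ω (ψ n)) atTop (𝓝 y) := by
  obtain ⟨y', hy'1, hy'2⟩ := mem_closure_iff_seq_limit.mp (denseRange_testGrad y)
  choose ψ hψ using hy'1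
  exact ⟨ψ, by simpa only [hψ] using hy'2⟩

/-- The right-hand side, unlike the norm, is visibly an integrable function of time when the
gradient is square integrable in space-time. -/
theorem norm_toLp_le {g : Eucl N → Eucl N} (hg : MemLp g 2 (volume.restrict Ω)) :
    ‖hg.toLp g‖ ≤ 1 + ∫ x in Ω, ‖g x‖ ^ 2 := by
  have h1 : ‖hg.toLp g‖ ^ 2 = ∫ x in Ω, ‖g x‖ ^ 2 := by
    rw [norm_sq_eq_integral_norm_sq]
    refine integral_congr_ae ?_
    filter_upwards [hg.coeFn_toLp] with x hx
    rw [hx]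
  rw [← h1]
  nlinarith [sq_nonneg (‖hg.toLp g‖ - 1 / 2)]

/-- Dominated convergence carries the weak equation from test functions z_n to their limit y in the
gradient norm, as both terms are values of one functional X(t) with integrable norm bound. -/
theorem integral_eq_zero_of_tendsto_inner {Y : Type*} [NormedAddCommGroup Y]
    [InnerProductSpace ℝ Y] {α : Type*} [MeasurableSpace α] {μ : Measure α} {f β : α → ℝ}
    {F : ℕ → α → ℝ} {y : Y} {z : ℕ → Y} (hz : Tendsto z atTop (𝓝 y)) (hβ : Integrable β μ)
    (hF : ∀ n, Integrable (F n) μ ∧ ∫ t, F n t ∂μ = 0)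
    (hX : ∀ᵐ t ∂μ, ∃ X : Y, ‖X‖ ≤ β t ∧ (∀ n, F n t = inner ℝ X (z n)) ∧ f t = inner ℝ X y) :
    ∫ t, f t ∂μ = 0 := by
  obtain ⟨D, hD⟩ := hz.norm.bddAbove_range
  have hD' : ∀ n, ‖z n‖ ≤ D := fun n => hD ⟨n, rfl⟩
  refine tendsto_nhds_unique (tendsto_integral_of_dominated_convergence (fun t => β t * D)
    (fun n => (hF n).1.1) (hβ.mul_const D) (fun n => ?_) ?_)
    ((tendsto_const_nhds (x := (0 : ℝ))).congr fun n => (hF n).2.symm)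
  · filter_upwards [hX] with t ⟨X, h1, h2, _⟩
    rw [h2 n]
    exact (norm_inner_le_norm (𝕜 := ℝ) X (z n)).trans
      (mul_le_mul h1 (hD' n) (norm_nonneg _) ((norm_nonneg _).trans h1))
  · filter_upwards [hX] with t ⟨X, _, h2, h3⟩
    rw [h3]
    simp only [h2]
    exact tendsto_const_nhds.inner hz

theorem exists_inner_eq_sub {Y : Type*} [NormedAddCommGroup Y] [InnerProductSpace ℝ Y]
    (x y : Y) (A B : ℝ) : ∃ X : Y, ‖X‖ ≤ |A| * ‖x‖ + |B| * ‖y‖ ∧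
      ∀ z, inner ℝ X z = A * inner ℝ x z - B * inner ℝ y z :=
  ⟨A • x - B • y, (norm_sub_le _ _).trans (by simp [norm_smul]), fun z => by
    rw [inner_sub_left, real_inner_smul_left, real_inner_smul_left]⟩

/-- Both terms of the weak equation at a fixed time are represented by one vector X. On test
gradients it gives the original integrals; on the adjoint image of x it gives pairings of x with T X
and Y of the flow. -/
theorem exists_inner_testGrad_eq (hN : 1 ≤ N) (hΩ : Bornology.IsBounded Ω)
    (hΩm : MeasurableSet Ω) (hp : 1 < p) (hV : IsPositiveStationarySolution Ω p c V)
    (hw : MemLp (fun x => sqrtWeight p (V x)) ⊤ (volume.restrict Ω))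
    {u : Eucl N → ℝ} {g : Eucl N → Eucl N} (h : MemH10 Ω u g) (hu : IsNear Ω V u) (A B : ℝ) :
    ∃ X : GradSpace Ω,
      ‖X‖ ≤ |A| * ‖ContinuousLinearMap.adjoint (weightedPotential hw) (powClass Ω p V u)‖ +
        |B| * (1 + ∫ x in Ω, ‖g x‖ ^ 2) ∧
      (∀ ψ : testSpace Ω, A * (∫ x in Ω, u x ^ p * ψ.1 x) -
        B * ∫ x in Ω, inner ℝ (g x) (gradient ψ.1 x) = inner ℝ X (testGrad Ω ψ)) ∧
      ∀ x, A * inner ℝ x (weightedInverse hw (powClass Ω p V u)) -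
        B * inner ℝ x (linClass Ω p V u) =
          inner ℝ X (ContinuousLinearMap.adjoint (weightedPotential hw) x) := by
  obtain ⟨X, hX1, hX2⟩ := exists_inner_eq_sub
    (ContinuousLinearMap.adjoint (weightedPotential hw) (powClass Ω p V u))
    (GradSpace.mk _ h.toLp_mem) A B
  refine ⟨X, hX1.trans (add_le_add_right (mul_le_mul_of_nonneg_left (norm_toLp_le h.2.1)
    (abs_nonneg B)) _), fun ψ => ?_, fun x => ?_⟩
  · rw [hX2, inner_adjoint_powClass_testGrad hN hΩ hΩm hp hV hw hu, inner_toLp_testGrad]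
  · have e1 : inner ℝ x (weightedInverse hw (powClass Ω p V u)) = inner ℝ
        (ContinuousLinearMap.adjoint (weightedPotential hw) (powClass Ω p V u))
        (ContinuousLinearMap.adjoint (weightedPotential hw) x) :=
      (real_inner_comm _ _).trans (inner_weightedInverse hw _ _)
    have e2 : inner ℝ x (linClass Ω p V u) = inner ℝ
        (GradSpace.mk _ h.toLp_mem)
        (ContinuousLinearMap.adjoint (weightedPotential hw) x) := by
      rw [← weightedPotential_toLp_eq_linClass hN hΩ hΩm hp hV hw h hu]
      exact (real_inner_comm _ _).trans
        (ContinuousLinearMap.adjoint_inner_right (weightedPotential hw) _ x).symm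
    exact (congrArg₂ (fun r s => A * r - B * s) e1 e2).trans (hX2 _).symm

/-- The weak formulation tested with the solution of the Dirichlet problem with datum `x`. -/
theorem integral_deriv_mul_inner_eq_zero (hN : 1 ≤ N) (hΩ : Bornology.IsBounded Ω)
    (hΩo : IsOpen Ω) (hp : 1 < p) (hV : IsPositiveStationarySolution Ω p c V)
    (hw : MemLp (fun x => sqrtWeight p (V x)) ⊤ (volume.restrict Ω))
    (hm : AEStronglyMeasurable (fun z : ℝ × Eucl N => v z.1 z.2)
      (volume.restrict (Ioi (0 : ℝ) ×ˢ Ω)))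
    (hrel : RelativeErrorCondition Ω V v δ t₀) (hδ0 : 0 < δ) (hδ : δ < 1) (ht₀ : 0 < t₀)
    (hGH : ∀ᵐ t ∂(volume.restrict (Ioi (0 : ℝ))), MemH10 Ω (v t) (G t))
    (hG : MemLp (fun z : ℝ × Eucl N => G z.1 z.2) 2 (volume.restrict (Ioo a b ×ˢ Ω)))
    (hweak : ∀ φ : ℝ × Eucl N → ℝ, IsSpaceTimeTestFunction Ω φ →
      ∫ z in Ioi (0 : ℝ) ×ˢ Ω,
        (v z.1 z.2 ^ p * deriv (fun s => φ (s, z.2)) z.1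
          - inner ℝ (G z.1 z.2) (gradient (fun y => φ (z.1, y)) z.2)
          + c * v z.1 z.2 ^ p * φ z) = 0)
    (ha : t₀ < a) (hnear : ∀ t, a < t → IsNear Ω V (v t))
    (hθ : ContDiff ℝ ∞ θ) (hθc : HasCompactSupport θ)
    (hθs : tsupport θ ⊆ Ioo a b) (x : Lp ℝ 2 (volume.restrict Ω)) :
    ∫ t in Ioo a b, ((deriv θ t + c * θ t) * inner ℝ x (weightedInverse hw (powClass Ω p V (v t)))
      - θ t * inner ℝ x (linClass Ω p V (v t))) = 0 := by
  have := isFiniteMeasure_restrict hΩ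
  obtain ⟨ψ, hψ⟩ := exists_seq_tendsto_testGrad
    (ContinuousLinearMap.adjoint (weightedPotential hw) x)
  obtain ⟨M, hM⟩ := exists_norm_powClass_le hp hΩ hΩo.measurableSet hV
  have hθ' : Continuous (deriv θ) := hθ.continuous_deriv (by simp)
  obtain ⟨C₁, hC₁⟩ := (hθc.deriv.add hθc.mul_left).exists_bound_of_continuous
    (f := fun t => deriv θ t + c * θ t) (hθ'.add (continuous_const.mul hθ.continuous))
  obtain ⟨C₂, hC₂⟩ := hθc.exists_bound_of_continuous hθ.continuous
  have hC₁0 : 0 ≤ C₁ := (norm_nonneg _).trans (hC₁ 0)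
  have hGsq : Integrable (fun t => ∫ x in Ω, ‖G t x‖ ^ 2) (volume.restrict (Ioo a b)) := by
    have hG' := hG
    rw [Measure.volume_eq_prod, ← Measure.prod_restrict] at hG'
    exact (hG'.integrable_norm_pow two_ne_zero).integral_prod_left
  have hGH' : ∀ᵐ t ∂(volume.restrict (Ioo a b)), MemH10 Ω (v t) (G t) :=
    ae_restrict_of_ae_restrict_of_subset (fun t ht => (ht₀.trans ha).trans ht.1) hGH
  refine integral_eq_zero_of_tendsto_inner (Y := GradSpace Ω) hψ
    (β := fun t => C₁ * (‖ContinuousLinearMap.adjoint (weightedPotential hw)‖ * M) +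
      C₂ * (1 + ∫ x in Ω, ‖G t x‖ ^ 2))
    ((integrable_const _).add (((integrable_const _).add hGsq).const_mul C₂))
    (fun n => integral_separated_test_eq_zero hΩ hΩo hp hV hm hrel hδ0 hδ ht₀ hG hweak
      ha hθ hθc hθs (ψ n).2) ?_
  filter_upwards [hGH', ae_restrict_mem measurableSet_Ioo] with t h1 h2
  obtain ⟨X, hX1, hX2, hX3⟩ := exists_inner_testGrad_eq hN hΩ hΩo.measurableSet hp hV hw h1
    (hnear t h2.1) (deriv θ t + c * θ t) (θ t)
  refine ⟨X, hX1.trans (add_le_add ?_ ?_), fun n => hX2 (ψ n), hX3 x⟩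
  · exact mul_le_mul (hC₁ t) ((ContinuousLinearMap.le_opNorm _ _).trans
      (mul_le_mul_of_nonneg_left (hM _ (hnear t h2.1)) (ContinuousLinearMap.opNorm_nonneg _)))
      (norm_nonneg _) hC₁0
  · exact mul_le_mul_of_nonneg_right (hC₂ t) (by positivity)

end EvolutionEquation

/-! ### Convergence and regularity in time -/

section Convergence

open scoped ENNReal

variable {N : ℕ} {Ω : Set (Eucl N)} {p c T δ t₀ t₁ η κ : ℝ} {V u₀ : Eucl N → ℝ}
  {v : ℝ → Eucl N → ℝ}

theorem ae_abs_le_of_eLpNorm_top_le {α : Type*} [MeasurableSpace α] {μ : Measure α} {f : α → ℝ}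
    {C : ℝ} (hC : 0 ≤ C) (h : eLpNorm f ⊤ μ ≤ ENNReal.ofReal C) : ∀ᵐ x ∂μ, |f x| ≤ C := by
  rw [eLpNorm_exponent_top] at h
  filter_upwards [ae_le_eLpNormEssSup (f := f) (μ := μ)] with x hx
  have := hx.trans h
  rwa [Real.enorm_eq_ofReal_abs, ENNReal.ofReal_le_ofReal_iff hC] at this

theorem tendsto_of_norm_sub_sq_le {H ι : Type*} [NormedAddCommGroup H] {l : Filter ι} {f : ι → H}
    {a : H} {g : ι → ℝ} (hg : Tendsto g l (𝓝 0)) (h : ∀ᶠ i in l, ‖f i - a‖ ^ 2 ≤ g i) :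
    Tendsto f l (𝓝 a) := by
  rw [tendsto_iff_norm_sub_tendsto_zero]
  have h1 := (Real.continuous_sqrt.tendsto 0).comp hg
  rw [Real.sqrt_zero] at h1
  refine squeeze_zero' (Eventually.of_forall fun i => norm_nonneg _) ?_ h1
  filter_upwards [h] with i hi
  exact Real.le_sqrt_of_sq_le hi

theorem entropyDensity_nonneg (hp : 1 < p) {V v : ℝ} (hV : 0 < V) (hv : 0 ≤ v) :
    0 ≤ entropyDensity p V v := by
  have h := entropyDensity_sub_le hp hV hV.le hv
  have h0 : entropyDensity p V V = 0 := by simp [entropyDensity]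
  rw [h0, sub_self, mul_zero, zero_mul, mul_zero] at h
  linarith

theorem entropy_nonneg (hp : 1 < p) (hΩm : MeasurableSet Ω) {w : Eucl N → ℝ}
    (hV : IsPositiveStationarySolution Ω p c V)
    (hw : ∀ᵐ x ∂(volume.restrict Ω), 0 ≤ w x) : 0 ≤ entropy Ω p V w := by
  refine integral_nonneg_of_ae ?_
  filter_upwards [hw, ae_restrict_mem hΩm] with x h1 h2
  exact entropyDensity_nonneg hp (hV.pos x h2) h1

/-- A crude bound that does not presuppose relative closeness: the tangent inequality at v gives (v
- V)(v^p - V^p), and v ≤ 1 + v^p bounds the first factor. -/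
theorem entropyDensity_le_of_abs_rpow_sub_le (hp : 1 < p) {V v B ε : ℝ} (hV : 0 < V)
    (hVB : V ≤ B) (hv : 0 ≤ v) (hε : |v ^ p - V ^ p| ≤ ε) (hε1 : ε ≤ 1) :
    entropyDensity p V v ≤ (p + 1) / p * (2 + B ^ p + B) * ε := by
  have h := entropyDensity_sub_le hp hV hv hV.le
  have h0 : entropyDensity p V V = 0 := by simp [entropyDensity]
  have hs := (sqrtWeight_pos (p := p) hV).ne'
  have h1 : sqrtWeight p V * (v - V) * ((v ^ p - V ^ p) / sqrtWeight p V -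
      (V ^ p - V ^ p) / sqrtWeight p V) = (v - V) * (v ^ p - V ^ p) := by
    field_simp; ring
  rw [h0, sub_zero, h1] at h
  refine h.trans ?_
  rw [mul_assoc]
  refine mul_le_mul_of_nonneg_left ?_ (by positivity)
  have h2 : V ^ p ≤ B ^ p := Real.rpow_le_rpow hV.le hVB (by linarith)
  have h3 : v ≤ 1 + v ^ p := by
    rcases le_total v 1 with h | h
    · linarith [Real.rpow_nonneg hv p]
    · linarith [Real.self_le_rpow_of_one_le h hp.le]
  have h4 : |v - V| ≤ 2 + B ^ p + B := by
    rw [abs_le] at hε ⊢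
    have := Real.rpow_nonneg hV.le p
    constructor <;> linarith [hε.1, hε.2]
  calc (v - V) * (v ^ p - V ^ p) ≤ |v - V| * |v ^ p - V ^ p| := by
        rw [← abs_mul]; exact le_abs_self _
    _ ≤ _ := mul_le_mul h4 hε (abs_nonneg _) ((abs_nonneg _).trans h4)

theorem eventually_ae_abs_rpow_sub_le
    (hlim : Tendsto (fun t : ℝ => eLpNorm (fun x => v t x ^ p - V x ^ p) ⊤ (volume.restrict Ω))
      atTop (𝓝 0)) :
    ∃ ε : ℝ → ℝ, Tendsto ε atTop (𝓝 0) ∧ ∀ᶠ t in atTop, 0 ≤ ε t ∧ ε t ≤ 1 ∧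
      ∀ᵐ x ∂(volume.restrict Ω), |v t x ^ p - V x ^ p| ≤ ε t := by
  refine ⟨fun t => (eLpNorm (fun x => v t x ^ p - V x ^ p) ⊤ (volume.restrict Ω)).toReal, ?_, ?_⟩
  · have h := (ENNReal.tendsto_toReal ENNReal.zero_ne_top).comp hlim
    rwa [ENNReal.toReal_zero] at h
  · filter_upwards [hlim.eventually_lt_const zero_lt_one] with t ht
    refine ⟨ENNReal.toReal_nonneg, ENNReal.toReal_mono ENNReal.one_ne_top ht.le, ?_⟩
    refine ae_abs_le_of_eLpNorm_top_le ENNReal.toReal_nonneg ?_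
    rw [ENNReal.ofReal_toReal ht.ne_top]

theorem tendsto_entropy_zero (hp : 1 < p) (hΩ : Bornology.IsBounded Ω) (hΩm : MeasurableSet Ω)
    (hV : IsPositiveStationarySolution Ω p c V)
    (hnn : ∀ t, 0 ≤ t → ∀ᵐ x ∂(volume.restrict Ω), 0 ≤ v t x)
    (hlim : Tendsto (fun t : ℝ => eLpNorm (fun x => v t x ^ p - V x ^ p) ⊤ (volume.restrict Ω))
      atTop (𝓝 0)) :
    Tendsto (fun t => entropy Ω p V (v t)) atTop (𝓝 0) := by
  have := isFiniteMeasure_restrict hΩ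
  obtain ⟨B, hB0, hB⟩ := hV.exists_le hΩ
  obtain ⟨ε, hε0, hε⟩ := eventually_ae_abs_rpow_sub_le hlim
  have h1 := (hε0.const_mul ((p + 1) / p * (2 + B ^ p + B))).mul_const
    ((volume.restrict Ω).real univ)
  rw [mul_zero, zero_mul] at h1
  refine squeeze_zero_norm' ?_ h1
  filter_upwards [hε, eventually_ge_atTop 0] with t ⟨_, h3, h4⟩ h5
  refine norm_integral_le_of_norm_le_const ?_
  filter_upwards [h4, hnn t h5, ae_restrict_mem hΩm] with x h6 h7 h8
  have h9 : 0 ≤ entropyDensity p (V x) (v t x) := entropyDensity_nonneg hp (hV.pos x h8) h7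
  exact (Real.norm_of_nonneg h9).trans_le
    (entropyDensity_le_of_abs_rpow_sub_le hp (hV.pos x h8) (hB x h8) h7 h6 h3)

theorem tendsto_integral_abs_rpow_sub (hΩ : Bornology.IsBounded Ω)
    (hlim : Tendsto (fun t : ℝ => eLpNorm (fun x => v t x ^ p - V x ^ p) ⊤ (volume.restrict Ω))
      atTop (𝓝 0)) :
    Tendsto (fun t => ∫ x in Ω, |v t x ^ p - V x ^ p|) atTop (𝓝 0) := by
  have := isFiniteMeasure_restrict hΩ
  obtain ⟨ε, hε0, hε⟩ := eventually_ae_abs_rpow_sub_le hlim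
  have h1 := hε0.mul_const ((volume.restrict Ω).real univ)
  rw [zero_mul] at h1
  refine squeeze_zero_norm' ?_ h1
  filter_upwards [hε] with t ⟨_, _, h4⟩
  refine norm_integral_le_of_norm_le_const ?_
  filter_upwards [h4] with x h6
  rwa [Real.norm_eq_abs, abs_abs]

theorem ae_abs_sub_le_mul_of_eLpNorm_le (hΩm : MeasurableSet Ω) {w : Eucl N → ℝ} {θ : ℝ}
    (hV : IsPositiveStationarySolution Ω p c V) (hθ : 0 ≤ θ)
    (h : eLpNorm (fun x => (w x - V x) / V x) ⊤ (volume.restrict Ω) ≤ ENNReal.ofReal θ) :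
    ∀ᵐ x ∂(volume.restrict Ω), |w x - V x| ≤ θ * V x := by
  filter_upwards [ae_abs_le_of_eLpNorm_top_le hθ h, ae_restrict_mem hΩm] with x h1 h2
  rwa [abs_div, abs_of_pos (hV.pos x h2), div_le_iff₀ (hV.pos x h2)] at h1

theorem aemeasurable_of_integrableOn_rpow (hp : 0 < p) {w : Eucl N → ℝ}
    (hw : ∀ᵐ x ∂(volume.restrict Ω), 0 ≤ w x) (hi : IntegrableOn (fun x => w x ^ p) Ω) :
    AEMeasurable w (volume.restrict Ω) := by
  refine (hi.aemeasurable.pow_const p⁻¹).congr ?_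
  filter_upwards [hw] with x hx
  exact Real.rpow_rpow_inv hx hp.ne'

/-- The entropy tends to 0 by uniform convergence of v^p, so the assumed bound forces a relative
error below 1/4. It holds at every late time, not merely at almost every one. -/
theorem exists_forall_isNear (hp : 1 < p) (hΩ : Bornology.IsBounded Ω) (hΩm : MeasurableSet Ω)
    (hV : IsPositiveStationarySolution Ω p c V) (hv : IsRCDPSolution Ω p T u₀ v)
    (hlim : Tendsto (fun t : ℝ => eLpNorm (fun x => v t x ^ p - V x ^ p) ⊤ (volume.restrict Ω))
      atTop (𝓝 0)) (hη : 0 < η) (ht₀ : 1 ≤ t₀) (hκ : 0 ≤ κ)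
    (h : ∀ t, t₀ ≤ t → eLpNorm (fun x => (v t x - V x) / V x) ⊤ (volume.restrict Ω)
      ≤ ENNReal.ofReal (κ * entropy Ω p V (v (t - 1)) ^ η)) :
    ∃ t₁, t₀ ≤ t₁ ∧ ∀ t, t₁ < t → IsNear Ω V (v t) ∧ ∀ᵐ x ∂(volume.restrict Ω),
      |v t x - V x| ≤ κ * entropy Ω p V (v (t - 1)) ^ η * V x := by
  have h1 : Tendsto (fun t : ℝ => entropy Ω p V (v (t - 1))) atTop (𝓝 0) :=
    (tendsto_entropy_zero hp hΩ hΩm hV hv.nonneg hlim).comp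
      (tendsto_atTop_add_const_right _ (-1) tendsto_id)
  have h2 := (h1.rpow_const (p := η) (Or.inr hη.le)).const_mul κ
  rw [Real.zero_rpow hη.ne', mul_zero] at h2
  obtain ⟨s, hs⟩ := eventually_atTop.mp (h2.eventually_le_const (show (0 : ℝ) < 1 / 4 by norm_num))
  refine ⟨max t₀ s, le_max_left _ _, fun t ht => ?_⟩
  have ht0 : t₀ ≤ t := (le_max_left _ _).trans ht.le
  have hθ : 0 ≤ κ * entropy Ω p V (v (t - 1)) ^ η := mul_nonneg hκ
    (Real.rpow_nonneg (entropy_nonneg hp hΩm hV (hv.nonneg _ (by linarith))) _)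
  have h3 := ae_abs_sub_le_mul_of_eLpNorm_le hΩm hV hθ (h t ht0)
  refine ⟨⟨aemeasurable_of_integrableOn_rpow (by linarith) (hv.nonneg t (by linarith))
    (hv.integrable t (by linarith)), ?_⟩, h3⟩
  filter_upwards [h3, ae_restrict_mem hΩm] with x h4 h5
  exact h4.trans (mul_le_mul_of_nonneg_right (hs t ((le_max_right _ _).trans ht.le))
    (hV.pos x h5).le)

theorem continuousOn_powClass_linClass (hp : 1 < p) (hΩ : Bornology.IsBounded Ω)
    (hΩm : MeasurableSet Ω) (hV : IsPositiveStationarySolution Ω p c V)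
    (hv : IsRCDPSolution Ω p T u₀ v) (ht₁ : 0 ≤ t₁) (hnear : ∀ t, t₁ < t → IsNear Ω V (v t)) :
    ContinuousOn (fun t => powClass Ω p V (v t)) (Ioi t₁) ∧
    ContinuousOn (fun t => linClass Ω p V (v t)) (Ioi t₁) := by
  obtain ⟨C, hC0, hC⟩ := exists_norm_sq_class_sub_le hp hΩ hΩm hV
  have hg : ∀ s ∈ Ioi t₁, Tendsto (fun t => C * ∫ x in Ω, |v t x ^ p - v s x ^ p|)
      (𝓝[Ioi t₁] s) (𝓝 0) := fun s hs => by
    have h1 := (hv.continuous_L1 s (ht₁.trans (le_of_lt hs))).mono_left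
      (nhdsWithin_mono s (fun t ht => ht₁.trans (le_of_lt ht) : Ioi t₁ ⊆ Ici 0))
    simpa using h1.const_mul C
  have hbd : ∀ s ∈ Ioi t₁, ∀ t ∈ Ioi t₁, _ := fun s hs t ht =>
    hC (v t) (v s) (hnear t ht) (hnear s hs) (hv.integrable t (ht₁.trans (le_of_lt ht)))
      (hv.integrable s (ht₁.trans (le_of_lt hs)))
  constructor
  · exact fun s hs => tendsto_of_norm_sub_sq_le (hg s hs)
      (eventually_mem_nhdsWithin.mono fun t ht => (hbd s hs t ht).1)
  · exact fun s hs => tendsto_of_norm_sub_sq_le (hg s hs)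
      (eventually_mem_nhdsWithin.mono fun t ht => (hbd s hs t ht).2)

theorem tendsto_powClass_linClass (hp : 1 < p) (hΩ : Bornology.IsBounded Ω)
    (hΩm : MeasurableSet Ω) (hV : IsPositiveStationarySolution Ω p c V)
    (hv : IsRCDPSolution Ω p T u₀ v) (ht₁ : 0 ≤ t₁) (hnear : ∀ t, t₁ < t → IsNear Ω V (v t))
    (hlim : Tendsto (fun t : ℝ => eLpNorm (fun x => v t x ^ p - V x ^ p) ⊤ (volume.restrict Ω))
      atTop (𝓝 0)) :
    Tendsto (fun t => powClass Ω p V (v t)) atTop (𝓝 (powClass Ω p V V)) ∧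
    Tendsto (fun t => linClass Ω p V (v t)) atTop (𝓝 (linClass Ω p V V)) := by
  have := isFiniteMeasure_restrict hΩ
  obtain ⟨C, hC0, hC⟩ := exists_norm_sq_class_sub_le hp hΩ hΩm hV
  obtain ⟨B, hB0, hB⟩ := hV.exists_le hΩ
  have hVi : IntegrableOn (fun x => V x ^ p) Ω := by
    refine Integrable.of_bound ((hV.aemeasurable hΩm).pow_const p).aestronglyMeasurable (B ^ p) ?_
    filter_upwards [ae_restrict_mem hΩm] with x hx
    rw [Real.norm_of_nonneg (Real.rpow_nonneg (hV.pos x hx).le _)]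
    exact Real.rpow_le_rpow (hV.pos x hx).le (hB x hx) (by linarith)
  have hg := (tendsto_integral_abs_rpow_sub hΩ hlim).const_mul C
  rw [mul_zero] at hg
  have hbd : ∀ t ∈ Ioi t₁, _ := fun t ht =>
    hC (v t) V (hnear t ht) (hV.isNear hΩm) (hv.integrable t (ht₁.trans (le_of_lt ht))) hVi
  constructor
  · exact tendsto_of_norm_sub_sq_le hg ((eventually_gt_atTop t₁).mono fun t ht => (hbd t ht).1)
  · exact tendsto_of_norm_sub_sq_le hg ((eventually_gt_atTop t₁).mono fun t ht => (hbd t ht).2)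

end Convergence

/-! ### Weak flows in a Hilbert space -/

section WeakFlow

variable {H : Type*} [NormedAddCommGroup H] [InnerProductSpace ℝ H] [CompleteSpace H]
  {T : H →L[ℝ] H} {c t₁ : ℝ} {X Y : ℝ → H} {X₀ Y₀ : H}

theorem hasDerivAt_of_weak_flow (hX : ContinuousOn X (Ioi t₁)) (hY : ContinuousOn Y (Ioi t₁))
    (hweak : ∀ (x : H) (θ : ℝ → ℝ) (a b : ℝ), t₁ < a → a < b → ContDiff ℝ ∞ θ →
      HasCompactSupport θ → tsupport θ ⊆ Ioo a b →
      ∫ t in Ioo a b, ((deriv θ t + c * θ t) * inner ℝ x (T (X t)) - θ t * inner ℝ x (Y t)) = 0)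
    {t : ℝ} (ht : t₁ < t) : HasDerivAt (fun t => T (X t)) (c • T (X t) - Y t) t := by
  have hT : ContinuousOn (fun t => T (X t)) (Ioi t₁) := T.continuous.comp_continuousOn hX
  have hQ : ContinuousOn (fun t => c • T (X t) - Y t) (Ioi t₁) := (hT.const_smul c).sub hY
  refine hasDerivAt_of_integral_deriv_mul_inner hT hQ (fun x θ a b ha hab hθ hθc hsub => ?_) ht
  rw [← hweak x θ a b ha hab hθ hθc hsub]
  refine integral_congr_ae (Eventually.of_forall fun t => ?_)
  simp only [inner_sub_right, real_inner_smul_right]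
  ring

/-- T X and its derivative both converge, so the limit of the derivative is 0. This supplies the
stationary equation in operator form without placing V in H¹₀(Ω). -/
theorem limit_eq_of_hasDerivAt
    (hder : ∀ t, t₁ < t → HasDerivAt (fun t => T (X t)) (c • T (X t) - Y t) t)
    (hX : Tendsto X atTop (𝓝 X₀)) (hY : Tendsto Y atTop (𝓝 Y₀)) : Y₀ = c • T X₀ := by
  have h3 : Tendsto (fun t => T (X t)) atTop (𝓝 (T X₀)) := (T.continuous.tendsto _).comp hX
  refine ext_inner_left ℝ fun x => ?_
  have h4 := eq_zero_of_tendsto_of_tendsto_deriv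
    (fun t ht => (hasDerivAt_const t x).inner ℝ (hder t ht))
    (tendsto_const_nhds.inner h3)
    (((tendsto_const_nhds (x := x)).inner ((h3.const_smul c).sub hY)).add
      ((tendsto_const_nhds (x := (0 : H))).inner h3))
  rw [inner_zero_left, add_zero, inner_sub_right, sub_eq_zero] at h4
  exact h4.symm

/-- Sharp decay of the entropy along a weak solution of `(T X)' = c T X - Y` that converges. -/
theorem exists_sharp_decay_of_weak_flow {P : H →L[ℝ] H} {e : ℝ → ℝ} {Λ p σ c₁ c₂ c₃ κ η : ℝ}
    (hT : T.IsSymmetric) (hTpos : ∀ x, 0 ≤ inner ℝ (T x) x)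
    (hP : P.IsSymmetric) (hPP : ∀ x, P (P x) = P x) (hTP : ∀ x, T (P x) = P (T x))
    (hc : 0 < c) (hp : 0 < p) (hΛ : c * p < Λ) (hσ : 0 < σ)
    (hhigh : ∀ x, Λ * inner ℝ (T (P x)) (P x) ≤ ‖P x‖ ^ 2)
    (hlow : ∀ x, (1 + σ) * ‖x - P x‖ ^ 2 ≤ c * p * inner ℝ (T (x - P x)) (x - P x))
    (hc₁ : 0 < c₁) (hc₂ : 0 < c₂) (hc₃ : 0 < c₃) (hκ : 0 ≤ κ) (hη : 0 < η)
    (hX : ContinuousOn X (Ioi t₁)) (hY : ContinuousOn Y (Ioi t₁))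
    (hX₀ : Tendsto X atTop (𝓝 X₀)) (hY₀ : Tendsto Y atTop (𝓝 Y₀))
    (hweak : ∀ (x : H) (θ : ℝ → ℝ) (a b : ℝ), t₁ < a → a < b → ContDiff ℝ ∞ θ →
      HasCompactSupport θ → tsupport θ ⊆ Ioo a b →
      ∫ t in Ioo a b, ((deriv θ t + c * θ t) * inner ℝ x (T (X t)) - θ t * inner ℝ x (Y t)) = 0)
    (hlo : ∀ t, t₁ < t → c₁ * ‖X t - X₀‖ ^ 2 ≤ e t)
    (hup : ∀ t, t₁ < t → e t ≤ c₂ * ‖X t - X₀‖ ^ 2)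
    (hconv : ∀ t τ, t₁ < t → t₁ < τ →
      e τ - e t ≤ c₃ * inner ℝ (Y τ - Y₀) ((X τ - X₀) - (X t - X₀)))
    (hFW : ∀ t, t₁ < t → ‖Y t - Y₀‖ ≤ ‖X t - X₀‖)
    (hR : ∀ t, t₁ < t →
      ‖(X t - X₀) - p • (Y t - Y₀)‖ ≤ κ * e (t - 1) ^ η * ‖X t - X₀‖)
    (hlim : Tendsto e atTop (𝓝 0)) :
    ∃ C t₂ : ℝ, 0 < C ∧ ∀ s t, t₂ ≤ s → s ≤ t →
      e t ≤ C * Real.exp (-(2 * (Λ - c * p) / p) * (t - s)) * e s := by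
  have hder := fun t (ht : t₁ < t) => hasDerivAt_of_weak_flow hX hY hweak ht
  have hstat := limit_eq_of_hasDerivAt hder hX₀ hY₀
  refine exists_sharp_decay (W := fun t => X t - X₀) (F := fun t => Y t - Y₀) (c₄ := 1)
    hT hTpos hP hPP hTP hc hp hΛ hσ hhigh hlow hc₁ hc₂ hc₃ zero_le_one hκ hη
    (hX.sub continuousOn_const) (hY.sub continuousOn_const) (fun t ht => ?_) hlo hup hconv
    (fun t ht => (hFW t ht).trans_eq (one_mul _).symm) hR hlim
  have h := (hder t ht).sub_const (T X₀)
  have h1 : -(Y t - Y₀) + c • T (X t - X₀) = c • T (X t) - Y t := by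
    rw [hstat, map_sub, smul_sub]
    abel
  rw [h1]
  simpa only [map_sub] using h

end WeakFlow

/-! ### Decay of the entropy and the final constant -/

section EntropyDecay

variable {N : ℕ} {Ω : Set (Eucl N)} {p T δ t₀ η κ : ℝ} {V u₀ : Eucl N → ℝ}
  {v : ℝ → Eucl N → ℝ}

theorem lambdaP_spec_of_isPositiveStationarySolution {c : ℝ} (hN : 1 ≤ N)
    (hΩ : Bornology.IsBounded Ω) (hΩo : IsOpen Ω) (hne : Ω.Nonempty) (hp : 1 < p) (hc : 0 < c)
    (hV : IsPositiveStationarySolution Ω p c V) (hnd : NondegeneracyCondition Ω p c V) :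
    0 < lambdaP Ω p c V ∧
      ∀ μ, IsWeightedEigenvalue Ω p V μ → μ < c * p ∨ c * p + lambdaP Ω p c V ≤ μ := by
  have hw := hV.memLp_sqrtWeight hp hΩ hΩo.measurableSet
  exact lambdaP_spec (by positivity) (finite_isWeightedEigenvalue_le hN hΩ hΩo hV.pos hw)
    (exists_isWeightedEigenvalue_gt hN hΩ hΩo hne hV.pos hw) hnd

theorem exists_entropy_decay (hN : 1 ≤ N) (hΩ : Bornology.IsBounded Ω) (hΩo : IsOpen Ω)
    (hne : Ω.Nonempty) (hp : 1 < p) (hc : 0 < rateConst p T)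
    (hV : IsPositiveStationarySolution Ω p (rateConst p T) V)
    (hv : IsRCDPSolution Ω p T u₀ v)
    (hlim : Tendsto (fun t : ℝ => eLpNorm (fun x => v t x ^ p - V x ^ p) ⊤ (volume.restrict Ω))
      atTop (𝓝 0))
    (hnd : NondegeneracyCondition Ω p (rateConst p T) V) (hδ0 : 0 < δ) (hδ : δ < 1)
    (ht₀ : 1 ≤ t₀) (hrel : RelativeErrorCondition Ω V v δ t₀) (hη : 0 < η) (hκ : 0 ≤ κ)
    (h : ∀ t, t₀ ≤ t → eLpNorm (fun x => (v t x - V x) / V x) ⊤ (volume.restrict Ω)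
      ≤ ENNReal.ofReal (κ * entropy Ω p V (v (t - 1)) ^ η)) :
    ∃ C t₂ : ℝ, 0 < C ∧ ∀ s t, t₂ ≤ s → s ≤ t → entropy Ω p V (v t) ≤
      C * Real.exp (-(2 * lambdaP Ω p (rateConst p T) V / p) * (t - s)) *
        entropy Ω p V (v s) := by
  have hΩm := hΩo.measurableSet
  have hw := hV.memLp_sqrtWeight hp hΩ hΩm
  have hp0 : 0 < p := by linarith
  obtain ⟨hlam, hgap⟩ := lambdaP_spec_of_isPositiveStationarySolution hN hΩ hΩo hne hp hc hV hnd
  obtain ⟨P, σ, hσ, hP, hPP, hTP, hhigh, hlow⟩ := exists_weighted_spectral_projection hN hΩ hΩo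
    hV.pos hw (mul_pos hc hp0) (lt_add_of_pos_right _ hlam) hgap
  obtain ⟨t₁, ht₁, hnear⟩ := exists_forall_isNear hp hΩ hΩm hV hv hlim hη ht₀ hκ h
  have hnear' := fun t (ht : t₁ < t) => (hnear t ht).1
  have ht₁0 : 0 ≤ t₁ := by linarith
  obtain ⟨hX, hY⟩ := continuousOn_powClass_linClass hp hΩ hΩm hV hv ht₁0 hnear'
  obtain ⟨hX₀, hY₀⟩ := tendsto_powClass_linClass hp hΩ hΩm hV hv ht₁0 hnear' hlim
  obtain ⟨c₁, c₂, hc₁, hc₂, hent⟩ := exists_entropy_bounds hp hΩ hΩm hV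
  obtain ⟨C, hC0, hC⟩ := exists_norm_linearization_error_le hp hΩ hΩm hV
  obtain ⟨G, -, hGH, hG, hweak⟩ := hv.weak
  have hdecay := exists_sharp_decay_of_weak_flow (T := weightedInverse hw) (P := P)
    (e := fun t => entropy Ω p V (v t)) (c₃ := (p + 1) / p) (κ := C * κ)
    (isSymmetric_weightedInverse hw)
    (fun x => (inner_weightedInverse hw x x).symm ▸ real_inner_self_nonneg)
    hP hPP hTP hc hp0 (lt_add_of_pos_right _ hlam) hσ hhigh hlow hc₁ hc₂ (by positivity)
    (mul_nonneg hC0 hκ) hη hX hY hX₀ hY₀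
    (fun x θ a b ha hab hθ hθc hsub => integral_deriv_mul_inner_eq_zero hN hΩ hΩo hp hV hw
      hv.measurable hrel hδ0 hδ (by linarith) hGH (hG a b (ht₁0.trans_lt ha) hab) hweak
      (ht₁.trans_lt ha) (fun t ht => hnear' t (ha.trans ht)) hθ hθc hsub x)
    (fun t ht => (hent _ (hnear' t ht)).2.1) (fun t ht => (hent _ (hnear' t ht)).2.2)
    (fun t τ ht hτ => entropy_sub_le hp hΩ hΩm hV (hnear' τ hτ) (hnear' t ht))
    (fun t ht => norm_linClass_sub_le hp hΩ hΩm hV (hnear' t ht))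
    (fun t ht => by
      rw [mul_assoc C]
      exact hC _ _ (hnear' t ht) (hnear t ht).2)
    (tendsto_entropy_zero hp hΩ hΩm hV hv.nonneg hlim)
  simpa only [add_sub_cancel_left] using hdecay

/-- The quadratic s² eventually exceeds r s + log C, for any C and r. -/
theorem exists_mul_exp_le_exp_sq {C r : ℝ} (hC : 0 < C) (hr : 0 ≤ r) (a : ℝ) :
    ∃ s, a ≤ s ∧ C * Real.exp (r * s) ≤ Real.exp (s ^ 2) := by
  refine ⟨max a (r + |Real.log C| + 1), le_max_left _ _, ?_⟩
  set s := max a (r + |Real.log C| + 1) with hs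
  have h1 : r + |Real.log C| + 1 ≤ s := le_max_right _ _
  have h2 := abs_nonneg (Real.log C)
  have h3 := le_abs_self (Real.log C)
  nth_rewrite 1 [← Real.exp_log hC]
  rw [← Real.exp_add, Real.exp_le_exp]
  nlinarith

end EntropyDecay

theorem mainTheorem4 (N : ℕ) (hN : 1 ≤ N) (p : ℝ) (hp : 1 < p)
    (hps : 2 < N → p < ((N : ℝ) + 2) / ((N : ℝ) - 2)) (η : ℝ) (hη : 0 < η) :
    ∃ K : ℝ → ℝ → ℝ, (∀ s e : ℝ, 0 < K s e) ∧
      ∀ (α : ℝ) (_ : 0 < α) (_ : α < 1)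
        (Ω : Set (Eucl N)) (_ : IsC2AlphaDomain Ω α)
        (T : ℝ) (_ : 0 < T)
        (u₀ : Eucl N → ℝ) (_ : InitialDatumCondition Ω (1 / p) u₀)
        (v : ℝ → Eucl N → ℝ) (_ : IsRCDPSolution Ω p T u₀ v)
        (V : Eucl N → ℝ) (_ : IsPositiveStationarySolution Ω p (rateConst p T) V)
        (_ : Tendsto
          (fun t : ℝ => eLpNorm (fun x => v t x ^ p - V x ^ p) ⊤ (volume.restrict Ω))
          atTop (𝓝 0))
        (_ : NondegeneracyCondition Ω p (rateConst p T) V)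
        (δ : ℝ) (_ : 0 < δ) (_ : δ < 1 / (2 * p))
        (t₀ : ℝ) (_ : 1 ≤ t₀) (_ : RelativeErrorCondition Ω V v δ t₀)
        (κ : ℝ) (_ : 0 < κ)
        (_ : ∀ t, t₀ ≤ t →
          eLpNorm (fun x => (v t x - V x) / V x) ⊤ (volume.restrict Ω)
            ≤ ENNReal.ofReal (κ * entropy Ω p V (v (t - 1)) ^ η)),
        0 < lambdaP Ω p (rateConst p T) V ∧
        ∃ T₀ : ℝ, t₀ ≤ T₀ ∧ ∀ t, T₀ ≤ t →
          entropy Ω p V (v t) ≤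
            K T₀ (entropy Ω p V (v T₀)) *
              Real.exp (-(2 * lambdaP Ω p (rateConst p T) V / p) * t) := by
  -- The constant is E(T₀) exp(T₀²), with 1 in place of a vanishing entropy to keep it positive. The
  -- factor C exp(r T₀), which involves κ, T, V and the spectrum, is dominated by exp(T₀²) once T₀
  -- is large, so these data enter only through the choice of T₀.
  refine ⟨fun s e => (if 0 < e then e else 1) * Real.exp (s ^ 2), fun s e => ?_, ?_⟩
  · refine mul_pos ?_ (Real.exp_pos _)
    split_ifs with h
    exacts [h, one_pos]
  intro α _ _ Ω hΩ T hT u₀ _ v hv V hV hlim hnd δ hδ0 hδ t₀ ht₀ hrel κ hκ h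
  have hp0 : 0 < p := by linarith
  have hc : 0 < rateConst p T := div_pos hp0 (mul_pos (by linarith) hT)
  have hδ1 : δ < 1 := hδ.trans ((div_lt_one (by linarith)).mpr (by linarith))
  have hlam := (lambdaP_spec_of_isPositiveStationarySolution hN hΩ.bounded hΩ.isOpen hΩ.nonempty
    hp hc hV hnd).1
  refine ⟨hlam, ?_⟩
  obtain ⟨C, t₂, hC, hdecay⟩ := exists_entropy_decay hN hΩ.bounded hΩ.isOpen hΩ.nonempty hp hc hV
    hv hlim hnd hδ0 hδ1 ht₀ hrel hη hκ.le h
  set r := 2 * lambdaP Ω p (rateConst p T) V / p with hr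
  have hr0 : 0 ≤ r := by positivity
  obtain ⟨s, hs, hCs⟩ := exists_mul_exp_le_exp_sq hC hr0 (max t₀ t₂)
  have hst₀ : t₀ ≤ s := (le_max_left _ _).trans hs
  refine ⟨s, hst₀, fun t ht => ?_⟩
  have he : 0 ≤ entropy Ω p V (v s) := entropy_nonneg hp hΩ.isOpen.measurableSet hV
    (hv.nonneg s (by linarith))
  have hle : entropy Ω p V (v s) ≤
      if 0 < entropy Ω p V (v s) then entropy Ω p V (v s) else 1 := by
    split_ifs with h0
    exacts [le_rfl, (not_lt.mp h0).trans zero_le_one]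
  calc entropy Ω p V (v t)
      ≤ C * Real.exp (-r * (t - s)) * entropy Ω p V (v s) :=
        hdecay s t ((le_max_right _ _).trans hs) ht
    _ = C * Real.exp (r * s) * entropy Ω p V (v s) * Real.exp (-r * t) := by
        rw [show -r * (t - s) = r * s + -r * t by ring, Real.exp_add]
        ring
    _ ≤ Real.exp (s ^ 2) * (if 0 < entropy Ω p V (v s) then entropy Ω p V (v s) else 1) *
        Real.exp (-r * t) := by gcongr
    _ = _ := by ring
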